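/- Write $y=\operatorname{Im} z$ and let $m$ be Lebesgue measure on $\mathbb C$. For $f\in L^2(\mathbb R)$ let $C_f(z)=\frac1{2\pi i}\int_{\mathbb R}\frac{f(x)}{x-z}\,dx$, $z\in\mathbb C\setminus\mathbb R$, and let $C_f'$ be the derivative of this holomorphic function on $\mathbb C\setminus\mathbb R$ (with no distributional part on $\mathbb R$). Let $S$ be the Beurling transform, $Sg(z)=-\frac1\pi\,\mathrm{p.v.}\int_{\mathbb C}\frac{g(w)}{(w-z)^2}\,dm(w)$. Let $\mu\in L^\infty(\mathbb C)$ with $\|\mu\|_\infty<1$. Suppose that $|\mu|^2/|y|\,dm$ is a Carleson measure relative to $\mathbb R$: there is a constant $A$ with $\int_{|z-x|\le r}\frac{|\mu(z)|^2}{|y|}\,dm(z)\le A\,r$ for all $x\in\mathbb R$, $r>0$. Suppose also that $I-\mu S$ is invertible on $L^2(dm/|y|)$, in the following sense: there is a constant $B$ such that for every compactly supported $\Phi\in L^2(dm/|y|)$ the unique $h\in L^2(\mathbb C)$ with $h-\mu Sh=\Phi$ satisfies $\int_{\mathbb C}|h|^2\frac{dm}{|y|}\le B\int_{\mathbb C}|\Phi|^2\frac{dm}{|y|}$.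 Then there is a constant $c>0$, depending only on $A$ and $B$, such that the following holds. If $f\in L^2(\mathbb R)$, and if $H\in W^{1,2}_{\mathrm{loc}}(\mathbb C)$ satisfies $$\overline\partial H-\mu\,\partial H=\mu\,C_f'\qquad\text{a.e. in }\mathbb C$$ and vanishes at infinity in the sense that $R^{-2}\int_{R<|z|<2R}|H|^2\,dm\to0$ as $R\to\infty$ (for instance if $H(z)\to0$ as $z\to\infty$), then the boundary values $H|_{\mathbb R}$ (the limit of $H$ in the mean over discs $B(x,r)$, $r\to0$, at a.e. $x\in\mathbb R$) exist a.e., belong to $L^2(\mathbb R)$, and satisfy $\|H|_{\mathbb R}\|_{2}\le c\,\|f\|_{2}$. -/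

import Mathlib

open MeasureTheory Filter Topology
open scoped NNReal ENNReal ContDiff

noncomputable section

/-- The Cauchy integral over the real line,
`C_f(z) = (1 / 2πi) ∫_ℝ f(x) / (x - z) dx` (for `z` off the real line). -/
def lineCauchyIntegral (f : ℝ → ℂ) (z : ℂ) : ℂ :=
  (2 * (Real.pi : ℂ) * Complex.I)⁻¹ * ∫ x : ℝ, f x / ((x : ℂ) - z)

/-- `C'_f`: the complex derivative of the holomorphic function `C_f` on `ℂ \ ℝ`. It carries no
distributional part on `ℝ`; on the null set `ℝ` it is set to `0`. -/
def lineCauchyDeriv (f : ℝ → ℂ) (z : ℂ) : ℂ :=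
  if z.im = 0 then 0 else deriv (lineCauchyIntegral f) z

/-- The Beurling transform, a principal value integral:
`S f(z) = -(1/π) lim_{ε → 0+} ∫_{|w - z| > ε} f(w) / (w - z)² dm(w)`.
For `f ∈ L²(ℂ)` every truncated integral converges absolutely and the limit exists for
almost every `z`. -/
def beurling (f : ℂ → ℂ) (z : ℂ) : ℂ :=
  limUnder (𝓝[>] (0 : ℝ)) fun ε : ℝ =>
    -(1 / (Real.pi : ℂ)) * ∫ w in {w : ℂ | ε < ‖w - z‖}, f w / (w - z) ^ 2

/-- The squared norm `∫ |f|² dm/|y|` (`y = Im z`) of the space `L²(dm/|y|)`. -/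
def weightedSq (f : ℂ → ℂ) : ℝ≥0∞ :=
  ∫⁻ z : ℂ, ‖f z‖ₑ ^ 2 / ‖z.im‖ₑ

/-- `σ` is a Carleson measure relative to `ℝ`, with constant `A`. -/
def IsCarlesonWith (σ : Measure ℂ) (A : ℝ≥0) : Prop :=
  ∀ (x r : ℝ), 0 < r → σ {w : ℂ | ‖w - (x : ℂ)‖ ≤ r} ≤ A * ENNReal.ofReal r

/-- The measure `|μ|²/|y| dm`. -/
def dilatationMeasure (μ : ℂ → ℂ) : Measure ℂ :=
  volume.withDensity fun z => ‖μ z‖ₑ ^ 2 / ‖z.im‖ₑ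

/-- `I - μ S` is invertible on `L²(dm/|y|)`, with constant `B`: for every compactly supported `Φ`
in `L²(dm/|y|)` (hence in `L²(ℂ)`) the element `h = (I - μ S)⁻¹ Φ` of `L²(ℂ)` satisfies
`∫ |h|² dm/|y| ≤ B ∫ |Φ|² dm/|y|`. As `‖μ‖_∞ < 1` and `S` is an isometry of `L²(ℂ)`, the equation
`h - μ S h = Φ` has exactly one solution `h` in `L²(ℂ)`. -/
def InvertibleWith (μ : ℂ → ℂ) (B : ℝ≥0) : Prop :=
  ∀ Φ h : ℂ → ℂ, AEStronglyMeasurable Φ → HasCompactSupport Φ → weightedSq Φ < ⊤ →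
    MemLp h 2 → (∀ᵐ z : ℂ, h z - μ z * beurling h z = Φ z) →
      weightedSq h ≤ B * weightedSq Φ

/-- `∂φ = (φ_x - i φ_y) / 2`. -/
def wirtinger (φ : ℂ → ℂ) (z : ℂ) : ℂ :=
  (fderiv ℝ φ z 1 - Complex.I * fderiv ℝ φ z Complex.I) / 2

/-- `∂̄φ = (φ_x + i φ_y) / 2`. -/
def wirtingerBar (φ : ℂ → ℂ) (z : ℂ) : ℂ :=
  (fderiv ℝ φ z 1 + Complex.I * fderiv ℝ φ z Complex.I) / 2

/-- `u ∈ L²_loc(ℂ)`. -/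
def MemL2Loc (u : ℂ → ℂ) : Prop :=
  ∀ K : Set ℂ, IsCompact K → MemLp u 2 (volume.restrict K)

/-- `H ∈ W^{1,2}_loc(ℂ)`, and its weak derivatives are `∂H = p` and `∂̄H = q`. -/
structure IsW12Loc (H p q : ℂ → ℂ) : Prop where
  memH : MemL2Loc H
  memP : MemL2Loc p
  memQ : MemL2Loc q
  weakDz : ∀ φ : ℂ → ℂ, ContDiff ℝ ∞ φ → HasCompactSupport φ →
    ∫ z, H z * wirtinger φ z = -∫ z, p z * φ z
  weakDzBar : ∀ φ : ℂ → ℂ, ContDiff ℝ ∞ φ → HasCompactSupport φ →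
    ∫ z, H z * wirtingerBar φ z = -∫ z, q z * φ z

/-- `H` vanishes at infinity in quadratic mean: `R⁻² ∫_{R < |z| < 2R} |H|² dm → 0` as `R → ∞`. -/
def VanishesAtInfty (H : ℂ → ℂ) : Prop :=
  Tendsto (fun R : ℝ => (R ^ 2)⁻¹ * ∫ z in {z : ℂ | R < ‖z‖ ∧ ‖z‖ < 2 * R}, ‖H z‖ ^ 2)
    atTop (𝓝 0)

/-- `u` is the restriction (trace) `H|_ℝ`: for almost every real `x`, `u(x)` is the Lebesgue value
of `H` at `x`, that is, the mean of `|H - u(x)|` over the disc `B(x, r)` tends to `0`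
as `r → 0`. -/
def IsTraceOnReal (H : ℂ → ℂ) (u : ℝ → ℂ) : Prop :=
  ∀ᵐ x : ℝ, Tendsto (fun r : ℝ => ⨍ w in Metric.ball (x : ℂ) r, ‖H w - u x‖) (𝓝[>] 0) (𝓝 0)

end

/-! The estimate is proved by duality. For compactly supported $g\in L^2(\mathbb R)$ the jump
relation says that $\int C_g\,\overline\partial\varphi\,dm=\frac1{2i}\int_{\mathbb R}g\varphi\,dx$,
so formally $\int gH\,dx=2i\int C_g\,\overline\partial H\,dm$. Let $k$ solve the dual equation
$k-\mu Sk=\mu C_g$ and put $K=Sk$. Then $\int K\,\overline\partial H=\int k\,\partial H$ and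
$\mu(C_g+K)=k$. Inserting $\overline\partial H=\mu\,\partial H+\mu C_f'$, the terms with $\partial
H$ cancel and $\int gH\,dx=2i\int C_f'\,k\,dm$.

Cauchy-Schwarz with the weights $|y|$ and $1/|y|$ leaves two factors. The Littlewood-Paley estimate
`lintegral_sq_lineCauchyDeriv_le` gives $\int|C_f'|^2|y|\,dm\le2\|f\|_2^2$. Invertibility of $I-\mu
S$ on $L^2(dm/|y|)$ and the Carleson embedding `lintegral_sq_lineCauchyIntegral_le_carleson` give
$\int|k|^2/|y|\,dm\le B\int|\mu|^2|C_g|^2/|y|\,dm\le12288AB\|g\|_2^2$.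

To make this rigorous, $C_g$ is cut off to a large disc, because it need not lie in $L^2(\mathbb C)$
and the invertibility hypothesis asks for compact support. $H$ is multiplied by a cutoff $\chi_j$ at
scale $2^j$. The error $\int(C_g+K)H(\overline\partial\chi_j-\mu\,\partial\chi_j)$ lives on a dyadic
annulus. The mass of $|C_g+K|^2$ grows only logarithmically with the radius of the disc, so a
pigeonhole argument finds an annulus of bounded mass, and there the decay of $H$ makes the error
small. This is `enorm_integral_mul_trace_le` and `exists_enorm_integral_mul_trace_le`.

Two analytic facts are needed besides. The principal value `beurling` agrees a.e. with the $L^2$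
extension of $\overline\partial\varphi\mapsto\partial\varphi$ (`beurling_ae_eq`), since a truncated
integral is exactly a disc mean of that extension. A compactly supported $W^{1,2}$ function has
Lebesgue values a.e. on $\mathbb R$, equal to the $L^2$ limit of its mollifications there
(`exists_isTraceOnReal`). -/

section HalfPlane

open scoped FourierTransform

/-! ### Bilinear pairings in $L^2$ -/

section L2Pairing

variable {α : Type*} [MeasurableSpace α] {ν : Measure α}

lemma integral_mul_eq_inner {e : α → ℂ} (he : MemLp e 2 ν) (f : Lp ℂ 2 ν) :
    ∫ x, f x * e x ∂ν = inner ℂ (he.star.toLp) f := by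
  rw [L2.inner_def]
  refine integral_congr_ae ?_
  filter_upwards [he.star.coeFn_toLp] with x hx
  rw [hx]
  simp [mul_comm]

/-- The density arguments below rest on this: an identity between pairings with fixed $L^2$
functions is a closed condition on `f`. -/
lemma continuous_integral_mul {e : α → ℂ} (he : MemLp e 2 ν) :
    Continuous fun f : Lp ℂ 2 ν => ∫ x, f x * e x ∂ν := by
  simp_rw [integral_mul_eq_inner he]
  fun_prop

lemma integrable_mul_of_memLp_two {f g : α → ℂ} (hf : MemLp f 2 ν) (hg : MemLp g 2 ν) :
    Integrable (fun x => f x * g x) ν :=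
  MemLp.integrable_mul hf hg

lemma lintegral_enorm_sq_eq {β : Type*} [NormedAddCommGroup β] (f : α → β) :
    ∫⁻ x, ‖f x‖ₑ ^ 2 ∂ν = eLpNorm f 2 ν ^ 2 := by
  have := eLpNorm_nnreal_pow_eq_lintegral (f := f) (μ := ν) (p := 2) two_ne_zero
  simpa using this.symm

lemma memLp_two_of_lintegral_lt_top {β : Type*} [NormedAddCommGroup β] {f : α → β}
    (hf : AEStronglyMeasurable f ν)
    (h : ∫⁻ x, ‖f x‖ₑ ^ 2 ∂ν < ⊤) : MemLp f 2 ν := by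
  refine ⟨hf, ?_⟩
  rw [lintegral_enorm_sq_eq] at h
  simpa using h

/-- Cauchy-Schwarz for the bilinear pairing. -/
lemma enorm_integral_mul_le (f g : α → ℂ) (hf : AEStronglyMeasurable f ν)
    (hg : AEStronglyMeasurable g ν) :
    ‖∫ x, f x * g x ∂ν‖ₑ ≤ eLpNorm f 2 ν * eLpNorm g 2 ν := by
  refine (enorm_integral_le_lintegral_enorm _).trans ?_
  have := eLpNorm_smul_le_mul_eLpNorm (p := 2) (q := 2) (r := 1) hg hf
  simpa [eLpNorm_one_eq_lintegral_enorm] using this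

end L2Pairing

/-! ### The Fourier transform on $L^2(\mathbb R)$ -/

section Fourier

lemma integral_fourier_mul_eq_of_integrable {f e : ℝ → ℂ} (hf : Integrable f)
    (he : Integrable e) : ∫ ξ, 𝓕 f ξ * e ξ = ∫ t, f t * 𝓕 e t := by
  have := VectorFourier.integral_bilin_fourierIntegral_eq_flip (.mul ℂ ℂ) (L := innerₗ ℝ)
    Real.continuous_fourierChar continuous_inner hf he
  simpa using! this

/-- The multiplication formula extends from Schwartz functions by density, both sides being
continuous in `f` because `e` and `𝓕 e` are square integrable. -/
lemma integral_fourier_mul_eq_of_memLp (f : Lp ℂ 2 (volume : Measure ℝ)) {e : ℝ → ℂ}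
    (he : Integrable e) (he2 : MemLp e 2) (heF : MemLp (𝓕 e) 2) :
    ∫ ξ, (𝓕 f : Lp ℂ 2 (volume : Measure ℝ)) ξ * e ξ = ∫ t, f t * 𝓕 e t := by
  have hc : Continuous fun f : Lp ℂ 2 (volume : Measure ℝ) =>
      ∫ ξ, (𝓕 f : Lp ℂ 2 (volume : Measure ℝ)) ξ * e ξ :=
    (continuous_integral_mul he2).comp (Lp.fourierTransformₗᵢ ℝ ℂ).continuous
  have hd : DenseRange (fun φ : SchwartzMap ℝ ℂ => φ.toLp 2 (volume : Measure ℝ)) :=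
    SchwartzMap.denseRange_toLpCLM (E := ℝ) (F := ℂ) (p := 2) (μ := volume) ENNReal.ofNat_ne_top
  refine DenseRange.induction_on (p := fun f : Lp ℂ 2 (volume : Measure ℝ) =>
    ∫ ξ, (𝓕 f : Lp ℂ 2 (volume : Measure ℝ)) ξ * e ξ = ∫ t, f t * 𝓕 e t)
    hd f ?_ ?_
  · exact isClosed_eq hc (continuous_integral_mul heF)
  · intro φ
    rw [SchwartzMap.toLp_fourier_eq]
    have h1 : ∫ ξ, (𝓕 φ).toLp 2 volume ξ * e ξ = ∫ ξ, 𝓕 (φ : ℝ → ℂ) ξ * e ξ := by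
      refine integral_congr_ae ?_
      filter_upwards [(𝓕 φ).coeFn_toLp 2 volume] with x hx
      rw [hx]; rfl
    have h2 : ∫ ξ, φ.toLp 2 volume ξ * 𝓕 e ξ = ∫ ξ, φ ξ * 𝓕 e ξ := by
      refine integral_congr_ae ?_
      filter_upwards [φ.coeFn_toLp 2 volume] with x hx
      rw [hx]
    rw [h1, h2]
    exact integral_fourier_mul_eq_of_integrable φ.integrable he

/-- On `L¹ ∩ L²` the Fourier integral agrees with the `L²` Fourier transform. -/
lemma fourier_toLp_ae_eq {m : ℝ → ℂ} (hm : Integrable m) (hm2 : MemLp m 2) :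
    (𝓕 (hm2.toLp m) : Lp ℂ 2 (volume : Measure ℝ)) =ᵐ[volume] 𝓕 m := by
  have hcont : Continuous (𝓕 m) := by
    exact VectorFourier.fourierIntegral_continuous Real.continuous_fourierChar
      (by exact continuous_inner) hm
  refine ae_eq_of_integral_contDiff_smul_eq
    ((Lp.memLp _).locallyIntegrable (by norm_num)) hcont.locallyIntegrable ?_
  intro g hg hgc
  have hg' : HasCompactSupport (fun x => (g x : ℂ)) := hgc.comp_left (g := Complex.ofReal) (by simp)
  have hgd : ContDiff ℝ ∞ (fun x => (g x : ℂ)) := Complex.ofRealCLM.contDiff.comp hg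
  set φ : SchwartzMap ℝ ℂ := hg'.toSchwartzMap hgd with hφ
  have hφg : ∀ x, φ x = g x := fun x => rfl
  have h1 := integral_fourier_mul_eq_of_memLp (hm2.toLp m) φ.integrable (φ.memLp 2)
    (SchwartzMap.fourier_coe φ ▸ (𝓕 φ).memLp 2 volume)
  have h2 := integral_fourier_mul_eq_of_integrable hm φ.integrable
  have h3 : ∫ t, hm2.toLp m t * 𝓕 (φ : ℝ → ℂ) t = ∫ t, m t * 𝓕 (φ : ℝ → ℂ) t := by
    refine integral_congr_ae ?_
    filter_upwards [hm2.coeFn_toLp] with x hx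
    rw [hx]
  rw [h3, ← h2] at h1
  simpa [hφg, mul_comm] using h1

lemma eLpNorm_fourierIntegral {m : ℝ → ℂ} (hm : Integrable m) (hm2 : MemLp m 2) :
    eLpNorm (𝓕 m) 2 volume = eLpNorm m 2 volume := by
  rw [← eLpNorm_congr_ae (fourier_toLp_ae_eq hm hm2), ← Lp.enorm_def]
  rw [← ofReal_norm, Lp.norm_fourier_eq, ofReal_norm, Lp.enorm_def, eLpNorm_congr_ae hm2.coeFn_toLp]

end Fourier

lemma memLp_fourierIntegral {m : ℝ → ℂ} (hm : Integrable m) (hm2 : MemLp m 2) :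
    MemLp (𝓕 m) 2 :=
  (memLp_congr_ae (fourier_toLp_ae_eq hm hm2)).1 (Lp.memLp _)

/-- A representative of the `L²` Fourier transform of `f`. -/
noncomputable def l2Fourier (f : ℝ → ℂ) (hf : MemLp f 2) : ℝ → ℂ :=
  (𝓕 (hf.toLp f) : Lp ℂ 2 (volume : Measure ℝ))

lemma memLp_l2Fourier {f : ℝ → ℂ} (hf : MemLp f 2) : MemLp (l2Fourier f hf) 2 := Lp.memLp _

lemma measurable_l2Fourier {f : ℝ → ℂ} (hf : MemLp f 2) : Measurable (l2Fourier f hf) :=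
  (Lp.stronglyMeasurable _).measurable

lemma eLpNorm_l2Fourier {f : ℝ → ℂ} (hf : MemLp f 2) :
    eLpNorm (l2Fourier f hf) 2 volume = eLpNorm f 2 volume := by
  rw [l2Fourier, ← Lp.enorm_def, ← ofReal_norm, Lp.norm_fourier_eq, ofReal_norm, Lp.enorm_def,
    eLpNorm_congr_ae hf.coeFn_toLp]

/-! ### Half-line exponentials and their Fourier transforms -/

section HalfLine

/-- The exponential `ξ ↦ e^{2πiξz}` cut off to the positive half line. -/
noncomputable def halfExp (z : ℂ) : ℝ → ℂ :=
  (Set.Ioi (0 : ℝ)).indicator fun ξ => Complex.exp (2 * Real.pi * Complex.I * z * ξ)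

lemma norm_exp_two_pi (z : ℂ) (ξ : ℝ) :
    ‖Complex.exp (2 * Real.pi * Complex.I * z * ξ)‖ = Real.exp (-(2 * Real.pi * z.im) * ξ) := by
  rw [Complex.norm_exp]
  congr 1
  simp [Complex.mul_re, Complex.mul_im]

lemma measurable_halfExp (z : ℂ) : Measurable (halfExp z) := by
  refine Measurable.indicator ?_ measurableSet_Ioi
  fun_prop

lemma integrable_halfExp {z : ℂ} (hz : 0 < z.im) : Integrable (halfExp z) := by
  rw [halfExp, integrable_indicator_iff measurableSet_Ioi]
  refine integrableOn_exp_mul_complex_Ioi ?_ 0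
  simp [Complex.mul_re, Complex.mul_im]
  positivity

lemma norm_halfExp_le (z : ℂ) (hz : 0 < z.im) (ξ : ℝ) : ‖halfExp z ξ‖ ≤ 1 := by
  rw [halfExp]
  by_cases h : ξ ∈ Set.Ioi (0 : ℝ)
  · rw [Set.indicator_of_mem h, norm_exp_two_pi, Real.exp_le_one_iff]
    have : 0 < ξ := h
    have := mul_pos (mul_pos Real.two_pi_pos hz) this
    linarith
  · rw [Set.indicator_of_notMem h]; simp

lemma memLp_halfExp {z : ℂ} (hz : 0 < z.im) : MemLp (halfExp z) 2 := by
  rw [memLp_two_iff_integrable_sq_norm (measurable_halfExp z).aestronglyMeasurable]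
  refine (integrable_halfExp hz).norm.mono'
    ((measurable_halfExp z).norm.pow_const 2).aestronglyMeasurable
    (Eventually.of_forall fun ξ => ?_)
  rw [Real.norm_of_nonneg (by positivity)]
  have := norm_halfExp_le z hz ξ
  nlinarith [norm_nonneg (halfExp z ξ)]

lemma fourier_halfExp {z : ℂ} (hz : 0 < z.im) (t : ℝ) :
    𝓕 (halfExp z) t = (2 * (Real.pi : ℂ) * Complex.I)⁻¹ / ((t : ℂ) - z) := by
  rw [Real.fourier_eq']
  have : ∀ ξ : ℝ, Complex.exp (↑(-2 * Real.pi * inner ℝ ξ t) * Complex.I) • halfExp z ξ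
      = (Set.Ioi (0 : ℝ)).indicator
        (fun ξ : ℝ => Complex.exp (2 * Real.pi * Complex.I * (z - t) * ξ)) ξ := by
    intro ξ
    by_cases h : ξ ∈ Set.Ioi (0 : ℝ)
    · rw [halfExp, Set.indicator_of_mem h, Set.indicator_of_mem h, smul_eq_mul, ← Complex.exp_add]
      congr 1
      simp
      ring
    · rw [halfExp, Set.indicator_of_notMem h, Set.indicator_of_notMem h, smul_zero]
  simp_rw [this]
  rw [integral_indicator measurableSet_Ioi, integral_exp_mul_complex_Ioi]
  · have h1 : (t : ℂ) - z ≠ 0 := fun h => by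
      have := congrArg Complex.im h
      simp at this
      linarith
    have h2 : z - (t : ℂ) ≠ 0 := fun h => h1 (by rw [← neg_sub, h, neg_zero])
    have h3 : (Real.pi : ℂ) ≠ 0 := by exact_mod_cast Real.pi_ne_zero
    have h4 := Complex.I_ne_zero
    simp
    field_simp
    rw [Complex.I_sq]
    ring
  · simp [Complex.mul_re, Complex.mul_im]
    positivity

end HalfLine

/-! ### The Cauchy integral in the upper half plane as a Fourier integral -/

/-- The Cauchy kernel is the Fourier transform of `halfExp z`, so the multiplication formula gives
$C_f(z)=\int_0^\infty\hat f(\xi)e^{2\pi i\xi z}\,d\xi$: above the real line only positive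
frequencies are seen. -/
lemma lineCauchyIntegral_eq {f : ℝ → ℂ} (hf : MemLp f 2) {z : ℂ} (hz : 0 < z.im) :
    lineCauchyIntegral f z = ∫ ξ, l2Fourier f hf ξ * halfExp z ξ := by
  rw [l2Fourier, integral_fourier_mul_eq_of_memLp _ (integrable_halfExp hz) (memLp_halfExp hz)
    (memLp_fourierIntegral (integrable_halfExp hz) (memLp_halfExp hz)), lineCauchyIntegral,
    ← integral_const_mul]
  refine integral_congr_ae ?_
  filter_upwards [hf.coeFn_toLp] with t ht
  rw [ht, fourier_halfExp hz]
  ring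

/-- Half of the exponential decay pays for the factor $\xi$, since $\xi e^{-2\pi s\xi}\le(2\pi
s)^{-1}$. The bound dominates the differentiated integrand uniformly in $z$. -/
lemma norm_id_mul_halfExp_le {z : ℂ} {s : ℝ} (hs : 0 < s) (hsz : 2 * s ≤ z.im)
    (ξ : ℝ) : ‖(ξ : ℂ) * halfExp z ξ‖ ≤ (2 * Real.pi * s)⁻¹ * ‖halfExp (s * Complex.I) ξ‖ := by
  by_cases h : ξ ∈ Set.Ioi (0 : ℝ)
  · have hξ : 0 < ξ := h
    rw [halfExp, halfExp, Set.indicator_of_mem h, Set.indicator_of_mem h, norm_mul,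
      norm_exp_two_pi, norm_exp_two_pi, Complex.norm_real, Real.norm_eq_abs, abs_of_pos hξ]
    have hc : 0 < 2 * Real.pi * s := by positivity
    have h1 : Real.exp (-(2 * Real.pi * z.im) * ξ) ≤
        Real.exp (-(2 * Real.pi * s * ξ)) * Real.exp (-(2 * Real.pi * s) * ξ) := by
      rw [← Real.exp_add, Real.exp_le_exp]
      have := mul_le_mul_of_nonneg_left hsz (mul_pos Real.two_pi_pos hξ).le
      nlinarith
    have h2 : 2 * Real.pi * s * ξ * Real.exp (-(2 * Real.pi * s * ξ)) ≤ 1 := by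
      have := Real.add_one_le_exp (2 * Real.pi * s * ξ)
      rw [Real.exp_neg, ← div_eq_mul_inv, div_le_one (Real.exp_pos _)]
      linarith
    have h3 : ξ * Real.exp (-(2 * Real.pi * s * ξ)) ≤ (2 * Real.pi * s)⁻¹ := by
      rw [inv_eq_one_div, le_div_iff₀ hc]
      linarith
    calc ξ * Real.exp (-(2 * Real.pi * z.im) * ξ)
        ≤ ξ * (Real.exp (-(2 * Real.pi * s * ξ)) * Real.exp (-(2 * Real.pi * s) * ξ)) := by gcongr
      _ = ξ * Real.exp (-(2 * Real.pi * s * ξ)) * Real.exp (-(2 * Real.pi * s) * ξ) := by ring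
      _ ≤ _ := by
        simp only [Complex.mul_im, Complex.ofReal_re, Complex.I_im, mul_one, Complex.ofReal_im,
          Complex.I_re, mul_zero, add_zero]
        gcongr
  · rw [halfExp, halfExp, Set.indicator_of_notMem h, Set.indicator_of_notMem h]; simp

lemma memLp_id_mul_halfExp {z : ℂ} (hz : 0 < z.im) : MemLp (fun ξ : ℝ => (ξ : ℂ) * halfExp z ξ) 2 := by
  have hs : 0 < z.im / 2 := by positivity
  refine MemLp.of_le_mul (c := (2 * Real.pi * (z.im / 2))⁻¹)
    (memLp_halfExp (z := (z.im / 2 : ℝ) * Complex.I) (by simpa using hs)) ?_ ?_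
  · exact (Complex.measurable_ofReal.mul (measurable_halfExp z)).aestronglyMeasurable
  · exact Eventually.of_forall fun ξ => norm_id_mul_halfExp_le hs (by linarith) ξ

lemma hasDerivAt_lineCauchyIntegral {f : ℝ → ℂ} (hf : MemLp f 2) {z : ℂ} (hz : 0 < z.im) :
    HasDerivAt (lineCauchyIntegral f)
      (∫ ξ, l2Fourier f hf ξ * (2 * Real.pi * Complex.I) * (ξ * halfExp z ξ)) z := by
  -- On the disc of radius $2s$ about $z$ the imaginary part stays above $4s-2s=2s$, the margin that
  -- `norm_id_mul_halfExp_le` asks for.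
  set s := z.im / 4 with hs
  have hs0 : 0 < s := by positivity
  have hball : ∀ w ∈ Metric.ball z (2 * s), 2 * s ≤ w.im := by
    intro w hw
    have h1 : |(w - z).im| ≤ ‖w - z‖ := Complex.abs_im_le_norm _
    rw [Metric.mem_ball, dist_eq_norm] at hw
    have := abs_le.1 (h1.trans hw.le)
    simp at this
    linarith [this.1]
  have key := hasDerivAt_integral_of_dominated_loc_of_deriv_le (𝕜 := ℂ) (μ := (volume : Measure ℝ))
    (F := fun w ξ => l2Fourier f hf ξ * halfExp w ξ)
    (F' := fun w ξ => l2Fourier f hf ξ * (2 * Real.pi * Complex.I) * (ξ * halfExp w ξ))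
    (x₀ := z) (s := Metric.ball z (2 * s))
    (bound := fun ξ => ‖l2Fourier f hf ξ * (2 * Real.pi * Complex.I) *
        ((2 * Real.pi * s)⁻¹ * halfExp (s * Complex.I) ξ)‖)
    (Metric.ball_mem_nhds z (by positivity)) ?_ ?_ ?_ ?_ ?_ ?_
  · refine key.2.congr_of_eventuallyEq ?_
    filter_upwards [Metric.ball_mem_nhds z (show 0 < 2 * s by positivity)] with w hw
    exact lineCauchyIntegral_eq hf (by linarith [hball w hw])
  · exact Eventually.of_forall fun w =>
      ((measurable_l2Fourier hf).mul (measurable_halfExp w)).aestronglyMeasurable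
  · exact integrable_mul_of_memLp_two (memLp_l2Fourier hf) (memLp_halfExp hz)
  · exact (((measurable_l2Fourier hf).mul_const _).mul
      (Complex.measurable_ofReal.mul (measurable_halfExp z))).aestronglyMeasurable
  · refine Eventually.of_forall fun ξ w hw => ?_
    have h := norm_id_mul_halfExp_le (z := w) hs0 (hball w hw) ξ
    rw [norm_mul, norm_mul _ (_ * halfExp _ _)]
    refine mul_le_mul_of_nonneg_left (h.trans_eq ?_) (norm_nonneg _)
    rw [norm_mul]
    congr 1
    simp [abs_of_pos hs0, abs_of_pos Real.pi_pos]
  · refine (integrable_mul_of_memLp_two ?_ ?_).norm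
    · exact (memLp_l2Fourier hf).mul_const _ 
    · exact (memLp_halfExp (z := s * Complex.I) (by simpa using hs0)).const_mul _
  · refine Eventually.of_forall fun ξ w _ => ?_
    by_cases h : ξ ∈ Set.Ioi (0 : ℝ)
    · simp only [halfExp, Set.indicator_of_mem h]
      have h1 : HasDerivAt (fun w : ℂ => 2 * Real.pi * Complex.I * w * (ξ : ℂ))
          (2 * Real.pi * Complex.I * (ξ : ℂ)) w := by
        simpa using ((hasDerivAt_id w).const_mul (2 * Real.pi * Complex.I : ℂ)).mul_const (ξ : ℂ)
      refine ((h1.cexp).const_mul (l2Fourier f hf ξ)).congr_deriv ?_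
      ring
    · simp only [halfExp, Set.indicator_of_notMem h, mul_zero]
      exact hasDerivAt_const _ _

lemma halfExp_add_mul_I (x y ξ : ℝ) : halfExp (x + y * Complex.I) ξ =
    Complex.exp (2 * Real.pi * Complex.I * x * ξ) * halfExp (y * Complex.I) ξ := by
  by_cases h : ξ ∈ Set.Ioi (0 : ℝ)
  · rw [halfExp, halfExp, Set.indicator_of_mem h, Set.indicator_of_mem h, ← Complex.exp_add]
    congr 1
    ring
  · rw [halfExp, halfExp, Set.indicator_of_notMem h, Set.indicator_of_notMem h, mul_zero]

/-- Plancherel on a horizontal line: as a function of $x$ the inner integral is a Fourier transform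
evaluated at $-x$. -/
lemma lintegral_sq_integral_mul_halfExp {a : ℝ → ℂ} {y : ℝ}
    (h1 : Integrable fun ξ => a ξ * halfExp (y * Complex.I) ξ)
    (h2 : MemLp (fun ξ => a ξ * halfExp (y * Complex.I) ξ) 2) :
    ∫⁻ x : ℝ, ‖∫ ξ, a ξ * halfExp (x + y * Complex.I) ξ‖ₑ ^ 2 =
      ∫⁻ ξ, ‖a ξ * halfExp (y * Complex.I) ξ‖ₑ ^ 2 := by
  have h : ∀ x : ℝ, ∫ ξ, a ξ * halfExp (x + y * Complex.I) ξ =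
      𝓕 (fun ξ => a ξ * halfExp (y * Complex.I) ξ) (-x) := by
    intro x
    rw [Real.fourier_eq']
    refine integral_congr_ae (Eventually.of_forall fun ξ => ?_)
    simp only [halfExp_add_mul_I, smul_eq_mul]
    rw [mul_left_comm]
    congr 2
    simp
    ring
  simp_rw [h]
  have := lintegral_neg_eq_self (μ := (volume : Measure ℝ))
    (fun x : ℝ => ‖𝓕 (fun ξ => a ξ * halfExp (y * Complex.I) ξ) x‖ₑ ^ 2)
  rw [this, lintegral_enorm_sq_eq, lintegral_enorm_sq_eq, eLpNorm_fourierIntegral h1 h2]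

lemma memLp_mul_of_bound {α : Type*} [MeasurableSpace α] {ν : Measure α} {a b : α → ℂ} {C : ℝ}
    (ha : MemLp a 2 ν) (hb : AEStronglyMeasurable b ν) (hC : ∀ x, ‖b x‖ ≤ C) :
    MemLp (fun x => a x * b x) 2 ν := by
  refine ha.of_le_mul (c := C) (ha.1.mul hb) (Eventually.of_forall fun x => ?_)
  rw [norm_mul, mul_comm]
  exact mul_le_mul_of_nonneg_right (hC x) (norm_nonneg _)

/-- The Cauchy integral is bounded in `L²` on every line parallel to `ℝ`. -/
lemma lintegral_sq_lineCauchyIntegral_le_of_pos {f : ℝ → ℂ} (hf : MemLp f 2) {y : ℝ} (hy : 0 < y) :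
    ∫⁻ x : ℝ, ‖lineCauchyIntegral f (x + y * Complex.I)‖ₑ ^ 2 ≤ eLpNorm f 2 volume ^ 2 := by
  have hz : 0 < ((y : ℂ) * Complex.I).im := by simpa using hy
  have h : ∀ x : ℝ, lineCauchyIntegral f (x + y * Complex.I) =
      ∫ ξ, l2Fourier f hf ξ * halfExp (x + y * Complex.I) ξ := fun x =>
    lineCauchyIntegral_eq hf (by simpa using hy)
  simp_rw [h]
  rw [lintegral_sq_integral_mul_halfExp
    (integrable_mul_of_memLp_two (memLp_l2Fourier hf) (memLp_halfExp hz))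
    (memLp_mul_of_bound (memLp_l2Fourier hf) (measurable_halfExp _).aestronglyMeasurable
      (norm_halfExp_le _ hz)),
    ← eLpNorm_l2Fourier hf, ← lintegral_enorm_sq_eq]
  refine lintegral_mono fun ξ => ?_
  gcongr
  rw [enorm_mul]
  calc _ ≤ ‖l2Fourier f hf ξ‖ₑ * 1 := by
        gcongr
        rw [← ofReal_norm, ENNReal.ofReal_le_one]
        exact norm_halfExp_le _ hz ξ
    _ = _ := mul_one _

/-! ### Integration over half planes and the reflection $z\mapsto-z$ -/

lemma lintegral_complex {F : ℂ → ℝ≥0∞} (hF : Measurable F) :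
    ∫⁻ z, F z = ∫⁻ y : ℝ, ∫⁻ x : ℝ, F (x + y * Complex.I) := by
  rw [← (Complex.volume_preserving_equiv_real_prod.symm).lintegral_comp hF,
    Measure.volume_eq_prod, lintegral_prod_symm']
  · refine lintegral_congr fun y => lintegral_congr fun x => ?_
    congr 1
    apply Complex.ext <;> simp [Complex.measurableEquivRealProd]
  · exact hF.comp Complex.measurableEquivRealProd.symm.measurable

lemma measurableSet_im_pos : MeasurableSet {z : ℂ | 0 < z.im} :=
  measurableSet_lt measurable_const Complex.measurable_im

lemma setLIntegral_im_pos {F : ℂ → ℝ≥0∞} (hF : Measurable F) :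
    ∫⁻ z in {z : ℂ | 0 < z.im}, F z =
      ∫⁻ y in Set.Ioi (0 : ℝ), ∫⁻ x : ℝ, F (x + y * Complex.I) := by
  rw [← lintegral_indicator measurableSet_im_pos, ← lintegral_indicator measurableSet_Ioi,
    lintegral_complex (hF.indicator measurableSet_im_pos)]
  refine lintegral_congr fun y => ?_
  by_cases hy : 0 < y
  · rw [Set.indicator_of_mem (show y ∈ Set.Ioi 0 from hy)]
    refine lintegral_congr fun x => ?_
    rw [Set.indicator_of_mem]
    simpa using hy
  · rw [Set.indicator_of_notMem (show y ∉ Set.Ioi 0 from hy)]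
    rw [lintegral_eq_zero_of_ae_eq_zero]
    refine Eventually.of_forall fun x => ?_
    exact Set.indicator_of_notMem (by simpa using hy) _

lemma volume_im_eq_zero : volume {z : ℂ | z.im = 0} = 0 := by
  have hm : MeasurableSet {z : ℂ | z.im = 0} :=
    measurableSet_eq_fun Complex.measurable_im measurable_const
  rw [← lintegral_indicator_one hm, lintegral_complex (measurable_one.indicator hm)]
  refine lintegral_eq_zero_of_ae_eq_zero ?_
  have : ∀ᵐ y : ℝ, y ≠ 0 := by simp [ae_iff]
  filter_upwards [this] with y hy
  refine lintegral_eq_zero_of_ae_eq_zero (Eventually.of_forall fun x => ?_)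
  exact Set.indicator_of_notMem (by simpa using hy) _

lemma ae_im_ne_zero : ∀ᵐ z : ℂ, z.im ≠ 0 := by
  rw [ae_iff]
  simpa using volume_im_eq_zero

/-- Splitting an integral over the plane into the two half planes. -/
lemma lintegral_eq_im_pos_add {ν : Measure ℂ} (hν : ν {z : ℂ | z.im = 0} = 0) {F : ℂ → ℝ≥0∞}
    (hF : Measurable F) :
    ∫⁻ z, F z ∂ν = ∫⁻ z in {z : ℂ | 0 < z.im}, F z ∂ν +
      ∫⁻ z in {z : ℂ | 0 < z.im}, F (-z) ∂(ν.map Neg.neg) := by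
  rw [setLIntegral_map (f := fun z => F (-z)) measurableSet_im_pos (hF.comp measurable_neg) measurable_neg,
    ← lintegral_add_compl F measurableSet_im_pos]
  simp only [neg_neg]
  congr 1
  refine setLIntegral_congr ?_
  have : ∀ᵐ z ∂ν, z.im ≠ 0 := by
    rw [ae_iff]; simpa using hν
  filter_upwards [this] with z hz
  refine propext ?_
  change ¬ (0 < z.im) ↔ 0 < (-z).im
  simp only [Complex.neg_im, not_lt, Left.neg_pos_iff]
  exact ⟨fun h => lt_of_le_of_ne h hz, le_of_lt⟩

lemma lineCauchyIntegral_congr {f g : ℝ → ℂ} (h : f =ᵐ[volume] g) :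
    lineCauchyIntegral f = lineCauchyIntegral g := by
  ext z
  unfold lineCauchyIntegral
  congr 1
  refine integral_congr_ae ?_
  filter_upwards [h] with x hx
  rw [hx]

lemma measurable_lineCauchyIntegral {f : ℝ → ℂ} (hf : AEStronglyMeasurable f) :
    Measurable (lineCauchyIntegral f) := by
  rw [lineCauchyIntegral_congr hf.ae_eq_mk]
  refine Measurable.const_mul ?_ _
  have : StronglyMeasurable fun p : ℂ × ℝ => hf.mk f p.2 / ((p.2 : ℂ) - p.1) := by
    have h1 := hf.stronglyMeasurable_mk.measurable
    exact Measurable.stronglyMeasurable (by fun_prop)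
  exact this.integral_prod_right.measurable

lemma measurable_lineCauchyDeriv (f : ℝ → ℂ) : Measurable (lineCauchyDeriv f) := by
  refine Measurable.ite ?_ measurable_const (measurable_deriv _)
  exact measurableSet_eq_fun Complex.measurable_im measurable_const

/-- The reflection $z\mapsto-z$ exchanges the half planes and replaces $f$ by $f(-\cdot)$, so each
estimate has to be proved in the upper half plane only. -/
lemma lineCauchyIntegral_neg (f : ℝ → ℂ) (z : ℂ) :
    lineCauchyIntegral f (-z) = -lineCauchyIntegral (fun t => f (-t)) z := by
  unfold lineCauchyIntegral
  rw [← integral_neg_eq_self, ← mul_neg, ← integral_neg]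
  congr 2
  ext t
  push_cast
  rw [← div_neg]
  congr 1
  ring

lemma lineCauchyDeriv_neg (f : ℝ → ℂ) (z : ℂ) :
    lineCauchyDeriv f (-z) = lineCauchyDeriv (fun t => f (-t)) z := by
  unfold lineCauchyDeriv
  simp only [Complex.neg_im, neg_eq_zero]
  split_ifs
  · rfl
  · have : (fun w => lineCauchyIntegral f (-w)) = -lineCauchyIntegral (fun t => f (-t)) := by
      ext w; exact lineCauchyIntegral_neg f w
    have h2 := deriv_comp_neg (lineCauchyIntegral f) z
    rw [this, deriv.neg] at h2
    exact (neg_injective h2).symm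

lemma memLp_comp_neg {f : ℝ → ℂ} (hf : MemLp f 2) : MemLp (fun t => f (-t)) 2 :=
  hf.comp_measurePreserving (Measure.measurePreserving_neg volume)

lemma eLpNorm_comp_neg {f : ℝ → ℂ} (hf : MemLp f 2) :
    eLpNorm (fun t => f (-t)) 2 volume = eLpNorm f 2 volume :=
  eLpNorm_comp_measurePreserving hf.1 (Measure.measurePreserving_neg volume)

/-! ### The Littlewood-Paley estimate -/

lemma lintegral_Ioi_mul_exp {b : ℝ} (hb : 0 < b) :
    ∫⁻ y in Set.Ioi (0 : ℝ), ENNReal.ofReal (b ^ 2 * (y * Real.exp (-(b * y)))) = 1 := by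
  have h := Real.integral_rpow_mul_exp_neg_mul_Ioi (a := 2) (r := b) two_pos hb
  have hi : IntegrableOn (fun y : ℝ => y ^ ((2 : ℝ) - 1) * Real.exp (-(b * y))) (Set.Ioi 0) := by
    -- A non-integrable function has Bochner integral $0$, whereas the Gamma integral is positive;
    -- integrability follows.
    by_contra hc
    rw [integral_undef hc] at h
    have h2 : (0 : ℝ) < (1 / b) ^ (2 : ℝ) * Real.Gamma 2 := by
      have := Real.Gamma_pos_of_pos (show (0 : ℝ) < 2 by norm_num)
      positivity
    linarith
  have e : (2 : ℝ) - 1 = 1 := by norm_num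
  simp only [e, Real.rpow_one] at h hi
  rw [← ofReal_integral_eq_lintegral_ofReal (hi.const_mul _), integral_const_mul, h]
  · rw [Real.Gamma_two]
    norm_num
    field_simp
  · filter_upwards [ae_restrict_mem measurableSet_Ioi] with y hy
    have : 0 < y := hy
    positivity

/-- By Plancherel on each line and Tonelli, a frequency $\xi>0$ contributes $|\hat
f(\xi)|^2(2\pi\xi)^2\int_0^\infty ye^{-4\pi\xi y}\,dy=|\hat f(\xi)|^2/4$. The proof enlarges
$(2\pi\xi)^2$ to $(4\pi\xi)^2$, which normalises the integral to $1$. -/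
lemma setLIntegral_sq_lineCauchyDeriv_le {f : ℝ → ℂ} (hf : MemLp f 2) :
    ∫⁻ z in {z : ℂ | 0 < z.im}, ‖lineCauchyDeriv f z‖ₑ ^ 2 * ‖z.im‖ₑ ≤ eLpNorm f 2 volume ^ 2 := by
  have hm := measurable_lineCauchyDeriv f
  rw [setLIntegral_im_pos (by fun_prop)]
  have hG : Measurable fun p : ℝ × ℝ => l2Fourier f hf p.2 * (2 * Real.pi * Complex.I) * p.2 *
      halfExp (p.1 * Complex.I) p.2 := by
    have h1 := measurable_l2Fourier hf
    have h2 : Measurable fun p : ℝ × ℝ => halfExp (p.1 * Complex.I) p.2 := by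
      have : (fun p : ℝ × ℝ => halfExp (p.1 * Complex.I) p.2) =
        {p : ℝ × ℝ | 0 < p.2}.indicator
          (fun p => Complex.exp (2 * Real.pi * Complex.I * (p.1 * Complex.I) * p.2)) := by
        ext p
        simp [halfExp, Set.indicator]
      rw [this]
      refine Measurable.indicator (by fun_prop) (measurableSet_lt measurable_const measurable_snd)
    fun_prop
  calc _ = ∫⁻ y in Set.Ioi (0 : ℝ), ∫⁻ ξ : ℝ, ‖l2Fourier f hf ξ * (2 * Real.pi * Complex.I) * ξ *
          halfExp (y * Complex.I) ξ‖ₑ ^ 2 * ‖y‖ₑ := by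
        refine setLIntegral_congr_fun measurableSet_Ioi fun y hy => ?_
        have hy0 : 0 < y := hy
        have hz : 0 < ((y : ℂ) * Complex.I).im := by simpa using hy0
        have e : ∀ x : ℝ, lineCauchyDeriv f (x + y * Complex.I) =
            ∫ ξ, (l2Fourier f hf ξ * (2 * Real.pi * Complex.I) * ξ) *
              halfExp (x + y * Complex.I) ξ := by
          intro x
          have hx : 0 < ((x : ℂ) + y * Complex.I).im := by simpa using hy0
          rw [lineCauchyDeriv, if_neg hx.ne', (hasDerivAt_lineCauchyIntegral hf hx).deriv]
          simp only [mul_assoc]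
        have him : ∀ x : ℝ, ((x : ℂ) + y * Complex.I).im = y := by simp
        simp only [e, him]
        rw [lintegral_mul_const', lintegral_mul_const', lintegral_sq_integral_mul_halfExp]
        · have := integrable_mul_of_memLp_two
            ((memLp_l2Fourier hf).mul_const (2 * Real.pi * Complex.I)) (memLp_id_mul_halfExp hz)
          simpa only [mul_assoc] using this
        · have := memLp_mul_of_bound (b := fun ξ : ℝ => (ξ : ℂ) * halfExp (y * Complex.I) ξ)
            (C := (2 * Real.pi * (y / 2))⁻¹)
            ((memLp_l2Fourier hf).mul_const (2 * Real.pi * Complex.I))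
            (memLp_id_mul_halfExp hz).1 (fun ξ => by
              refine (norm_id_mul_halfExp_le (s := y / 2) (by positivity) (by simp; linarith)
                ξ).trans ?_
              refine mul_le_of_le_one_right (by positivity) (norm_halfExp_le _ ?_ _)
              simpa using hy0)
          simpa only [mul_assoc] using this
        · exact enorm_ne_top
        · exact enorm_ne_top
    _ = ∫⁻ ξ : ℝ, ∫⁻ y in Set.Ioi (0 : ℝ), ‖l2Fourier f hf ξ * (2 * Real.pi * Complex.I) * ξ *
          halfExp (y * Complex.I) ξ‖ₑ ^ 2 * ‖y‖ₑ := by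
        refine lintegral_lintegral_swap ?_
        refine Measurable.aemeasurable ?_
        exact (hG.enorm.pow_const 2).mul measurable_fst.enorm
    _ ≤ ∫⁻ ξ, ‖l2Fourier f hf ξ‖ₑ ^ 2 := by
        refine lintegral_mono fun ξ => ?_
        by_cases h : ξ ∈ Set.Ioi (0 : ℝ)
        · have hξ : 0 < ξ := h
          calc _ ≤ ∫⁻ y in Set.Ioi (0 : ℝ), ‖l2Fourier f hf ξ‖ₑ ^ 2 *
                ENNReal.ofReal ((4 * Real.pi * ξ) ^ 2 * (y * Real.exp (-((4 * Real.pi * ξ) * y)))) := by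
                refine setLIntegral_mono' measurableSet_Ioi fun y hy => ?_
                have hy0 : 0 < y := hy
                rw [mul_assoc, mul_assoc, enorm_mul, mul_pow, mul_assoc]
                gcongr
                rw [← ofReal_norm, ← ofReal_norm, ← ENNReal.ofReal_pow (norm_nonneg _),
                  ← ENNReal.ofReal_mul (by positivity)]
                refine ENNReal.ofReal_le_ofReal ?_
                rw [halfExp, Set.indicator_of_mem h, norm_mul (2 * (Real.pi : ℂ) * Complex.I),
                  norm_mul (ξ : ℂ), norm_exp_two_pi,
                  Real.norm_of_nonneg hy0.le]
                have e1 : ‖(2 * Real.pi * Complex.I : ℂ)‖ = 2 * Real.pi := by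
                  simp [abs_of_pos Real.pi_pos]
                have e2 : ‖(ξ : ℂ)‖ = ξ := by simp [abs_of_pos hξ]
                rw [e1, e2]
                have e3 : Real.exp (-((4 * Real.pi * ξ) * y)) =
                  Real.exp (-(2 * Real.pi * ((y : ℂ) * Complex.I).im) * ξ) ^ 2 := by
                  rw [sq, ← Real.exp_add]
                  congr 1
                  simp
                  ring
                rw [e3]
                have : (0 : ℝ) ≤ Real.pi ^ 2 * ξ ^ 2 * y *
                  Real.exp (-(2 * Real.pi * ((y : ℂ) * Complex.I).im) * ξ) ^ 2 := by positivity
                nlinarith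
            _ = _ := by
                rw [lintegral_const_mul' _ _ (by simp), lintegral_Ioi_mul_exp (by positivity),
                  mul_one]
        · simp [halfExp, Set.indicator_of_notMem h]
    _ = _ := by rw [lintegral_enorm_sq_eq, eLpNorm_l2Fourier hf]

lemma map_neg_volume_complex : (volume : Measure ℂ).map Neg.neg = volume :=
  (Measure.measurePreserving_neg volume).map_eq

/-- The Littlewood-Paley estimate for the Cauchy integral. -/
lemma lintegral_sq_lineCauchyDeriv_le {f : ℝ → ℂ} (hf : MemLp f 2) :
    ∫⁻ z : ℂ, ‖lineCauchyDeriv f z‖ₑ ^ 2 * ‖z.im‖ₑ ≤ 2 * eLpNorm f 2 volume ^ 2 := by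
  have hm := measurable_lineCauchyDeriv f
  rw [lintegral_eq_im_pos_add volume_im_eq_zero (by fun_prop), map_neg_volume_complex, two_mul]
  gcongr
  · exact setLIntegral_sq_lineCauchyDeriv_le hf
  · simp only [lineCauchyDeriv_neg, Complex.neg_im, enorm_neg]
    exact (setLIntegral_sq_lineCauchyDeriv_le (memLp_comp_neg hf)).trans_eq
      (by rw [eLpNorm_comp_neg hf])

lemma lintegral_sq_lineCauchyIntegral_le {f : ℝ → ℂ} (hf : MemLp f 2) {y : ℝ} (hy : y ≠ 0) :
    ∫⁻ x : ℝ, ‖lineCauchyIntegral f (x + y * Complex.I)‖ₑ ^ 2 ≤ eLpNorm f 2 volume ^ 2 := by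
  rcases hy.lt_or_gt with h | h
  · have := lintegral_sq_lineCauchyIntegral_le_of_pos (memLp_comp_neg hf) (neg_pos.2 h)
    rw [eLpNorm_comp_neg hf, ← lintegral_neg_eq_self] at this
    refine le_trans (le_of_eq (lintegral_congr fun x => ?_)) this
    have e := lineCauchyIntegral_neg f (((-x : ℝ) : ℂ) + ((-y : ℝ) : ℂ) * Complex.I)
    rw [← enorm_neg (lineCauchyIntegral (fun t => f (-t)) _), ← e]
    congr 3
    push_cast
    ring
  · exact lintegral_sq_lineCauchyIntegral_le_of_pos hf h

/-! ### Domination of the Cauchy integral by a Poisson integral -/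

section Poisson

lemma fourier_comp_neg (a : ℝ → ℂ) (t : ℝ) : 𝓕 (fun ξ => a (-ξ)) t = 𝓕 a (-t) := by
  rw [Real.fourier_eq', Real.fourier_eq', ← integral_neg_eq_self]
  simp

/-- `F` is the projection of `f` to positive frequencies. As its transform vanishes for $\xi\le0$,
the symbol `halfExp z` may be completed there at will; the completion $e^{2\pi i\bar z\xi}$ produces
the Poisson kernel, whose decay, unlike that of the Cauchy kernel, permits control by averages. The
factor $1/\pi$ is dropped. -/
lemma exists_poisson_bound {f : ℝ → ℂ} (hf : MemLp f 2) :
    ∃ F : ℝ → ℂ, Measurable F ∧ MemLp F 2 ∧ eLpNorm F 2 volume ≤ eLpNorm f 2 volume ∧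
      ∀ z : ℂ, 0 < z.im → ‖lineCauchyIntegral f z‖ₑ ≤
        ∫⁻ t : ℝ, ENNReal.ofReal (z.im / ‖(t : ℂ) - z‖ ^ 2) * ‖F t‖ₑ := by
  have hm : MemLp ((Set.Ioi (0 : ℝ)).indicator (l2Fourier f hf)) 2 :=
    (memLp_l2Fourier hf).indicator measurableSet_Ioi
  set G : Lp ℂ 2 (volume : Measure ℝ) := (Lp.fourierTransformₗᵢ ℝ ℂ).symm (hm.toLp _) with hG
  have hFG : (𝓕 G : Lp ℂ 2 (volume : Measure ℝ)) = hm.toLp _ :=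
    (Lp.fourierTransformₗᵢ ℝ ℂ).apply_symm_apply _
  refine ⟨G, (Lp.stronglyMeasurable G).measurable, Lp.memLp G, ?_, fun z hz => ?_⟩
  · rw [← Lp.enorm_def, ← ofReal_norm, hG, LinearIsometryEquiv.norm_map, ofReal_norm, Lp.enorm_def,
      eLpNorm_congr_ae hm.coeFn_toLp, ← eLpNorm_l2Fourier hf]
    exact eLpNorm_indicator_le _
  · set w : ℂ := -(starRingEnd ℂ z) with hw
    have hwi : 0 < w.im := by simpa [hw] using hz
    -- With $w=-\bar z$, the second summand is $e^{2\pi i\bar z\xi}$ on $\xi<0$.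
    set p : ℝ → ℂ := fun ξ => halfExp z ξ + halfExp w (-ξ) with hp
    have hn1 : Integrable fun ξ => halfExp w (-ξ) := (integrable_halfExp hwi).comp_neg
    have hn2 : MemLp (fun ξ => halfExp w (-ξ)) 2 := memLp_comp_neg (memLp_halfExp hwi)
    have hp1 : Integrable p := (integrable_halfExp hz).add hn1
    have hp2 : MemLp p 2 := (memLp_halfExp hz).add hn2
    have hk : ∀ t, 𝓕 p t = ((z.im / Real.pi / ‖(t : ℂ) - z‖ ^ 2 : ℝ) : ℂ) := by
      intro t
      have h1 : 𝓕 p t = 𝓕 (halfExp z) t + 𝓕 (fun ξ => halfExp w (-ξ)) t := by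
        rw [hp]
        exact congrFun (VectorFourier.fourierIntegral_add (L := innerₗ ℝ) Real.continuous_fourierChar
          continuous_inner (integrable_halfExp hz) hn1) t
      rw [h1, fourier_comp_neg, fourier_halfExp hz, fourier_halfExp hwi]
      have e1 : (t : ℂ) - z ≠ 0 := fun h => by
        have := congrArg Complex.im h
        simp at this
        linarith
      have e2 : (t : ℂ) - starRingEnd ℂ z ≠ 0 := fun h => by
        have := congrArg Complex.im h
        simp at this
        linarith
      have e3 : ((‖(t : ℂ) - z‖ ^ 2 : ℝ) : ℂ) = ((t : ℂ) - z) * ((t : ℂ) - starRingEnd ℂ z) := by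
        push_cast
        rw [← Complex.mul_conj']
        simp
      have e4 : ((-t : ℝ) : ℂ) - w = -((t : ℂ) - starRingEnd ℂ z) := by
        rw [hw]; push_cast; ring
      have e5 : z - starRingEnd ℂ z = 2 * z.im * Complex.I := by
        rw [Complex.sub_conj]; push_cast; ring
      have h3 : (Real.pi : ℂ) ≠ 0 := by exact_mod_cast Real.pi_ne_zero
      have h4 := Complex.I_ne_zero
      rw [Complex.ofReal_div, e3, e4]
      push_cast
      have e6 : (z.im : ℂ) = (z - starRingEnd ℂ z) / (2 * Complex.I) := by
        rw [e5]; field_simp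
      rw [e6, div_neg]
      field_simp
      ring
    have h1 := integral_fourier_mul_eq_of_memLp G hp1 hp2 (memLp_fourierIntegral hp1 hp2)
    have h2 : lineCauchyIntegral f z = ∫ t, G t * 𝓕 p t := by
      rw [← h1, hFG, lineCauchyIntegral_eq hf hz]
      refine integral_congr_ae ?_
      filter_upwards [hm.coeFn_toLp] with ξ hξ
      rw [hξ]
      by_cases h : 0 < ξ
      · rw [Set.indicator_of_mem (show ξ ∈ Set.Ioi 0 from h)]
        have : halfExp w (-ξ) = 0 := Set.indicator_of_notMem (by simpa using h.le) _
        simp [hp, this]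
      · rw [Set.indicator_of_notMem (show ξ ∉ Set.Ioi 0 from h)]
        have : halfExp z ξ = 0 := Set.indicator_of_notMem h _
        simp [this]
    rw [h2]
    refine (enorm_integral_le_lintegral_enorm _).trans (lintegral_mono fun t => ?_)
    rw [enorm_mul, mul_comm, hk, ← ofReal_norm, Complex.norm_real]
    gcongr
    rw [Real.norm_of_nonneg (by positivity)]
    gcongr
    refine div_le_self hz.le ?_
    linarith [Real.pi_gt_three]

end Poisson

/-! ### The Carleson embedding theorem -/

section Carleson

/-- The maximal average of `G` over intervals centred at `Re z` of radius at least `|Im z|`. -/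
noncomputable def tentMax (G : ℝ → ℝ≥0∞) (z : ℂ) : ℝ≥0∞ :=
  ⨆ (r : ℝ) (_ : 0 < r ∧ |z.im| ≤ r),
    (∫⁻ t in Metric.closedBall z.re r, G t) / ENNReal.ofReal (2 * r)

lemma setLIntegral_le_tentMax (G : ℝ → ℝ≥0∞) (z : ℂ) {r : ℝ} (hr : 0 < r) (hz : |z.im| ≤ r) :
    ∫⁻ t in Metric.closedBall z.re r, G t ≤ ENNReal.ofReal (2 * r) * tentMax G z := by
  have h : (∫⁻ t in Metric.closedBall z.re r, G t) / ENNReal.ofReal (2 * r) ≤ tentMax G z :=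
    le_iSup₂_of_le r ⟨hr, hz⟩ le_rfl
  have h0 : ENNReal.ofReal (2 * r) ≠ 0 := by simpa using hr
  rwa [ENNReal.div_le_iff h0 ENNReal.ofReal_ne_top, mul_comm] at h

lemma tentMax_le_add {G G₁ : ℝ → ℝ≥0∞} {s : ℝ≥0∞} (hG : Measurable G₁) (h : ∀ t, G t ≤ G₁ t + s)
    (z : ℂ) : tentMax G z ≤ tentMax G₁ z + s := by
  refine iSup₂_le fun r hr => ?_
  have h0 : ENNReal.ofReal (2 * r) ≠ 0 := by simpa using hr.1
  rw [ENNReal.div_le_iff h0 ENNReal.ofReal_ne_top, add_mul]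
  calc ∫⁻ t in Metric.closedBall z.re r, G t
      ≤ ∫⁻ t in Metric.closedBall z.re r, (G₁ t + s) := lintegral_mono h
    _ = (∫⁻ t in Metric.closedBall z.re r, G₁ t) + s * ENNReal.ofReal (2 * r) := by
        rw [lintegral_add_left hG, setLIntegral_const, Real.volume_closedBall]
    _ ≤ _ := by
        gcongr
        rw [mul_comm]
        exact setLIntegral_le_tentMax G₁ z hr.1 hr.2

/-- Dyadic decomposition about $\operatorname{Re}z$: for $2^{k-1}y\le|t-\operatorname{Re}z|\le2^ky$
the kernel is at most $4/(4^ky)$, while the integral of `G` over that ball is at most $2\cdot2^ky$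
times `tentMax`. The $k$-th term is thus at most $8\cdot2^{-k}$ times `tentMax`, and the series sums
to $16$. -/
lemma lintegral_poisson_le_tentMax {G : ℝ → ℝ≥0∞} (hG : Measurable G) {z : ℂ} (hz : 0 < z.im) :
    ∫⁻ t : ℝ, ENNReal.ofReal (z.im / ‖(t : ℂ) - z‖ ^ 2) * G t ≤ 16 * tentMax G z := by
  set y := z.im with hy
  have hpt : ∀ t : ℝ, ENNReal.ofReal (y / ‖(t : ℂ) - z‖ ^ 2) * G t ≤
      ∑' k : ℕ, (Metric.closedBall z.re (2 ^ k * y)).indicator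
        (fun t => ENNReal.ofReal (4 / (4 ^ k * y)) * G t) t := by
    intro t
    have hn : ‖(t : ℂ) - z‖ ^ 2 = (t - z.re) ^ 2 + y ^ 2 := by
      rw [Complex.sq_norm, Complex.normSq_apply]
      simp
      ring
    suffices ∃ k : ℕ, |t - z.re| ≤ 2 ^ k * y ∧
        y / ‖(t : ℂ) - z‖ ^ 2 ≤ 4 / (4 ^ k * y) by
      obtain ⟨k, h1, h2⟩ := this
      refine le_trans ?_ (ENNReal.le_tsum k)
      rw [Set.indicator_of_mem (by rwa [Metric.mem_closedBall, Real.dist_eq])]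
      gcongr
    rw [hn]
    by_cases h : |t - z.re| / y < 1
    · refine ⟨0, ?_, ?_⟩
      · rw [div_lt_one hz] at h
        simpa using h.le
      · rw [div_le_div_iff₀ (by positivity) (by positivity)]
        nlinarith [sq_nonneg (t - z.re)]
    · obtain ⟨n, h1, h2⟩ := exists_nat_pow_near (not_lt.1 h) one_lt_two
      refine ⟨n + 1, ?_, ?_⟩
      · rw [div_lt_iff₀ hz] at h2
        exact h2.le
      · rw [le_div_iff₀ hz] at h1
        rw [div_le_div_iff₀ (by positivity) (by positivity)]
        have h3 : (2 ^ n * y) ^ 2 ≤ (t - z.re) ^ 2 := by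
          rw [← sq_abs (t - z.re)]
          gcongr
        have h4 : (2 ^ n * y) ^ 2 = 4 ^ n * y ^ 2 := by
          rw [mul_pow, ← pow_mul, mul_comm n, pow_mul]; norm_num
        rw [h4] at h3
        rw [pow_succ]
        nlinarith [sq_nonneg y]
  calc _ ≤ ∫⁻ t, ∑' k : ℕ, (Metric.closedBall z.re (2 ^ k * y)).indicator
        (fun t => ENNReal.ofReal (4 / (4 ^ k * y)) * G t) t := lintegral_mono hpt
    _ = ∑' k : ℕ, ENNReal.ofReal (4 / (4 ^ k * y)) *
        ∫⁻ t in Metric.closedBall z.re (2 ^ k * y), G t := by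
        rw [lintegral_tsum]
        · refine tsum_congr fun k => ?_
          rw [lintegral_indicator Metric.isClosed_closedBall.measurableSet,
            lintegral_const_mul _ hG]
        · exact fun k => ((hG.const_mul _).indicator
            Metric.isClosed_closedBall.measurableSet).aemeasurable
    _ ≤ ∑' k : ℕ, (8 * tentMax G z) * 2⁻¹ ^ k := by
        refine ENNReal.tsum_le_tsum fun k => ?_
        have hk : |z.im| ≤ 2 ^ k * y := by
          rw [← hy, abs_of_pos hz]
          exact le_mul_of_one_le_left hz.le (one_le_pow₀ one_le_two)
        calc _ ≤ ENNReal.ofReal (4 / (4 ^ k * y)) *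
              (ENNReal.ofReal (2 * (2 ^ k * y)) * tentMax G z) := by
              gcongr
              exact setLIntegral_le_tentMax G z (by positivity) hk
          _ = _ := by
              rw [← mul_assoc, ← ENNReal.ofReal_mul (by positivity)]
              have : 4 / (4 ^ k * y) * (2 * (2 ^ k * y)) = 8 * (2 : ℝ)⁻¹ ^ k := by
                have : (4 : ℝ) ^ k = 2 ^ k * 2 ^ k := by rw [← mul_pow]; norm_num
                rw [this, inv_pow]
                field_simp
                norm_num
              rw [this, ENNReal.ofReal_mul (by norm_num), ENNReal.ofReal_pow (by norm_num),
                ENNReal.ofReal_inv_of_pos two_pos]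
              simp only [ENNReal.ofReal_ofNat]
              ring
    _ = 16 * tentMax G z := by
        rw [ENNReal.tsum_mul_left, ENNReal.tsum_geometric_two]
        ring

/-- The weak type `(1, 1)` estimate for `tentMax` with respect to a Carleson measure. -/
lemma mul_measure_tentMax_gt_le {σ : Measure ℂ} {A : ℝ≥0} (hσ : IsCarlesonWith σ A)
    {G : ℝ → ℝ≥0∞} (hG : ∫⁻ t, G t ≠ ⊤) {s : ℝ} (hs : 0 < s) :
    ENNReal.ofReal s * σ {z | ENNReal.ofReal s < tentMax G z} ≤ 3 * A * ∫⁻ t, G t := by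
  set S := {z | ENNReal.ofReal s < tentMax G z} with hS
  have h1 : ∀ z ∈ S, ∃ r : ℝ, 0 < r ∧ |z.im| ≤ r ∧
      ENNReal.ofReal (s * (2 * r)) ≤ ∫⁻ t in Metric.closedBall z.re r, G t := by
    intro z hz
    simp only [hS, Set.mem_ofPred_eq, tentMax, lt_iSup_iff] at hz
    obtain ⟨r, hr0, hr⟩ := hz
    refine ⟨r, hr0.1, hr0.2, ?_⟩
    have h0 : ENNReal.ofReal (2 * r) ≠ 0 := by simpa using hr0.1
    rw [ENNReal.ofReal_mul hs.le]
    exact ((ENNReal.lt_div_iff_mul_lt (Or.inl h0) (Or.inl ENNReal.ofReal_ne_top)).1 hr).le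
  choose! r hr0 hri hrG using h1
  -- Vitali's covering lemma needs bounded radii; finiteness of $\int G$ supplies the bound.
  have hbound : ∀ z ∈ S, r z ≤ (∫⁻ t, G t).toReal / (2 * s) := by
    intro z hz
    have := (hrG z hz).trans (setLIntegral_le_lintegral _ _)
    rw [ENNReal.ofReal_le_iff_le_toReal hG] at this
    rw [le_div_iff₀ (by positivity)]
    linarith
  obtain ⟨u, huS, hdisj, hcov⟩ := Vitali.exists_disjoint_subfamily_covering_enlargement_closedBall
    S (fun z => z.re) r _ hbound 5 (by norm_num)
  have hcount : u.Countable := by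
    refine hdisj.countable_of_nonempty_interior fun z hz => ?_
    refine ⟨z.re, ?_⟩
    exact interior_mono Metric.ball_subset_closedBall
      (by rw [Metric.isOpen_ball.interior_eq]; exact Metric.mem_ball_self (hr0 z (huS hz)))
  -- The interval of radius $r_z$ about $\operatorname{Re}z$ lies in the enlarged one, so
  -- $|\operatorname{Re}z-\operatorname{Re}b|\le5r_b-r_z$. The missing $r_z$ accommodates
  -- $|\operatorname{Im}z|\le r_z$.
  have hSsub : S ⊆ ⋃ b ∈ u, {w : ℂ | ‖w - (b.re : ℂ)‖ ≤ 5 * r b} := by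
    intro z hz
    obtain ⟨b, hb, hsub⟩ := hcov z hz
    refine Set.mem_biUnion hb ?_
    have hrz := hr0 z hz
    have e1 : z.re + r z ∈ Metric.closedBall b.re (5 * r b) := hsub (by
      simp [abs_of_pos hrz])
    have e2 : z.re - r z ∈ Metric.closedBall b.re (5 * r b) := hsub (by
      simp [abs_of_pos hrz])
    rw [Metric.mem_closedBall, Real.dist_eq, abs_le] at e1 e2
    change ‖z - (b.re : ℂ)‖ ≤ 5 * r b
    refine (Complex.norm_le_abs_re_add_abs_im _).trans ?_
    have e3 := hri z hz
    simp only [Complex.sub_re, Complex.ofReal_re, Complex.sub_im, Complex.ofReal_im, sub_zero]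
    have : |z.re - b.re| ≤ 5 * r b - r z := abs_le.2 ⟨by linarith [e2.1], by linarith [e1.2]⟩
    linarith
  have : Countable u := hcount.to_subtype
  calc ENNReal.ofReal s * σ S
      ≤ ENNReal.ofReal s * ∑' b : u, σ {w : ℂ | ‖w - ((b : ℂ).re : ℂ)‖ ≤ 5 * r b} := by
        gcongr
        exact (measure_mono hSsub).trans (measure_biUnion_le _ hcount _)
    _ = ∑' b : u, ENNReal.ofReal s * σ {w : ℂ | ‖w - ((b : ℂ).re : ℂ)‖ ≤ 5 * r b} := by
        rw [ENNReal.tsum_mul_left]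
    _ ≤ ∑' b : u, 3 * A * ∫⁻ t in Metric.closedBall (b : ℂ).re (r b), G t := by
        refine ENNReal.tsum_le_tsum fun b => ?_
        have hb0 := hr0 b (huS b.2)
        calc _ ≤ ENNReal.ofReal s * (A * ENNReal.ofReal (5 * r b)) := by
              gcongr
              exact hσ _ _ (by positivity)
          _ = A * ENNReal.ofReal (s * (5 * r b)) := by
              rw [ENNReal.ofReal_mul hs.le]; ring
          -- The enlargement costs $5/2\le3$ against the interval length $2r_b$.
          _ ≤ A * (3 * ENNReal.ofReal (s * (2 * r b))) := by
              gcongr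
              rw [← ENNReal.ofReal_ofNat, ← ENNReal.ofReal_mul (by norm_num)]
              refine ENNReal.ofReal_le_ofReal ?_
              nlinarith [mul_pos hs hb0]
          _ ≤ A * (3 * ∫⁻ t in Metric.closedBall (b : ℂ).re (r b), G t) := by
              gcongr
              exact hrG b (huS b.2)
          _ = _ := by ring
    _ = 3 * A * ∫⁻ t in ⋃ b : u, Metric.closedBall (b : ℂ).re (r b), G t := by
        rw [ENNReal.tsum_mul_left, lintegral_iUnion]
        · exact fun b => Metric.isClosed_closedBall.measurableSet
        · intro a b hab
          exact hdisj a.2 b.2 (fun h => hab (Subtype.ext h))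
    _ ≤ _ := by
        exact mul_le_mul' le_rfl (setLIntegral_le_lintegral _ _)

/-- Marcinkiewicz interpolation. At level $t$ only the part of $|F|$ above $t/32$ matters: the
remainder has `tentMax` at most $t/32$ and so contributes at most $16\cdot t/32=t/2$. The weak type
bound, the layer cake formula and Tonelli then give the constant $2\cdot(32\cdot3)\cdot32=6144$. -/
lemma setLIntegral_sq_lineCauchyIntegral_le_carleson {σ : Measure ℂ} {A : ℝ≥0}
    (hσ : IsCarlesonWith σ A) {f : ℝ → ℂ} (hf : MemLp f 2) :
    ∫⁻ z in {z : ℂ | 0 < z.im}, ‖lineCauchyIntegral f z‖ₑ ^ 2 ∂σ ≤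
      6144 * A * eLpNorm f 2 volume ^ 2 := by
  obtain ⟨F, hFm, hF2, hFf, hFC⟩ := exists_poisson_bound hf
  have hm := measurable_lineCauchyIntegral hf.1
  have hFfin : ∫⁻ t, ‖F t‖ₑ ^ 2 ≠ ⊤ := by
    rw [lintegral_enorm_sq_eq]
    exact ENNReal.pow_ne_top hF2.2.ne
  have hlevel : ∀ t : ℝ, 0 < t →
      (σ.restrict {z : ℂ | 0 < z.im}) {z | t < ‖lineCauchyIntegral f z‖} * ENNReal.ofReal t ≤
        96 * A * ∫⁻ x, {x : ℝ | ENNReal.ofReal t < 32 * ‖F x‖ₑ}.indicator (fun x => ‖F x‖ₑ) x := by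
    intro t ht
    set G₁ := {x : ℝ | ENNReal.ofReal t < 32 * ‖F x‖ₑ}.indicator (fun x => ‖F x‖ₑ) with hG₁
    have hset : MeasurableSet {x : ℝ | ENNReal.ofReal t < 32 * ‖F x‖ₑ} :=
      measurableSet_lt measurable_const (hFm.enorm.const_mul _)
    have hG₁m : Measurable G₁ := hFm.enorm.indicator hset
    have ht' : (0 : ℝ) < t / 32 := by positivity
    have e32 : ENNReal.ofReal t = 32 * ENNReal.ofReal (t / 32) := by
      rw [← ENNReal.ofReal_ofNat, ← ENNReal.ofReal_mul (by norm_num)]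
      congr 1
      ring
    -- The large part of an $L^2$ function is integrable, by $(t/32)\,G_1\le|F|^2$.
    have hfin : ∫⁻ x, G₁ x ≠ ⊤ := by
      have : ∀ x, ENNReal.ofReal (t / 32) * G₁ x ≤ ‖F x‖ₑ ^ 2 := by
        intro x
        by_cases hx : x ∈ {x : ℝ | ENNReal.ofReal t < 32 * ‖F x‖ₑ}
        · rw [hG₁, Set.indicator_of_mem hx, sq]
          gcongr
          have hx' : ENNReal.ofReal t < 32 * ‖F x‖ₑ := hx
          rw [e32] at hx'
          exact (ENNReal.mul_lt_mul_iff_right (by norm_num) (by norm_num)).1 hx' |>.le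
        · rw [hG₁, Set.indicator_of_notMem hx]; simp
      have h2 := lintegral_mono (μ := volume) this
      rw [lintegral_const_mul _ hG₁m] at h2
      intro htop
      rw [htop, ENNReal.mul_top (by simpa using ht)] at h2
      exact hFfin (top_le_iff.1 h2)
    have hsub : {z | t < ‖lineCauchyIntegral f z‖} ∩ {z : ℂ | 0 < z.im} ⊆
        {z | ENNReal.ofReal (t / 32) < tentMax G₁ z} := by
      rintro z ⟨hz1, hz2⟩
      have h1 : ENNReal.ofReal t < 16 * tentMax (fun x => ‖F x‖ₑ) z :=
        calc ENNReal.ofReal t < ‖lineCauchyIntegral f z‖ₑ := by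
              rw [← ofReal_norm]
              exact (ENNReal.ofReal_lt_ofReal_iff (ht.trans hz1)).2 hz1
          _ ≤ _ := (hFC z hz2).trans (lintegral_poisson_le_tentMax hFm.enorm hz2)
      have h2 : tentMax (fun x => ‖F x‖ₑ) z ≤ tentMax G₁ z + ENNReal.ofReal (t / 32) := by
        refine tentMax_le_add hG₁m (fun x => ?_) z
        by_cases hx : x ∈ {x : ℝ | ENNReal.ofReal t < 32 * ‖F x‖ₑ}
        · rw [hG₁, Set.indicator_of_mem hx]
          exact le_self_add
        · rw [hG₁, Set.indicator_of_notMem hx, zero_add]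
          have hx' : ¬ ENNReal.ofReal t < 32 * ‖F x‖ₑ := hx
          rw [e32, not_lt] at hx'
          exact (ENNReal.mul_le_mul_iff_right (by norm_num) (by norm_num)).1 hx'
      by_contra hc
      have hc' : tentMax G₁ z ≤ ENNReal.ofReal (t / 32) := not_lt.1 hc
      have h3 : ENNReal.ofReal t < ENNReal.ofReal t := calc
        ENNReal.ofReal t < 16 * tentMax (fun x => ‖F x‖ₑ) z := h1
        _ ≤ 16 * (ENNReal.ofReal (t / 32) + ENNReal.ofReal (t / 32)) := by
            gcongr
            exact h2.trans (by gcongr)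
        _ = ENNReal.ofReal t := by
            rw [e32]; ring
      exact lt_irrefl _ h3
    calc _ ≤ σ {z | ENNReal.ofReal (t / 32) < tentMax G₁ z} * ENNReal.ofReal t := by
          refine mul_le_mul' ?_ le_rfl
          rw [Measure.restrict_apply (measurableSet_lt measurable_const hm.norm)]
          exact measure_mono hsub
      _ = 32 * (ENNReal.ofReal (t / 32) * σ {z | ENNReal.ofReal (t / 32) < tentMax G₁ z}) := by
          rw [e32]; ring
      _ ≤ 32 * (3 * A * ∫⁻ x, G₁ x) := by
          exact mul_le_mul' le_rfl (mul_measure_tentMax_gt_le hσ hfin ht')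
      _ = _ := by ring
  have hcake := lintegral_rpow_eq_lintegral_meas_lt_mul (σ.restrict {z : ℂ | 0 < z.im})
    (f := fun z => ‖lineCauchyIntegral f z‖) (Eventually.of_forall fun z => norm_nonneg _)
    hm.norm.aemeasurable (p := 2) two_pos
  have e1 : ∫⁻ z in {z : ℂ | 0 < z.im}, ‖lineCauchyIntegral f z‖ₑ ^ 2 ∂σ =
      ∫⁻ z in {z : ℂ | 0 < z.im}, ENNReal.ofReal (‖lineCauchyIntegral f z‖ ^ (2 : ℝ)) ∂σ := by
    refine lintegral_congr fun z => ?_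
    rw [Real.rpow_two, ENNReal.ofReal_pow (norm_nonneg _), ofReal_norm]
  rw [e1, hcake]
  have e2 : (2 : ℝ) - 1 = 1 := by norm_num
  simp only [e2, Real.rpow_one]
  calc _ ≤ ENNReal.ofReal 2 * ∫⁻ t in Set.Ioi (0 : ℝ), 96 * A *
        ∫⁻ x, {x : ℝ | ENNReal.ofReal t < 32 * ‖F x‖ₑ}.indicator (fun x => ‖F x‖ₑ) x := by
        refine mul_le_mul' le_rfl ?_
        exact setLIntegral_mono' measurableSet_Ioi fun t ht => hlevel t ht
    _ = 192 * A * ∫⁻ t in Set.Ioi (0 : ℝ),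
        ∫⁻ x, {x : ℝ | ENNReal.ofReal t < 32 * ‖F x‖ₑ}.indicator (fun x => ‖F x‖ₑ) x := by
        rw [lintegral_const_mul' _ _ (by finiteness), ← mul_assoc, ENNReal.ofReal_ofNat]
        congr 1
        ring
    _ = 192 * A * ∫⁻ x, ∫⁻ t in Set.Ioi (0 : ℝ),
        {x : ℝ | ENNReal.ofReal t < 32 * ‖F x‖ₑ}.indicator (fun x => ‖F x‖ₑ) x := by
        congr 1
        refine lintegral_lintegral_swap (Measurable.aemeasurable ?_)
        have : (Function.uncurry fun (t x : ℝ) =>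
            {x : ℝ | ENNReal.ofReal t < 32 * ‖F x‖ₑ}.indicator (fun x => ‖F x‖ₑ) x) =
            {p : ℝ × ℝ | ENNReal.ofReal p.1 < 32 * ‖F p.2‖ₑ}.indicator (fun p => ‖F p.2‖ₑ) := by
          ext p
          simp [Function.uncurry, Set.indicator]
        rw [this]
        have hF' : Measurable fun p : ℝ × ℝ => ‖F p.2‖ₑ := (hFm.comp measurable_snd).enorm
        exact hF'.indicator (measurableSet_lt (by fun_prop) (hF'.const_mul _))
    _ ≤ 192 * A * ∫⁻ x, 32 * ‖F x‖ₑ ^ 2 := by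
        gcongr with x
        have e3 : ∀ t ∈ Set.Ioi (0 : ℝ), {x : ℝ | ENNReal.ofReal t < 32 * ‖F x‖ₑ}.indicator
            (fun x => ‖F x‖ₑ) x ≤ (Set.Iio (32 * ‖F x‖)).indicator (fun _ => ‖F x‖ₑ) t := by
          intro t ht
          by_cases hx : x ∈ {x : ℝ | ENNReal.ofReal t < 32 * ‖F x‖ₑ}
          · rw [Set.indicator_of_mem hx, Set.indicator_of_mem]
            have hx' : ENNReal.ofReal t < 32 * ‖F x‖ₑ := hx
            rw [← ofReal_norm, ← ENNReal.ofReal_ofNat, ← ENNReal.ofReal_mul (by norm_num)] at hx'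
            exact (ENNReal.ofReal_lt_ofReal_iff_of_nonneg (le_of_lt ht)).1 hx'
          · rw [Set.indicator_of_notMem hx]; exact zero_le
        refine (setLIntegral_mono' measurableSet_Ioi e3).trans ?_
        rw [lintegral_indicator measurableSet_Iio, setLIntegral_const,
          Measure.restrict_apply measurableSet_Iio, Set.Iio_inter_Ioi, Real.volume_Ioo, sub_zero,
          ENNReal.ofReal_mul (by norm_num), ofReal_norm, ENNReal.ofReal_ofNat, sq]
        exact le_of_eq (by ring)
    _ = 6144 * A * eLpNorm F 2 volume ^ 2 := by
        rw [lintegral_const_mul _ (hFm.enorm.pow_const 2), lintegral_enorm_sq_eq]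
        ring
    _ ≤ _ := by gcongr

lemma IsCarlesonWith.map_neg {σ : Measure ℂ} {A : ℝ≥0} (hσ : IsCarlesonWith σ A) :
    IsCarlesonWith (σ.map Neg.neg) A := by
  intro x r hr
  rw [Measure.map_apply measurable_neg (measurableSet_le (by fun_prop) measurable_const)]
  refine le_trans (measure_mono fun w hw => ?_) (hσ (-x) r hr)
  have hw' : ‖-w - (x : ℂ)‖ ≤ r := hw
  change ‖w - ((-x : ℝ) : ℂ)‖ ≤ r
  rw [← norm_neg] at hw'
  rwa [show w - ((-x : ℝ) : ℂ) = -(-w - (x : ℂ)) by push_cast; ring]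

/-- The Carleson embedding theorem for the Cauchy integral. -/
lemma lintegral_sq_lineCauchyIntegral_le_carleson {σ : Measure ℂ} {A : ℝ≥0}
    (hσ : IsCarlesonWith σ A) (h0 : σ {z : ℂ | z.im = 0} = 0) {f : ℝ → ℂ} (hf : MemLp f 2) :
    ∫⁻ z, ‖lineCauchyIntegral f z‖ₑ ^ 2 ∂σ ≤ 12288 * A * eLpNorm f 2 volume ^ 2 := by
  have hm := measurable_lineCauchyIntegral hf.1
  rw [lintegral_eq_im_pos_add h0 (by fun_prop)]
  have h2 := setLIntegral_sq_lineCauchyIntegral_le_carleson hσ.map_neg (memLp_comp_neg hf)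
  rw [eLpNorm_comp_neg hf] at h2
  simp only [lineCauchyIntegral_neg, enorm_neg]
  calc _ ≤ 6144 * A * eLpNorm f 2 volume ^ 2 + 6144 * A * eLpNorm f 2 volume ^ 2 :=
        add_le_add (setLIntegral_sq_lineCauchyIntegral_le_carleson hσ hf) h2
    _ = _ := by ring

end Carleson

end HalfPlane

/-! ### Test functions and integration by parts for $\partial$ and $\overline\partial$ -/

/-- Complex valued smooth functions of compact support in the plane. -/
structure IsTestFunction (φ : ℂ → ℂ) : Prop where
  smooth : ContDiff ℝ ∞ φ
  compact : HasCompactSupport φ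

namespace IsTestFunction

variable {φ χ : ℂ → ℂ}

lemma continuous (h : IsTestFunction φ) : Continuous φ := h.smooth.continuous

lemma differentiable (h : IsTestFunction φ) : Differentiable ℝ φ :=
  h.smooth.differentiable (by simp)

lemma fderiv_apply (h : IsTestFunction φ) (v : ℂ) : IsTestFunction fun z => fderiv ℝ φ z v where
  smooth := (h.smooth.fderiv_right (m := ∞) (by simp)).clm_apply contDiff_const
  compact := h.compact.fderiv_apply ℝ v

lemma add (h : IsTestFunction φ) (h' : IsTestFunction χ) : IsTestFunction fun z => φ z + χ z :=
  ⟨h.smooth.add h'.smooth, h.compact.add h'.compact⟩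

lemma const_mul (h : IsTestFunction φ) (c : ℂ) : IsTestFunction fun z => c * φ z :=
  ⟨contDiff_const.mul h.smooth, h.compact.mul_left⟩

lemma sub (h : IsTestFunction φ) (h' : IsTestFunction χ) : IsTestFunction fun z => φ z - χ z := by
  simpa [sub_eq_add_neg] using h.add (h'.const_mul (-1))

lemma wirtinger (h : IsTestFunction φ) : IsTestFunction (wirtinger φ) := by
  have := ((h.fderiv_apply 1).sub ((h.fderiv_apply Complex.I).const_mul Complex.I)).const_mul (1 / 2)
  convert this using 2 with z
  unfold _root_.wirtinger
  ring

lemma wirtingerBar (h : IsTestFunction φ) : IsTestFunction (wirtingerBar φ) := by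
  have := ((h.fderiv_apply 1).add ((h.fderiv_apply Complex.I).const_mul Complex.I)).const_mul (1 / 2)
  convert this using 2 with z
  unfold _root_.wirtingerBar
  ring

lemma conj (h : IsTestFunction φ) : IsTestFunction fun z => starRingEnd ℂ (φ z) where
  smooth := Complex.conjCLE.contDiff.comp h.smooth
  compact := h.compact.comp_left (g := starRingEnd ℂ) (by simp)

lemma comp_add_right (h : IsTestFunction φ) (a : ℂ) : IsTestFunction fun z => φ (z + a) where
  smooth := h.smooth.comp (contDiff_id.add contDiff_const)
  compact := h.compact.comp_homeomorph (Homeomorph.addRight a)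

lemma exists_lipschitz (h : IsTestFunction φ) : ∃ C, LipschitzWith C φ :=
  h.smooth.lipschitzWith_of_hasCompactSupport h.compact (by simp)

lemma memLp (h : IsTestFunction φ) (p : ℝ≥0∞) : MemLp φ p :=
  h.continuous.memLp_of_hasCompactSupport h.compact

lemma integrable (h : IsTestFunction φ) : Integrable φ :=
  h.continuous.integrable_of_hasCompactSupport h.compact

end IsTestFunction

lemma LipschitzWith.measurable_lineDeriv' {C : ℝ≥0} {f : ℂ → ℝ} (hf : LipschitzWith C f) (v : ℂ) :
    Measurable fun z => lineDeriv ℝ f z v := measurable_lineDeriv hf.continuous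

lemma integral_lineDeriv_mul_eq_neg_of_real {C D : ℝ≥0} {f g : ℂ → ℝ} (hf : LipschitzWith C f)
    (hg : LipschitzWith D g) (hgc : HasCompactSupport g) (v : ℂ) :
    ∫ z, lineDeriv ℝ f z v * g z = -∫ z, f z * lineDeriv ℝ g z v := by
  rw [hf.integral_lineDeriv_mul_eq hg hgc, ← integral_neg]
  refine integral_congr_ae (Eventually.of_forall fun z => ?_)
  simp only [lineDeriv_neg]
  ring

/-- Integration by parts of a complex Lipschitz function against a test function. -/
lemma integral_lineDeriv_mul_eq_neg {C : ℝ≥0} {ψ φ : ℂ → ℂ} (hψ : LipschitzWith C ψ)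
    (hφ : IsTestFunction φ) (v : ℂ) :
    ∫ z, (⟨lineDeriv ℝ (fun w => (ψ w).re) z v, lineDeriv ℝ (fun w => (ψ w).im) z v⟩ : ℂ) * φ z =
      -∫ z, ψ z * fderiv ℝ φ z v := by
  obtain ⟨D, hD⟩ := hφ.exists_lipschitz
  have lre : ∀ {C : ℝ≥0} {u : ℂ → ℂ}, LipschitzWith C u → LipschitzWith C fun w => (u w).re := by
    intro C u hu
    refine LipschitzWith.of_dist_le_mul fun x y => (le_trans ?_ (hu.dist_le_mul x y))
    rw [Real.dist_eq, dist_eq_norm, ← Complex.sub_re]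
    exact Complex.abs_re_le_norm _
  have lim : ∀ {C : ℝ≥0} {u : ℂ → ℂ}, LipschitzWith C u → LipschitzWith C fun w => (u w).im := by
    intro C u hu
    refine LipschitzWith.of_dist_le_mul fun x y => (le_trans ?_ (hu.dist_le_mul x y))
    rw [Real.dist_eq, dist_eq_norm, ← Complex.sub_im]
    exact Complex.abs_im_le_norm _
  have cre : HasCompactSupport fun w => (φ w).re := hφ.compact.comp_left (g := Complex.re) rfl
  have cim : HasCompactSupport fun w => (φ w).im := hφ.compact.comp_left (g := Complex.im) rfl
  have dre : ∀ z, lineDeriv ℝ (fun w => (φ w).re) z v = (fderiv ℝ φ z v).re := fun z =>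
    ((Complex.reCLM.hasFDerivAt.comp z (hφ.differentiable z).hasFDerivAt).hasLineDerivAt v).lineDeriv
  have dim : ∀ z, lineDeriv ℝ (fun w => (φ w).im) z v = (fderiv ℝ φ z v).im := fun z =>
    ((Complex.imCLM.hasFDerivAt.comp z (hφ.differentiable z).hasFDerivAt).hasLineDerivAt v).lineDeriv
  have ib : ∀ {C : ℝ≥0} {f g : ℂ → ℝ}, LipschitzWith C f → Continuous g → HasCompactSupport g →
      Integrable fun z => lineDeriv ℝ f z v * g z := by
    intro C f g hf hg hgc
    refine (hg.integrable_of_hasCompactSupport hgc).bdd_mul (c := C * ‖v‖)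
      (hf.measurable_lineDeriv' v).aestronglyMeasurable ?_
    exact Eventually.of_forall fun z => norm_lineDeriv_le_of_lipschitz ℝ hf
  have hφv := hφ.fderiv_apply v
  have ic : ∀ {f g : ℂ → ℝ}, Continuous f → Continuous g → HasCompactSupport g →
      Integrable fun z => f z * g z := by
    intro f g hf hg hgc
    exact (hf.mul hg).integrable_of_hasCompactSupport hgc.mul_left
  have cvre : Continuous fun z => (fderiv ℝ φ z v).re := Complex.continuous_re.comp hφv.continuous
  have cvim : Continuous fun z => (fderiv ℝ φ z v).im := Complex.continuous_im.comp hφv.continuous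
  have cre' : HasCompactSupport fun z => (fderiv ℝ φ z v).re :=
    hφv.compact.comp_left (g := Complex.re) rfl
  have cim' : HasCompactSupport fun z => (fderiv ℝ φ z v).im :=
    hφv.compact.comp_left (g := Complex.im) rfl
  have pre := Complex.continuous_re.comp hψ.continuous
  have pim := Complex.continuous_im.comp hψ.continuous
  have qre := Complex.continuous_re.comp hφ.continuous
  have qim := Complex.continuous_im.comp hφ.continuous
  have e1 := integral_lineDeriv_mul_eq_neg_of_real (lre hψ) (lre hD) cre v
  have e2 := integral_lineDeriv_mul_eq_neg_of_real (lim hψ) (lim hD) cim v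
  have e3 := integral_lineDeriv_mul_eq_neg_of_real (lre hψ) (lim hD) cim v
  have e4 := integral_lineDeriv_mul_eq_neg_of_real (lim hψ) (lre hD) cre v
  simp only [dre, dim] at e1 e2 e3 e4
  have i1 := ib (lre hψ) qre cre
  have i2 := ib (lim hψ) qim cim
  have i3 := ib (lre hψ) qim cim
  have i4 := ib (lim hψ) qre cre
  have j1 := ic pre cvre cre'
  have j2 := ic pim cvim cim'
  have j3 := ic pre cvim cim'
  have j4 := ic pim cvre cre'
  simp only [Function.comp_def] at *
  have L : Integrable fun z => (⟨lineDeriv ℝ (fun w => (ψ w).re) z v,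
      lineDeriv ℝ (fun w => (ψ w).im) z v⟩ : ℂ) * φ z := by
    refine Integrable.re_im_iff.1 ⟨?_, ?_⟩
    · exact (i1.sub i2).congr (Eventually.of_forall fun z => by simp)
    · exact (i3.add i4).congr (Eventually.of_forall fun z => by simp)
  have J : Integrable fun z => ψ z * fderiv ℝ φ z v :=
    (hψ.continuous.mul hφv.continuous).integrable_of_hasCompactSupport hφv.compact.mul_left
  apply Complex.ext
  · rw [Complex.neg_re]
    have r1 : ∀ {u : ℂ → ℂ}, Integrable u → (∫ z, u z).re = ∫ z, (u z).re := fun hu =>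
      (Complex.reCLM.integral_comp_comm hu).symm
    rw [r1 L, r1 J]
    simp only [Complex.mul_re]
    rw [integral_sub i1 i2, integral_sub j1 j2, e1, e2]
    ring
  · rw [Complex.neg_im]
    have r1 : ∀ {u : ℂ → ℂ}, Integrable u → (∫ z, u z).im = ∫ z, (u z).im := fun hu =>
      (Complex.imCLM.integral_comp_comm hu).symm
    rw [r1 L, r1 J]
    simp only [Complex.mul_im]
    rw [integral_add i3 i4, integral_add j3 j4, e3, e4]
    ring

lemma integral_mul_eq_neg_of_hasLineDerivAt {C : ℝ≥0} {ψ φ d : ℂ → ℂ} (hψ : LipschitzWith C ψ)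
    (hφ : IsTestFunction φ) {v : ℂ} (hd : ∀ᵐ z, HasLineDerivAt ℝ ψ (d z) z v) :
    ∫ z, d z * φ z = -∫ z, ψ z * fderiv ℝ φ z v := by
  rw [← integral_lineDeriv_mul_eq_neg hψ hφ v]
  refine integral_congr_ae ?_
  filter_upwards [hd] with z hz
  congr 1
  have h0 : HasDerivAt (fun t : ℝ => ψ (z + t • v)) (d z) 0 := hz
  have h1 : HasLineDerivAt ℝ (fun w => (ψ w).re) (d z).re z v :=
    Complex.reCLM.hasFDerivAt.comp_hasDerivAt (0 : ℝ) h0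
  have h2 : HasLineDerivAt ℝ (fun w => (ψ w).im) (d z).im z v :=
    Complex.imCLM.hasFDerivAt.comp_hasDerivAt (0 : ℝ) h0
  rw [h1.lineDeriv, h2.lineDeriv]

/-- Integration by parts for `∂` and `∂̄`, the line derivatives of `ψ` being `d₁` and `d₂`. -/
lemma integral_mul_wirtinger_eq {C : ℝ≥0} {ψ φ d₁ d₂ : ℂ → ℂ} (hψ : LipschitzWith C ψ)
    (hφ : IsTestFunction φ) (h1 : ∀ᵐ z, HasLineDerivAt ℝ ψ (d₁ z) z 1)
    (h2 : ∀ᵐ z, HasLineDerivAt ℝ ψ (d₂ z) z Complex.I)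
    (hi1 : Integrable fun z => d₁ z * φ z) (hi2 : Integrable fun z => d₂ z * φ z) :
    (∫ z, ψ z * wirtinger φ z = -∫ z, (d₁ z - Complex.I * d₂ z) / 2 * φ z) ∧
    (∫ z, ψ z * wirtingerBar φ z = -∫ z, (d₁ z + Complex.I * d₂ z) / 2 * φ z) := by
  have e1 := integral_mul_eq_neg_of_hasLineDerivAt hψ hφ h1
  have e2 := integral_mul_eq_neg_of_hasLineDerivAt hψ hφ h2
  have J : ∀ v, Integrable fun z => ψ z * fderiv ℝ φ z v := fun v =>
    (hψ.continuous.mul (hφ.fderiv_apply v).continuous).integrable_of_hasCompactSupport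
      (hφ.fderiv_apply v).compact.mul_left
  constructor
  · have a1 : ∀ z, ψ z * wirtinger φ z = (1 / 2) * (ψ z * fderiv ℝ φ z 1) -
        (Complex.I / 2) * (ψ z * fderiv ℝ φ z Complex.I) := fun z => by
      unfold wirtinger; ring
    have a2 : ∀ z, (d₁ z - Complex.I * d₂ z) / 2 * φ z = (1 / 2) * (d₁ z * φ z) -
        (Complex.I / 2) * (d₂ z * φ z) := fun z => by ring
    simp only [a1, a2]
    rw [integral_sub ((J _).const_mul _) ((J _).const_mul _),
      integral_sub (hi1.const_mul _) (hi2.const_mul _)]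
    simp only [integral_const_mul]
    rw [e1, e2]
    ring
  · have a1 : ∀ z, ψ z * wirtingerBar φ z = (1 / 2) * (ψ z * fderiv ℝ φ z 1) +
        (Complex.I / 2) * (ψ z * fderiv ℝ φ z Complex.I) := fun z => by
      unfold wirtingerBar; ring
    have a2 : ∀ z, (d₁ z + Complex.I * d₂ z) / 2 * φ z = (1 / 2) * (d₁ z * φ z) +
        (Complex.I / 2) * (d₂ z * φ z) := fun z => by ring
    simp only [a1, a2]
    rw [integral_add ((J _).const_mul _) ((J _).const_mul _),
      integral_add (hi1.const_mul _) (hi2.const_mul _)]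
    simp only [integral_const_mul]
    rw [e1, e2]
    ring

namespace IsTestFunction

variable {φ χ : ℂ → ℂ}

lemma ae_hasLineDerivAt (h : IsTestFunction φ) (v : ℂ) :
    ∀ᵐ z, HasLineDerivAt ℝ φ (fderiv ℝ φ z v) z v :=
  Eventually.of_forall fun z => (h.differentiable z).hasFDerivAt.hasLineDerivAt v

lemma integrable_mul (h : IsTestFunction φ) {ψ : ℂ → ℂ} (hψ : Continuous ψ) :
    Integrable fun z => ψ z * φ z :=
  (hψ.mul h.continuous).integrable_of_hasCompactSupport h.compact.mul_left

lemma integral_mul_wirtinger (h : IsTestFunction φ) (h' : IsTestFunction χ) :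
    ∫ z, φ z * _root_.wirtinger χ z = -∫ z, _root_.wirtinger φ z * χ z := by
  obtain ⟨C, hC⟩ := h.exists_lipschitz
  exact (integral_mul_wirtinger_eq hC h' (h.ae_hasLineDerivAt _) (h.ae_hasLineDerivAt _)
    (h'.integrable_mul (h.fderiv_apply _).continuous)
    (h'.integrable_mul (h.fderiv_apply _).continuous)).1

lemma integral_mul_wirtingerBar (h : IsTestFunction φ) (h' : IsTestFunction χ) :
    ∫ z, φ z * _root_.wirtingerBar χ z = -∫ z, _root_.wirtingerBar φ z * χ z := by
  obtain ⟨C, hC⟩ := h.exists_lipschitz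
  exact (integral_mul_wirtinger_eq hC h' (h.ae_hasLineDerivAt _) (h.ae_hasLineDerivAt _)
    (h'.integrable_mul (h.fderiv_apply _).continuous)
    (h'.integrable_mul (h.fderiv_apply _).continuous)).2

lemma fderiv_fderiv_comm (h : IsTestFunction φ) (z v w : ℂ) :
    fderiv ℝ (fun z => fderiv ℝ φ z v) z w = fderiv ℝ (fun z => fderiv ℝ φ z w) z v := by
  have hd : DifferentiableAt ℝ (fderiv ℝ φ) z :=
    (h.smooth.fderiv_right (m := ∞) (by simp)).differentiable (by simp) z
  have e : ∀ v w : ℂ, fderiv ℝ (fun z => fderiv ℝ φ z v) z w = fderiv ℝ (fderiv ℝ φ) z w v := by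
    intro v w
    have := (hd.hasFDerivAt.clm_apply (hasFDerivAt_const v z)).fderiv
    rw [this]
    simp
  rw [e, e]
  exact (h.smooth.contDiffAt.isSymmSndFDerivAt
    (by rw [minSmoothness_of_isRCLikeNormedField]; exact WithTop.coe_le_coe.2 le_top)).eq w v

lemma wirtinger_wirtingerBar (h : IsTestFunction φ) (z : ℂ) :
    _root_.wirtinger (_root_.wirtingerBar φ) z = _root_.wirtingerBar (_root_.wirtinger φ) z := by
  have hd : ∀ v, DifferentiableAt ℝ (fun z => fderiv ℝ φ z v) z := fun v =>
    (h.fderiv_apply v).differentiable z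
  have e1 : ∀ v, fderiv ℝ (_root_.wirtingerBar φ) z v =
      (fderiv ℝ (fun z => fderiv ℝ φ z 1) z v +
        Complex.I * fderiv ℝ (fun z => fderiv ℝ φ z Complex.I) z v) / 2 := by
    intro v
    have := (((hd 1).hasFDerivAt.add ((hd Complex.I).hasFDerivAt.const_mul Complex.I)).mul_const
      (2⁻¹ : ℂ)).fderiv
    have e : _root_.wirtingerBar φ = fun z => (fderiv ℝ φ z 1 +
      Complex.I * fderiv ℝ φ z Complex.I) * 2⁻¹ := by ext; unfold _root_.wirtingerBar; ring
    rw [e]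
    erw [this]
    simp
    ring
  have e2 : ∀ v, fderiv ℝ (_root_.wirtinger φ) z v =
      (fderiv ℝ (fun z => fderiv ℝ φ z 1) z v -
        Complex.I * fderiv ℝ (fun z => fderiv ℝ φ z Complex.I) z v) / 2 := by
    intro v
    have := (((hd 1).hasFDerivAt.sub ((hd Complex.I).hasFDerivAt.const_mul Complex.I)).mul_const
      (2⁻¹ : ℂ)).fderiv
    have e : _root_.wirtinger φ = fun z => (fderiv ℝ φ z 1 -
      Complex.I * fderiv ℝ φ z Complex.I) * 2⁻¹ := by ext; unfold _root_.wirtinger; ring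
    rw [e]
    erw [this]
    simp
    ring
  rw [_root_.wirtinger, _root_.wirtingerBar, e1, e1, e2, e2, h.fderiv_fderiv_comm z 1 Complex.I]
  ring

/-- Two integrations by parts and the commutation of $\partial$ with $\overline\partial$. With
$\chi=\bar\varphi$ it becomes $\|\partial\varphi\|_2=\|\overline\partial\varphi\|_2$, the isometry
behind the Beurling transform. -/
lemma integral_wirtinger_mul_wirtingerBar (h : IsTestFunction φ) (h' : IsTestFunction χ) :
    ∫ z, _root_.wirtinger φ z * _root_.wirtingerBar χ z =
      ∫ z, _root_.wirtingerBar φ z * _root_.wirtinger χ z := by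
  rw [h.wirtinger.integral_mul_wirtingerBar h', h.wirtingerBar.integral_mul_wirtinger h']
  simp only [h.wirtinger_wirtingerBar]

end IsTestFunction

/-! ### The regularised Cauchy kernel -/

section CutCauchyKernel

/-- The Cauchy kernel `1 / w`, replaced inside the disc of radius `ε` by the linear function
`conj w / ε²`. -/
noncomputable def cutCauchyKernel (ε : ℝ) (w : ℂ) : ℂ :=
  starRingEnd ℂ w / ((max ‖w‖ ε ^ 2 : ℝ) : ℂ)

variable {ε : ℝ}

lemma cutCauchyKernel_of_le {w : ℂ} (h : ‖w‖ ≤ ε) :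
    cutCauchyKernel ε w = starRingEnd ℂ w / ((ε ^ 2 : ℝ) : ℂ) := by
  rw [cutCauchyKernel, max_eq_right h]

lemma cutCauchyKernel_of_ge {w : ℂ} (h : ε ≤ ‖w‖) : cutCauchyKernel ε w = w⁻¹ := by
  rw [cutCauchyKernel, max_eq_left h, Complex.inv_def, ← Complex.sq_norm]
  rw [div_eq_mul_inv]
  push_cast
  rfl

lemma norm_cutCauchyKernel_le (hε : 0 < ε) (w : ℂ) : ‖cutCauchyKernel ε w‖ ≤ ‖w‖⁻¹ := by
  rw [cutCauchyKernel, norm_div, RCLike.norm_conj, Complex.norm_real,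
    Real.norm_of_nonneg (by positivity)]
  have hm : 0 < max ‖w‖ ε := lt_max_of_lt_right hε
  rcases eq_or_ne w 0 with rfl | hw
  · simp
  · have hw' : 0 < ‖w‖ := norm_pos_iff.2 hw
    rw [div_le_iff₀ (by positivity), inv_mul_eq_div, le_div_iff₀ hw', ← sq]
    gcongr
    exact le_max_left _ _

/-- The inner and outer formulas agree on $|w|=\varepsilon$, where $\bar w/\varepsilon^2=1/w$. The
Lipschitz property ensures that integration by parts leaves no term on that circle. -/
lemma lipschitzWith_cutCauchyKernel (hε : 0 < ε) :
    LipschitzWith (Real.toNNReal (3 / ε ^ 2)) (cutCauchyKernel ε) := by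
  have key : ∀ a b : ℂ, ‖a‖ ≤ ‖b‖ →
      ‖cutCauchyKernel ε a - cutCauchyKernel ε b‖ ≤ 3 / ε ^ 2 * ‖a - b‖ := by
    intro a b hab
    set m := max ‖a‖ ε with hm
    set n := max ‖b‖ ε with hn
    have hm0 : 0 < m := lt_max_of_lt_right hε
    have hmε : ε ≤ m := le_max_right _ _
    have hmn : m ≤ n := max_le_max_right _ hab
    have hn0 : 0 < n := hm0.trans_le hmn
    have ham : ‖a‖ ≤ m := le_max_left _ _
    have hnm : n - m ≤ ‖a - b‖ := by
      have h1 := abs_max_sub_max_le_abs ‖b‖ ‖a‖ ε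
      have h2 := abs_norm_sub_norm_le b a
      rw [norm_sub_rev] at h2
      exact (le_abs_self _).trans (h1.trans h2)
    have e : cutCauchyKernel ε a - cutCauchyKernel ε b =
        starRingEnd ℂ (a - b) * (((n ^ 2)⁻¹ : ℝ) : ℂ) +
          starRingEnd ℂ a * (((n ^ 2 - m ^ 2) / (m ^ 2 * n ^ 2) : ℝ) : ℂ) := by
      rw [cutCauchyKernel, cutCauchyKernel, ← hm, ← hn]
      have c1 : (m : ℂ) ≠ 0 := by exact_mod_cast hm0.ne'
      have c2 : (n : ℂ) ≠ 0 := by exact_mod_cast hn0.ne'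
      push_cast
      rw [map_sub]
      field_simp
      ring
    rw [e]
    have hnm0 : 0 ≤ n ^ 2 - m ^ 2 := by nlinarith
    refine (norm_add_le _ _).trans ?_
    rw [norm_mul, norm_mul, RCLike.norm_conj, RCLike.norm_conj, Complex.norm_real,
      Complex.norm_real, Real.norm_of_nonneg (by positivity), Real.norm_of_nonneg (by positivity)]
    have b1 : ‖a - b‖ * (n ^ 2)⁻¹ ≤ 1 / ε ^ 2 * ‖a - b‖ := by
      rw [mul_comm, one_div]
      gcongr
      exact hmε.trans hmn
    have b2 : ‖a‖ * ((n ^ 2 - m ^ 2) / (m ^ 2 * n ^ 2)) ≤ 2 / ε ^ 2 * ‖a - b‖ := by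
      calc ‖a‖ * ((n ^ 2 - m ^ 2) / (m ^ 2 * n ^ 2))
          ≤ m * ((n ^ 2 - m ^ 2) / (m ^ 2 * n ^ 2)) := by gcongr
        _ = (n - m) * (n + m) / (m * n ^ 2) := by field_simp; ring
        _ ≤ ‖a - b‖ * (n + n) / (m * n ^ 2) := by gcongr
        _ = 2 / (m * n) * ‖a - b‖ := by field_simp; ring
        _ ≤ 2 / (ε * ε) * ‖a - b‖ := by
            gcongr
            exact hmε.trans hmn
        _ = _ := by rw [sq]
    calc _ ≤ 1 / ε ^ 2 * ‖a - b‖ + 2 / ε ^ 2 * ‖a - b‖ := add_le_add b1 b2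
      _ = _ := by ring
  refine LipschitzWith.of_dist_le_mul fun a b => ?_
  rw [Real.coe_toNNReal _ (by positivity), dist_eq_norm, dist_eq_norm]
  rcases le_total ‖a‖ ‖b‖ with h | h
  · exact key a b h
  · rw [norm_sub_rev, norm_sub_rev a]
    exact key b a h

lemma hasLineDerivAt_cutCauchyKernel_of_lt {w : ℂ} (h : ‖w‖ < ε) (v : ℂ) :
    HasLineDerivAt ℝ (cutCauchyKernel ε) (starRingEnd ℂ v / ((ε ^ 2 : ℝ) : ℂ)) w v := by
  have h1 : HasFDerivAt (fun w : ℂ => starRingEnd ℂ w * ((ε ^ 2 : ℝ) : ℂ)⁻¹)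
      (((ε ^ 2 : ℝ) : ℂ)⁻¹ • (Complex.conjCLE : ℂ →L[ℝ] ℂ)) w :=
    (Complex.conjCLE : ℂ →L[ℝ] ℂ).hasFDerivAt.mul_const _
  have h2 := h1.hasLineDerivAt v
  have h3 : cutCauchyKernel ε =ᶠ[𝓝 w] fun w : ℂ => starRingEnd ℂ w * ((ε ^ 2 : ℝ) : ℂ)⁻¹ := by
    filter_upwards [(isOpen_lt continuous_norm continuous_const).mem_nhds h] with x hx
    rw [cutCauchyKernel_of_le (le_of_lt hx), div_eq_mul_inv]
  refine (h2.congr_of_eventuallyEq h3).congr_deriv ?_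
  simp [div_eq_mul_inv, mul_comm]

lemma hasLineDerivAt_cutCauchyKernel_of_gt (hε : 0 < ε) {w : ℂ} (h : ε < ‖w‖) (v : ℂ) :
    HasLineDerivAt ℝ (cutCauchyKernel ε) (-v / w ^ 2) w v := by
  have hw : w ≠ 0 := norm_pos_iff.1 (hε.trans h)
  have h1 := (hasDerivAt_inv hw).hasFDerivAt.restrictScalars ℝ
  have h2 := h1.hasLineDerivAt v
  have h3 : cutCauchyKernel ε =ᶠ[𝓝 w] fun w : ℂ => w⁻¹ := by
    filter_upwards [(isOpen_lt continuous_const continuous_norm).mem_nhds h] with x hx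
    rw [cutCauchyKernel_of_ge (le_of_lt hx)]
  refine (h2.congr_of_eventuallyEq h3).congr_deriv ?_
  simp [div_eq_mul_inv]

lemma ae_norm_ne (ε : ℝ) : ∀ᵐ w : ℂ, ‖w‖ ≠ ε := by
  have := Measure.addHaar_sphere (volume : Measure ℂ) 0 ε
  rcases lt_or_ge ε 0 with h | h
  · exact Eventually.of_forall fun w hw => by linarith [norm_nonneg w]
  · rw [ae_iff]
    convert this using 2
    ext w
    simp

/-- Inside the disc the kernel has $\partial=0$ and $\overline\partial=\varepsilon^{-2}$; outside,
$\partial=-w^{-2}$ and $\overline\partial=0$. One derivative therefore gives the truncated Beurling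
kernel and the other a disc mean. The same kernel yields the Cauchy-Pompeiu formula as
$\varepsilon\to0$. -/
lemma integral_cutCauchyKernel_mul (hε : 0 < ε) {φ : ℂ → ℂ} (hφ : IsTestFunction φ) :
    (∫ w, cutCauchyKernel ε w * wirtinger φ w = ∫ w in {w : ℂ | ε < ‖w‖}, φ w / w ^ 2) ∧
    (∫ w, cutCauchyKernel ε w * wirtingerBar φ w =
      -(((ε ^ 2 : ℝ) : ℂ)⁻¹ * ∫ w in Metric.ball (0 : ℂ) ε, φ w)) := by
  set D : ℂ → ℂ → ℂ := fun v w =>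
    if ‖w‖ < ε then starRingEnd ℂ v / ((ε ^ 2 : ℝ) : ℂ) else -v / w ^ 2 with hD
  have hDl : ∀ v, ∀ᵐ w, HasLineDerivAt ℝ (cutCauchyKernel ε) (D v w) w v := by
    intro v
    filter_upwards [ae_norm_ne ε] with w hw
    rcases hw.lt_or_gt with h | h
    · simp only [hD, if_pos h]
      exact hasLineDerivAt_cutCauchyKernel_of_lt h v
    · simp only [hD, if_neg h.not_gt]
      exact hasLineDerivAt_cutCauchyKernel_of_gt hε h v
  have hDi : ∀ v, Integrable fun w => D v w * φ w := by
    intro v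
    refine hφ.integrable.bdd_mul (c := ‖v‖ / ε ^ 2) ?_ (Eventually.of_forall fun w => ?_)
    · refine (Measurable.ite (measurableSet_lt measurable_norm measurable_const) measurable_const
        ?_).aestronglyMeasurable
      fun_prop
    · by_cases h : ‖w‖ < ε
      · simp only [hD, if_pos h]
        rw [norm_div, RCLike.norm_conj, Complex.norm_real, Real.norm_of_nonneg (by positivity)]
      · simp only [hD, if_neg h]
        rw [norm_div, norm_neg, norm_pow]
        gcongr
        exact not_lt.1 h
  obtain ⟨h1, h2⟩ := integral_mul_wirtinger_eq (lipschitzWith_cutCauchyKernel hε) hφ (hDl 1)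
    (hDl Complex.I) (hDi 1) (hDi Complex.I)
  refine ⟨?_, ?_⟩
  · rw [h1, ← integral_neg, ← integral_indicator (measurableSet_lt measurable_const measurable_norm)]
    refine integral_congr_ae ?_
    filter_upwards [ae_norm_ne ε] with w hw
    rcases hw.lt_or_gt with h | h
    · rw [Set.indicator_of_notMem (by simpa using h.le)]
      simp only [hD, if_pos h]
      have : Complex.I * starRingEnd ℂ Complex.I = 1 := by simp
      rw [mul_div_assoc', this]
      simp
    · rw [Set.indicator_of_mem (show w ∈ {w : ℂ | ε < ‖w‖} from h)]
      simp only [hD, if_neg h.not_gt]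
      have : Complex.I * -Complex.I = 1 := by simp
      rw [mul_div_assoc', this]
      ring
  · rw [h2, ← integral_const_mul, ← integral_indicator Metric.isOpen_ball.measurableSet]
    congr 1
    refine integral_congr_ae ?_
    filter_upwards [ae_norm_ne ε] with w hw
    rcases hw.lt_or_gt with h | h
    · rw [Set.indicator_of_mem (by simpa using h)]
      simp only [hD, if_pos h]
      have : Complex.I * starRingEnd ℂ Complex.I = 1 := by simp
      rw [mul_div_assoc', this]
      simp
    · rw [Set.indicator_of_notMem (by simpa using h.le)]
      simp only [hD, if_neg h.not_gt]
      have : Complex.I * -Complex.I = 1 := by simp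
      rw [mul_div_assoc', this]
      ring

end CutCauchyKernel

/-! ### Mollification in $L^2(\mathbb C)$ -/

section Mollification

open scoped Convolution

/-- A bump function of radius `1 / (n + 1)` at the origin. -/
noncomputable def mollBump (n : ℕ) : ContDiffBump (0 : ℂ) where
  rIn := 1 / (n + 2)
  rOut := 1 / (n + 1)
  rIn_pos := by positivity
  rIn_lt_rOut := by
    apply one_div_lt_one_div_of_lt <;> [positivity; linarith]

/-- The mollification of `u` at scale `1 / (n + 1)`. -/
noncomputable def mollify (n : ℕ) (u : ℂ → ℂ) : ℂ → ℂ :=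
  ((mollBump n).normed volume ⋆[ContinuousLinearMap.lsmul ℝ ℝ, volume] u)

lemma mollBump_rOut (n : ℕ) : (mollBump n).rOut = 1 / (n + 1) := rfl

lemma mollBump_rOut_le_one (n : ℕ) : (mollBump n).rOut ≤ 1 := by
  rw [mollBump_rOut, div_le_one (by positivity)]
  linarith [(Nat.cast_nonneg n : (0 : ℝ) ≤ n)]

lemma tendsto_mollBump_rOut : Tendsto (fun n => (mollBump n).rOut) atTop (𝓝 0) :=
  tendsto_one_div_add_atTop_nhds_zero_nat

lemma mollify_apply (n : ℕ) (u : ℂ → ℂ) (x : ℂ) :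
    mollify n u x = ∫ t, (((mollBump n).normed volume t : ℝ) : ℂ) * u (x - t) := by
  rw [mollify, convolution_def]
  rfl

lemma mollify_apply' (n : ℕ) (u : ℂ → ℂ) (x : ℂ) :
    mollify n u x = ∫ w, (((mollBump n).normed volume (x - w) : ℝ) : ℂ) * u w := by
  rw [mollify_apply, ← integral_sub_left_eq_self _ volume x]
  simp

lemma contDiff_mollify (n : ℕ) {u : ℂ → ℂ} (hu : LocallyIntegrable u) :
    ContDiff ℝ ∞ (mollify n u) :=
  (mollBump n).hasCompactSupport_normed.contDiff_convolution_left _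
    (mollBump n).contDiff_normed hu

lemma integrable_mollBump_mul (n : ℕ) {u : ℂ → ℂ} (hu : LocallyIntegrable u) (x : ℂ) :
    Integrable fun t => (((mollBump n).normed volume t : ℝ) : ℂ) * u (x - t) :=
  (mollBump n).hasCompactSupport_normed.convolutionExists_left
    (ContinuousLinearMap.lsmul ℝ ℝ) (mollBump n).continuous_normed hu x

lemma mollify_sub (n : ℕ) {u v : ℂ → ℂ} (hu : LocallyIntegrable u) (hv : LocallyIntegrable v)
    (x : ℂ) : mollify n (fun z => u z - v z) x = mollify n u x - mollify n v x := by
  simp only [mollify_apply, mul_sub]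
  exact integral_sub (integrable_mollBump_mul n hu x) (integrable_mollBump_mul n hv x)

lemma mollify_congr (n : ℕ) {u v : ℂ → ℂ} (h : u =ᵐ[volume] v) : mollify n u = mollify n v := by
  ext x
  rw [mollify_apply', mollify_apply']
  refine integral_congr_ae ?_
  filter_upwards [h] with w hw
  rw [hw]

lemma mollify_eq_zero (n : ℕ) {u : ℂ → ℂ} {R : ℝ} (hu : ∀ z, R < ‖z‖ → u z = 0) {x : ℂ}
    (hx : R + 1 < ‖x‖) : mollify n u x = 0 := by
  rw [mollify_apply]
  refine integral_eq_zero_of_ae (Eventually.of_forall fun t => ?_)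
  by_cases ht : ‖t‖ < (mollBump n).rOut
  · have h1 := norm_sub_norm_le x t
    have h2 := mollBump_rOut_le_one n
    simp [hu (x - t) (by linarith)]
  · have : t ∉ Function.support ((mollBump n).normed volume) := by
      rw [ContDiffBump.support_normed_eq]
      simpa using ht
    rw [Function.notMem_support] at this
    simp [this]

lemma hasCompactSupport_of_norm_gt {u : ℂ → ℂ} {R : ℝ} (hu : ∀ z, R < ‖z‖ → u z = 0) :
    HasCompactSupport u := by
  refine HasCompactSupport.intro (isCompact_closedBall (0 : ℂ) R) fun z hz => hu z ?_
  simpa using hz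

lemma isTestFunction_mollify (n : ℕ) {u : ℂ → ℂ} (hu : LocallyIntegrable u) {R : ℝ}
    (hR : ∀ z, R < ‖z‖ → u z = 0) : IsTestFunction (mollify n u) :=
  ⟨contDiff_mollify n hu, hasCompactSupport_of_norm_gt fun _ hx => mollify_eq_zero n hR hx⟩

lemma isTestFunction_mollBump (n : ℕ) (x : ℂ) :
    IsTestFunction fun w => (((mollBump n).normed volume (x - w) : ℝ) : ℂ) where
  smooth := Complex.ofRealCLM.contDiff.comp
    ((mollBump n).contDiff_normed.comp (contDiff_const.sub contDiff_id))
  compact := by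
    have h1 : HasCompactSupport fun w => (mollBump n).normed volume (x - w) :=
      (mollBump n).hasCompactSupport_normed.comp_homeomorph (Homeomorph.subLeft x)
    exact h1.comp_left (g := Complex.ofReal) (by simp)

lemma fderiv_mollify (n : ℕ) {u : ℂ → ℂ} (hu : LocallyIntegrable u) (x v : ℂ) :
    fderiv ℝ (mollify n u) x v = -∫ w, u w *
      fderiv ℝ (fun w => (((mollBump n).normed volume (x - w) : ℝ) : ℂ)) w v := by
  have h := (mollBump n).hasCompactSupport_normed (μ := volume).hasFDerivAt_convolution_left
    (ContinuousLinearMap.lsmul ℝ ℝ) ((mollBump n).contDiff_normed (n := 1)) hu x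
  have hr : ∀ y, HasFDerivAt ((mollBump n).normed volume)
      (fderiv ℝ ((mollBump n).normed volume) y) y := fun y =>
    (((mollBump n).contDiff_normed (n := 1)).differentiable (by simp) y).hasFDerivAt
  have e : fderiv ℝ (mollify n u) x v = ∫ t, ((fderiv ℝ ((mollBump n).normed volume) t v : ℝ) : ℂ)
      * u (x - t) := by
    rw [mollify, h.fderiv, convolution_def, ContinuousLinearMap.integral_apply]
    · rfl
    · refine HasCompactSupport.convolutionExists_left _ ?_ ?_ hu x
      · exact (mollBump n).hasCompactSupport_normed.fderiv ℝ
      · exact ((mollBump n).contDiff_normed (n := 1)).continuous_fderiv (by simp)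
  rw [e, ← integral_sub_left_eq_self _ volume x, ← integral_neg]
  refine integral_congr_ae (Eventually.of_forall fun w => ?_)
  have h2 : HasFDerivAt (fun w => (((mollBump n).normed volume (x - w) : ℝ) : ℂ))
      (Complex.ofRealCLM.comp ((fderiv ℝ ((mollBump n).normed volume) (x - w)).comp
        (-ContinuousLinearMap.id ℝ ℂ))) w :=
    Complex.ofRealCLM.hasFDerivAt.comp w
      ((hr (x - w)).comp w ((hasFDerivAt_id w).const_sub x))
  simp only [h2.fderiv]
  simp
  ring

lemma integrable_mul_of_locallyIntegrable {u φ : ℂ → ℂ} (hu : LocallyIntegrable u)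
    (hφ : IsTestFunction φ) : Integrable fun z => u z * φ z := by
  have := hu.integrable_smul_left_of_hasCompactSupport hφ.continuous hφ.compact
  simpa [mul_comm] using this

/-- The weak derivative is tested on the translated bump $w\mapsto\rho(x-w)$; the reflection in its
argument cancels the sign of the weak formulation. -/
lemma wirtinger_mollify (n : ℕ) {u p : ℂ → ℂ} (hu : LocallyIntegrable u)
    (hp : ∀ φ, IsTestFunction φ → ∫ z, u z * wirtinger φ z = -∫ z, p z * φ z) (x : ℂ) :
    wirtinger (mollify n u) x = mollify n p x := by
  have ht := isTestFunction_mollBump n x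
  have h := hp _ ht
  rw [mollify_apply', wirtinger, fderiv_mollify n hu, fderiv_mollify n hu]
  have i := fun v => integrable_mul_of_locallyIntegrable hu (ht.fderiv_apply v)
  have e : ∀ w, u w * wirtinger (fun w => (((mollBump n).normed volume (x - w) : ℝ) : ℂ)) w =
      (1 / 2) * (u w * fderiv ℝ (fun w => (((mollBump n).normed volume (x - w) : ℝ) : ℂ)) w 1) -
      (Complex.I / 2) *
        (u w * fderiv ℝ (fun w => (((mollBump n).normed volume (x - w) : ℝ) : ℂ)) w Complex.I) :=
    fun w => by unfold wirtinger; ring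
  simp only [e] at h
  rw [integral_sub ((i _).const_mul _) ((i _).const_mul _), integral_const_mul,
    integral_const_mul] at h
  simp only [mul_comm _ (p _)]
  linear_combination -h

lemma wirtingerBar_mollify (n : ℕ) {u q : ℂ → ℂ} (hu : LocallyIntegrable u)
    (hq : ∀ φ, IsTestFunction φ → ∫ z, u z * wirtingerBar φ z = -∫ z, q z * φ z) (x : ℂ) :
    wirtingerBar (mollify n u) x = mollify n q x := by
  have ht := isTestFunction_mollBump n x
  have h := hq _ ht
  rw [mollify_apply', wirtingerBar, fderiv_mollify n hu, fderiv_mollify n hu]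
  have i := fun v => integrable_mul_of_locallyIntegrable hu (ht.fderiv_apply v)
  have e : ∀ w, u w * wirtingerBar (fun w => (((mollBump n).normed volume (x - w) : ℝ) : ℂ)) w =
      (1 / 2) * (u w * fderiv ℝ (fun w => (((mollBump n).normed volume (x - w) : ℝ) : ℂ)) w 1) +
      (Complex.I / 2) *
        (u w * fderiv ℝ (fun w => (((mollBump n).normed volume (x - w) : ℝ) : ℂ)) w Complex.I) :=
    fun w => by unfold wirtingerBar; ring
  simp only [e] at h
  rw [integral_add ((i _).const_mul _) ((i _).const_mul _), integral_const_mul,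
    integral_const_mul] at h
  simp only [mul_comm _ (q _)]
  linear_combination -h

lemma locallyIntegrable_of_memLp_two {u : ℂ → ℂ} (hu : MemLp u 2) : LocallyIntegrable u :=
  hu.locallyIntegrable (by norm_num)

/-- The bump is a probability density $\nu$, so an $L^1(\nu)$ norm is at most the $L^2(\nu)$ norm;
Tonelli and translation invariance do the rest. -/
lemma eLpNorm_mollify_le (n : ℕ) {u : ℂ → ℂ} (hu : MemLp u 2) :
    eLpNorm (mollify n u) 2 volume ≤ eLpNorm u 2 volume := by
  obtain ⟨v, hvm, hv⟩ := hu.1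
  rw [mollify_congr n hv, eLpNorm_congr_ae hv]
  rw [← ENNReal.pow_le_pow_left_iff (two_ne_zero), ← lintegral_enorm_sq_eq, ← lintegral_enorm_sq_eq]
  set ρ : ℂ → ℝ := (mollBump n).normed volume with hρ
  have hρc : Continuous ρ := (mollBump n).continuous_normed
  have hρ0 : ∀ t, 0 ≤ ρ t := (mollBump n).nonneg_normed
  set ν : Measure ℂ := volume.withDensity fun t => ENNReal.ofReal (ρ t) with hν
  have hρm : Measurable fun t => ENNReal.ofReal (ρ t) := hρc.measurable.ennreal_ofReal
  have hprob : IsProbabilityMeasure ν := ⟨by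
    rw [hν, withDensity_apply _ MeasurableSet.univ, Measure.restrict_univ,
      ← ofReal_integral_eq_lintegral_ofReal (mollBump n).integrable_normed
        (Eventually.of_forall hρ0), (mollBump n).integral_normed, ENNReal.ofReal_one]⟩
  have hpt : ∀ x, ‖mollify n v x‖ₑ ^ 2 ≤ ∫⁻ t, ‖v (x - t)‖ₑ ^ 2 ∂ν := by
    intro x
    have hvx : StronglyMeasurable fun t => v (x - t) := hvm.comp_measurable (by fun_prop)
    have h1 : ‖mollify n v x‖ₑ ≤ ∫⁻ t, ‖v (x - t)‖ₑ ∂ν := by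
      rw [mollify_apply, hν, lintegral_withDensity_eq_lintegral_mul _ hρm hvx.measurable.enorm]
      refine (enorm_integral_le_lintegral_enorm _).trans (lintegral_mono fun t => ?_)
      rw [enorm_mul, Pi.mul_apply]
      gcongr
      rw [← ofReal_norm, Complex.norm_real, Real.norm_of_nonneg (hρ0 t)]
    have h2 : ∫⁻ t, ‖v (x - t)‖ₑ ∂ν ≤ eLpNorm (fun t => v (x - t)) 2 ν := by
      rw [← eLpNorm_one_eq_lintegral_enorm]
      exact eLpNorm_le_eLpNorm_of_exponent_le (by norm_num) hvx.aestronglyMeasurable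
    rw [lintegral_enorm_sq_eq]
    gcongr
    exact h1.trans h2
  calc ∫⁻ x, ‖mollify n v x‖ₑ ^ 2 ≤ ∫⁻ x, ∫⁻ t, ‖v (x - t)‖ₑ ^ 2 ∂ν := lintegral_mono hpt
    _ = ∫⁻ t, ∫⁻ x, ‖v (x - t)‖ₑ ^ 2 ∂volume ∂ν := by
        refine lintegral_lintegral_swap (Measurable.aemeasurable ?_)
        exact ((hvm.measurable.comp (measurable_fst.sub measurable_snd)).enorm.pow_const 2)
    _ = ∫⁻ t, (∫⁻ x, ‖v x‖ₑ ^ 2) ∂ν := by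
        refine lintegral_congr fun t => ?_
        exact lintegral_sub_right_eq_self (fun x => ‖v x‖ₑ ^ 2) t
    _ = _ := by simp

lemma tendsto_eLpNorm_mollify_sub_of_test {g : ℂ → ℂ} (hg : IsTestFunction g) :
    Tendsto (fun n => eLpNorm (fun z => mollify n g z - g z) 2 volume) atTop (𝓝 0) := by
  obtain ⟨D, hD⟩ := hg.exists_lipschitz
  obtain ⟨R, hR⟩ := hg.compact.isCompact.isBounded.subset_closedBall 0
  have hR0 : ∀ z, R < ‖z‖ → g z = 0 := by
    intro z hz
    by_contra hc
    have := hR (subset_tsupport g hc)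
    simp at this
    linarith
  set K := Metric.closedBall (0 : ℂ) (R + 1) with hK
  have hbound : ∀ n, eLpNorm (fun z => mollify n g z - g z) 2 volume ≤
      ENNReal.ofReal (D * (mollBump n).rOut) * (volume K) ^ (1 / 2 : ℝ) := by
    intro n
    have h1 : ∀ z, ‖mollify n g z - g z‖ ≤
        ‖K.indicator (fun _ => (D * (mollBump n).rOut : ℝ)) z‖ := by
      intro z
      by_cases hz : z ∈ K
      · rw [Set.indicator_of_mem hz, ← dist_eq_norm, Real.norm_of_nonneg
          (mul_nonneg D.coe_nonneg (mollBump n).rOut_pos.le)]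
        refine ContDiffBump.dist_normed_convolution_le hg.continuous.aestronglyMeasurable
          fun x hx => ?_
        exact (hD.dist_le_mul x z).trans
          (mul_le_mul_of_nonneg_left (le_of_lt hx) D.coe_nonneg)
      · have hz' : R + 1 < ‖z‖ := by simpa [hK] using hz
        rw [mollify_eq_zero n hR0 hz', hR0 z (by linarith)]
        simp
    refine (eLpNorm_mono h1).trans ?_
    rw [eLpNorm_indicator_const Metric.isClosed_closedBall.measurableSet (by norm_num) (by norm_num)]
    rw [← ofReal_norm, Real.norm_of_nonneg (mul_nonneg D.coe_nonneg (mollBump n).rOut_pos.le),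
      ENNReal.toReal_ofNat]
  refine tendsto_of_tendsto_of_tendsto_of_le_of_le tendsto_const_nhds ?_ (fun _ => zero_le) hbound
  have h2 : Tendsto (fun n => ENNReal.ofReal (D * (mollBump n).rOut)) atTop (𝓝 0) := by
    have := ENNReal.tendsto_ofReal (tendsto_mollBump_rOut.const_mul (D : ℝ))
    simpa using this
  have hfin : (volume K) ^ (1 / 2 : ℝ) ≠ ⊤ :=
    ENNReal.rpow_ne_top_of_nonneg (by norm_num) (isCompact_closedBall _ _).measure_lt_top.ne
  simpa using ENNReal.Tendsto.mul_const h2 (Or.inr hfin)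

lemma aestronglyMeasurable_mollify (n : ℕ) {u : ℂ → ℂ} (hu : LocallyIntegrable u) :
    AEStronglyMeasurable (mollify n u) :=
  (contDiff_mollify n hu).continuous.aestronglyMeasurable

/-- Approximation by a test function within $\delta/3$: mollification is a contraction on the
difference, and converges on the test function. -/
lemma tendsto_eLpNorm_mollify_sub {u : ℂ → ℂ} (hu : MemLp u 2) :
    Tendsto (fun n => eLpNorm (fun z => mollify n u z - u z) 2 volume) atTop (𝓝 0) := by
  rw [ENNReal.tendsto_nhds_zero]
  intro δ hδ
  wlog hδ' : δ ≠ ⊤ generalizing δ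
  · simp only [ne_eq, not_not] at hδ'
    simp [hδ']
  have hδ3 : 0 < (δ / 3).toReal := ENNReal.toReal_pos (by simp [hδ.ne']) (by finiteness)
  obtain ⟨g, hg1, hg2, hg3⟩ := MemLp.exist_eLpNorm_sub_le (by norm_num) (by norm_num) hu hδ3
  have hg : IsTestFunction g := ⟨hg2, hg1⟩
  rw [ENNReal.ofReal_toReal (by finiteness)] at hg3
  have hlu := locallyIntegrable_of_memLp_two hu
  have hlg := locallyIntegrable_of_memLp_two (hg.memLp 2)
  filter_upwards [ENNReal.tendsto_nhds_zero.1 (tendsto_eLpNorm_mollify_sub_of_test hg) (δ / 3)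
    (ENNReal.div_pos hδ.ne' (by simp))] with n hn
  have hd : MemLp (fun z => u z - g z) 2 := hu.sub (hg.memLp 2)
  have e : (fun z => mollify n u z - u z) = (fun z => mollify n (fun z => u z - g z) z) +
      ((fun z => mollify n g z - g z) - fun z => u z - g z) := by
    ext z
    simp only [Pi.add_apply, Pi.sub_apply, mollify_sub n hlu hlg]
    ring
  rw [e]
  have m1 := aestronglyMeasurable_mollify n (locallyIntegrable_of_memLp_two hd)
  have m2 : AEStronglyMeasurable fun z => mollify n g z - g z :=
    (aestronglyMeasurable_mollify n hlg).sub hg.continuous.aestronglyMeasurable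
  calc _ ≤ eLpNorm (fun z => mollify n (fun z => u z - g z) z) 2 volume +
        eLpNorm ((fun z => mollify n g z - g z) - fun z => u z - g z) 2 volume :=
        eLpNorm_add_le m1 (m2.sub hd.1) (by norm_num)
    _ ≤ δ / 3 + (δ / 3 + δ / 3) := by
        gcongr
        · exact (eLpNorm_mollify_le n hd).trans hg3
        · refine (eLpNorm_sub_le m2 hd.1 (by norm_num)).trans ?_
          gcongr
          exact hg3
    _ = δ := by rw [← add_assoc, ENNReal.add_thirds]

end Mollification

/-! ### The Beurling transform as an $L^2$ operator -/

section Extension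

lemma wirtinger_add {φ χ : ℂ → ℂ} (h : IsTestFunction φ) (h' : IsTestFunction χ) :
    wirtinger (φ + χ) = wirtinger φ + wirtinger χ := by
  ext z
  simp only [wirtinger, Pi.add_apply, fderiv_add (h.differentiable z) (h'.differentiable z),
    add_apply]
  ring

lemma wirtingerBar_add {φ χ : ℂ → ℂ} (h : IsTestFunction φ) (h' : IsTestFunction χ) :
    wirtingerBar (φ + χ) = wirtingerBar φ + wirtingerBar χ := by
  ext z
  simp only [wirtingerBar, Pi.add_apply, fderiv_add (h.differentiable z) (h'.differentiable z),
    add_apply]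
  ring

lemma wirtinger_const_smul {φ : ℂ → ℂ} (h : IsTestFunction φ) (c : ℂ) :
    wirtinger (c • φ) = c • wirtinger φ := by
  ext z
  simp only [wirtinger, Pi.smul_apply, fderiv_const_smul (h.differentiable z) c,
    smul_apply, smul_eq_mul]
  ring

lemma wirtingerBar_const_smul {φ : ℂ → ℂ} (h : IsTestFunction φ) (c : ℂ) :
    wirtingerBar (c • φ) = c • wirtingerBar φ := by
  ext z
  simp only [wirtingerBar, Pi.smul_apply, fderiv_const_smul (h.differentiable z) c,
    smul_apply, smul_eq_mul]
  ring

lemma IsTestFunction.fderiv_conj {φ : ℂ → ℂ} (h : IsTestFunction φ) (z v : ℂ) :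
    fderiv ℝ (fun z => starRingEnd ℂ (φ z)) z v = starRingEnd ℂ (fderiv ℝ φ z v) := by
  have := ((Complex.conjCLE : ℂ →L[ℝ] ℂ).hasFDerivAt.comp z (h.differentiable z).hasFDerivAt).fderiv
  change fderiv ℝ (⇑(Complex.conjCLE : ℂ →L[ℝ] ℂ) ∘ φ) z v = _
  rw [this]
  rfl

lemma IsTestFunction.wirtingerBar_conj {φ : ℂ → ℂ} (h : IsTestFunction φ) (z : ℂ) :
    _root_.wirtingerBar (fun z => starRingEnd ℂ (φ z)) z =
      starRingEnd ℂ (_root_.wirtinger φ z) := by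
  have h2 : starRingEnd ℂ 2 = 2 := map_ofNat _ 2
  simp only [_root_.wirtingerBar, _root_.wirtinger, h.fderiv_conj, map_div₀, h2]
  simp

lemma IsTestFunction.wirtinger_conj {φ : ℂ → ℂ} (h : IsTestFunction φ) (z : ℂ) :
    _root_.wirtinger (fun z => starRingEnd ℂ (φ z)) z =
      starRingEnd ℂ (_root_.wirtingerBar φ z) := by
  have h2 : starRingEnd ℂ 2 = 2 := map_ofNat _ 2
  simp only [_root_.wirtingerBar, _root_.wirtinger, h.fderiv_conj, map_div₀, h2]
  simp [sub_eq_add_neg]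

/-- The space of test functions. -/
def testFunctions : Submodule ℂ (ℂ → ℂ) where
  carrier := {φ | IsTestFunction φ}
  add_mem' h h' := IsTestFunction.add h h'
  zero_mem' := ⟨contDiff_const, HasCompactSupport.zero⟩
  smul_mem' c _ h := IsTestFunction.const_mul h c

lemma isTestFunction_coe (φ : testFunctions) : IsTestFunction (φ : ℂ → ℂ) := φ.2

/-- `∂` as a map from test functions to `L²`. -/
noncomputable def wirtingerLp : testFunctions →ₗ[ℂ] Lp ℂ 2 (volume : Measure ℂ) where
  toFun φ := ((isTestFunction_coe φ).wirtinger.memLp 2).toLp _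
  map_add' φ χ := by
    rw [← MemLp.toLp_add]
    congr 1
    exact wirtinger_add (isTestFunction_coe φ) (isTestFunction_coe χ)
  map_smul' c φ := by
    rw [RingHom.id_apply, ← MemLp.toLp_const_smul]
    congr 1
    exact wirtinger_const_smul (isTestFunction_coe φ) c

/-- `∂̄` as a map from test functions to `L²`. -/
noncomputable def wirtingerBarLp : testFunctions →ₗ[ℂ] Lp ℂ 2 (volume : Measure ℂ) where
  toFun φ := ((isTestFunction_coe φ).wirtingerBar.memLp 2).toLp _
  map_add' φ χ := by
    rw [← MemLp.toLp_add]
    congr 1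
    exact wirtingerBar_add (isTestFunction_coe φ) (isTestFunction_coe χ)
  map_smul' c φ := by
    rw [RingHom.id_apply, ← MemLp.toLp_const_smul]
    congr 1
    exact wirtingerBar_const_smul (isTestFunction_coe φ) c

lemma coeFn_wirtingerLp (φ : testFunctions) : wirtingerLp φ =ᵐ[volume] wirtinger φ :=
  ((isTestFunction_coe φ).wirtinger.memLp 2).coeFn_toLp

lemma coeFn_wirtingerBarLp (φ : testFunctions) : wirtingerBarLp φ =ᵐ[volume] wirtingerBar φ :=
  ((isTestFunction_coe φ).wirtingerBar.memLp 2).coeFn_toLp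

lemma norm_wirtingerLp (φ : testFunctions) : ‖wirtingerLp φ‖ = ‖wirtingerBarLp φ‖ := by
  have h := (isTestFunction_coe φ)
  have key : inner ℂ (wirtingerLp φ) (wirtingerLp φ) =
      inner ℂ (wirtingerBarLp φ) (wirtingerBarLp φ) := by
    rw [L2.inner_def, L2.inner_def]
    have e1 : ∫ z, inner ℂ (wirtingerLp φ z) (wirtingerLp φ z) =
        ∫ z, wirtinger φ z * wirtingerBar (fun z => starRingEnd ℂ ((φ : ℂ → ℂ) z)) z := by
      refine integral_congr_ae ?_
      filter_upwards [coeFn_wirtingerLp φ] with z hz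
      rw [hz, h.wirtingerBar_conj, RCLike.inner_apply]
    have e2 : ∫ z, inner ℂ (wirtingerBarLp φ z) (wirtingerBarLp φ z) =
        ∫ z, wirtingerBar φ z * wirtinger (fun z => starRingEnd ℂ ((φ : ℂ → ℂ) z)) z := by
      refine integral_congr_ae ?_
      filter_upwards [coeFn_wirtingerBarLp φ] with z hz
      rw [hz, h.wirtinger_conj, RCLike.inner_apply]
    rw [e1, e2, h.integral_wirtinger_mul_wirtingerBar h.conj]
  rw [norm_eq_sqrt_re_inner (𝕜 := ℂ), norm_eq_sqrt_re_inner (𝕜 := ℂ), key]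

/-- Weyl's lemma with Liouville's theorem. Each mollification is smooth with $\overline\partial=0$,
hence entire; it is bounded by Cauchy-Schwarz, hence constant; being in $L^2$, it vanishes. The
mollifications converge to `u`. -/
lemma ae_eq_zero_of_forall_integral_mul_wirtingerBar {u : ℂ → ℂ} (hu : MemLp u 2)
    (h : ∀ φ, IsTestFunction φ → ∫ z, u z * wirtingerBar φ z = 0) : u =ᵐ[volume] 0 := by
  have hl := locallyIntegrable_of_memLp_two hu
  have hz : ∀ n x, mollify n u x = 0 := by
    intro n
    have hd : Differentiable ℂ (mollify n u) := by
      intro x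
      rw [differentiableAt_complex_iff_differentiableAt_real]
      refine ⟨(contDiff_mollify n hl).differentiable (by simp) x, ?_⟩
      have hw := wirtingerBar_mollify n (q := 0) hl (fun φ hφ => by simpa using h φ hφ) x
      have h0 : mollify n 0 x = 0 := by simp [mollify_apply]
      rw [h0, wirtingerBar] at hw
      rw [smul_eq_mul]
      have hI := Complex.I_mul_I
      linear_combination (-2 * Complex.I) * hw + (fderiv ℝ (mollify n u) x Complex.I) * hI
    have hb : Bornology.IsBounded (Set.range (mollify n u)) := by
      have hρ : MemLp (fun t => (((mollBump n).normed volume t : ℝ) : ℂ)) 2 := by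
        have := (isTestFunction_mollBump n 0).memLp 2
        exact (this.comp_measurePreserving (Measure.measurePreserving_neg volume)).ae_eq
          (Eventually.of_forall fun t => by simp)
      refine isBounded_iff_forall_norm_le.2 ⟨((eLpNorm (fun t => (((mollBump n).normed volume t : ℝ)
        : ℂ)) 2 volume * eLpNorm u 2 volume)).toReal, ?_⟩
      rintro _ ⟨x, rfl⟩
      rw [← toReal_enorm]
      have hfin : eLpNorm (fun t => (((mollBump n).normed volume t : ℝ) : ℂ)) 2 volume *
          eLpNorm u 2 volume ≠ ⊤ := ENNReal.mul_ne_top hρ.2.ne hu.2.ne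
      refine ENNReal.toReal_mono hfin ?_
      have hmp : MeasurePreserving (fun t : ℂ => x - t) volume volume :=
        Measure.measurePreserving_sub_left volume x
      rw [mollify_apply]
      refine (enorm_integral_mul_le _ (fun t => u (x - t)) hρ.1
        (hu.1.comp_measurePreserving hmp)).trans_eq ?_
      congr 1
      exact eLpNorm_comp_measurePreserving hu.1 hmp
    have hc : ∀ x, mollify n u x = mollify n u 0 := fun x => hd.apply_eq_apply_of_bounded hb x 0
    have hm : MemLp (fun _ : ℂ => mollify n u 0) 2 := by
      have : mollify n u = fun _ => mollify n u 0 := funext hc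
      rw [← this]
      exact ⟨aestronglyMeasurable_mollify n hl, (eLpNorm_mollify_le n hu).trans_lt hu.2⟩
    have h0 := (memLp_const_iff (by norm_num) (by norm_num)).1 hm
    rcases h0 with h0 | h0
    · intro x; rw [hc, h0]
    · simp at h0
  have ht := tendsto_eLpNorm_mollify_sub hu
  simp only [hz, zero_sub] at ht
  have e : eLpNorm (fun z => -u z) 2 volume = 0 := tendsto_nhds_unique tendsto_const_nhds ht
  rw [show (fun z => -u z) = -u from rfl, eLpNorm_neg, eLpNorm_eq_zero_iff hu.1 (by norm_num)] at e
  exact e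

/-- If $v$ is orthogonal to the range, then $\bar v$ annihilates every $\overline\partial\varphi$
and vanishes by the Liouville argument. -/
lemma denseRange_wirtingerBarLp : DenseRange wirtingerBarLp := by
  have : Dense ((LinearMap.range wirtingerBarLp : Submodule ℂ _) : Set (Lp ℂ 2 (volume : Measure ℂ))) := by
    rw [Submodule.dense_iff_topologicalClosure_eq_top, Submodule.topologicalClosure_eq_top_iff,
      Submodule.eq_bot_iff]
    intro v hv
    rw [Submodule.mem_orthogonal] at hv
    have hvm : MemLp (fun z => starRingEnd ℂ (v z)) 2 := (Lp.memLp v).star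
    have h0 : ∀ φ, IsTestFunction φ → ∫ z, starRingEnd ℂ (v z) * wirtingerBar φ z = 0 := by
      intro φ hφ
      have h1 := hv (wirtingerBarLp ⟨φ, hφ⟩) ⟨_, rfl⟩
      rw [L2.inner_def] at h1
      have h2 := congrArg (starRingEnd ℂ) h1
      rw [← integral_conj, map_zero] at h2
      rw [← h2]
      refine integral_congr_ae ?_
      filter_upwards [coeFn_wirtingerBarLp ⟨φ, hφ⟩] with z hz
      rw [hz]
      simp [mul_comm]
    have h2 := ae_eq_zero_of_forall_integral_mul_wirtingerBar hvm h0
    rw [Lp.eq_zero_iff_ae_eq_zero]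
    filter_upwards [h2] with z hz
    simpa using hz
  simpa [DenseRange] using! this

/-- The Beurling transform as an operator on `L²`: the continuous extension of `∂̄φ ↦ ∂φ`. -/
noncomputable def beurlingLp : Lp ℂ 2 (volume : Measure ℂ) →L[ℂ] Lp ℂ 2 (volume : Measure ℂ) :=
  wirtingerLp.extendOfNorm wirtingerBarLp

lemma beurlingLp_wirtingerBarLp (φ : testFunctions) :
    beurlingLp (wirtingerBarLp φ) = wirtingerLp φ :=
  LinearMap.extendOfNorm_eq denseRange_wirtingerBarLp
    ⟨1, fun φ => by rw [one_mul, norm_wirtingerLp]⟩ φ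

lemma norm_beurlingLp_le (f : Lp ℂ 2 (volume : Measure ℂ)) : ‖beurlingLp f‖ ≤ ‖f‖ := by
  refine DenseRange.induction_on (p := fun f => ‖beurlingLp f‖ ≤ ‖f‖) denseRange_wirtingerBarLp f
    ?_ ?_
  · exact isClosed_le (by fun_prop) (by fun_prop)
  · intro φ
    rw [beurlingLp_wirtingerBarLp, norm_wirtingerLp]

/-- The distributional identity $\overline\partial(Sf)=\partial f$, by density of the functions
$\overline\partial\varphi$. In the duality argument it moves $S$ off $k$. -/
lemma integral_beurlingLp_mul_wirtingerBar (f : Lp ℂ 2 (volume : Measure ℂ)) {χ : ℂ → ℂ}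
    (hχ : IsTestFunction χ) :
    ∫ z, beurlingLp f z * wirtingerBar χ z = ∫ z, f z * wirtinger χ z := by
  have hc : Continuous fun f : Lp ℂ 2 (volume : Measure ℂ) =>
      ∫ z, beurlingLp f z * wirtingerBar χ z :=
    (continuous_integral_mul (hχ.wirtingerBar.memLp 2)).comp beurlingLp.continuous
  refine DenseRange.induction_on (p := fun f : Lp ℂ 2 (volume : Measure ℂ) =>
    ∫ z, beurlingLp f z * wirtingerBar χ z = ∫ z, f z * wirtinger χ z)
    denseRange_wirtingerBarLp f ?_ ?_
  · exact isClosed_eq hc (continuous_integral_mul (hχ.wirtinger.memLp 2))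
  · intro φ
    rw [beurlingLp_wirtingerBarLp]
    have e1 : ∫ z, wirtingerLp φ z * wirtingerBar χ z = ∫ z, wirtinger φ z * wirtingerBar χ z := by
      refine integral_congr_ae ?_
      filter_upwards [coeFn_wirtingerLp φ] with z hz
      rw [hz]
    have e2 : ∫ z, wirtingerBarLp φ z * wirtinger χ z = ∫ z, wirtingerBar φ z * wirtinger χ z := by
      refine integral_congr_ae ?_
      filter_upwards [coeFn_wirtingerBarLp φ] with z hz
      rw [hz]
    rw [e1, e2, (isTestFunction_coe φ).integral_wirtinger_mul_wirtingerBar hχ]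

end Extension

/-! ### The principal value as a limit of disc means -/

section Truncation

/-- The kernel of the truncated Beurling transform. -/
noncomputable def truncKernel (ε : ℝ) (z : ℂ) : ℂ → ℂ :=
  {w : ℂ | ε < ‖w - z‖}.indicator fun w => ((w - z) ^ 2)⁻¹

lemma measurableSet_norm_sub_gt (ε : ℝ) (z : ℂ) : MeasurableSet {w : ℂ | ε < ‖w - z‖} :=
  measurableSet_lt measurable_const (by fun_prop)

lemma memLp_truncKernel {ε : ℝ} (hε : 0 < ε) (z : ℂ) : MemLp (truncKernel ε z) 2 := by
  have hm : Measurable (truncKernel ε z) :=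
    Measurable.indicator (by fun_prop) (measurableSet_norm_sub_gt ε z)
  rw [memLp_two_iff_integrable_sq_norm hm.aestronglyMeasurable]
  have h1 : Integrable fun w : ℂ => (1 + ‖w‖) ^ (-(4 : ℝ)) :=
    integrable_one_add_norm (by rw [Complex.finrank_real_complex]; norm_num)
  have h2 : Integrable fun w : ℂ => (1 + ‖w - z‖) ^ (-(4 : ℝ)) := h1.comp_sub_right z
  refine (h2.const_mul (((1 + ε) / ε) ^ 4)).mono' (hm.norm.pow_const 2).aestronglyMeasurable
    (Eventually.of_forall fun w => ?_)
  rw [Real.norm_of_nonneg (by positivity), Real.rpow_neg (by positivity)]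
  have e4 : (1 + ‖w - z‖) ^ (4 : ℝ) = (1 + ‖w - z‖) ^ 4 := by
    exact_mod_cast Real.rpow_natCast (1 + ‖w - z‖) 4
  rw [e4]
  by_cases h : ε < ‖w - z‖
  · rw [truncKernel, Set.indicator_of_mem (show w ∈ {w : ℂ | ε < ‖w - z‖} from h)]
    have hp : 0 < ‖w - z‖ := hε.trans h
    rw [norm_inv, norm_pow, inv_pow, ← pow_mul, ← div_eq_mul_inv, le_div_iff₀ (by positivity),
      inv_mul_eq_div, ← div_pow]
    have : (1 + ‖w - z‖) / ‖w - z‖ ≤ (1 + ε) / ε := by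
      rw [div_le_div_iff₀ hp hε]
      nlinarith
    gcongr
  · rw [truncKernel, Set.indicator_of_notMem (show w ∉ {w : ℂ | ε < ‖w - z‖} from h)]
    simp only [norm_zero, ne_eq, OfNat.ofNat_ne_zero, not_false_eq_true, zero_pow]
    positivity

lemma fderiv_comp_add_right' {φ : ℂ → ℂ} (z w : ℂ) :
    fderiv ℝ (fun w => φ (w + z)) w = fderiv ℝ φ (w + z) := fderiv_comp_add_right z

lemma wirtinger_comp_add_right (φ : ℂ → ℂ) (z : ℂ) :
    wirtinger (fun w => φ (w + z)) = fun w => wirtinger φ (w + z) := by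
  ext w; simp only [wirtinger, fderiv_comp_add_right']

lemma wirtingerBar_comp_add_right (φ : ℂ → ℂ) (z : ℂ) :
    wirtingerBar (fun w => φ (w + z)) = fun w => wirtingerBar φ (w + z) := by
  ext w; simp only [wirtingerBar, fderiv_comp_add_right']

/-- The mean of `∂φ` over a disc is a truncated Beurling transform of `∂̄φ`. -/
lemma IsTestFunction.integral_ball_wirtinger {φ : ℂ → ℂ} (hφ : IsTestFunction φ) {ε : ℝ}
    (hε : 0 < ε) (z : ℂ) :
    ∫ w in Metric.ball z ε, _root_.wirtinger φ w =
      -(((ε ^ 2 : ℝ) : ℂ) * ∫ w, _root_.wirtingerBar φ w * truncKernel ε z w) := by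
  have hz := hφ.comp_add_right z
  have h1 := (integral_cutCauchyKernel_mul hε hz.wirtingerBar).1
  have h2 := (integral_cutCauchyKernel_mul hε hz.wirtinger).2
  -- The regularised kernel is paired with
  -- $\partial\overline\partial\varphi=\overline\partial\partial\varphi$ in both ways: one evaluates
  -- to the truncated transform of $\overline\partial\varphi$, the other to the disc integral of
  -- $\partial\varphi$.
  have h3 : ∫ w, cutCauchyKernel ε w *
      _root_.wirtinger (_root_.wirtingerBar fun w => φ (w + z)) w =
      ∫ w, cutCauchyKernel ε w *
        _root_.wirtingerBar (_root_.wirtinger fun w => φ (w + z)) w := by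
    simp only [hz.wirtinger_wirtingerBar]
  rw [h1, h2] at h3
  simp only [wirtingerBar_comp_add_right, wirtinger_comp_add_right] at h3
  have e1 : ∫ w in {w : ℂ | ε < ‖w‖}, _root_.wirtingerBar φ (w + z) / w ^ 2 =
      ∫ w, _root_.wirtingerBar φ w * truncKernel ε z w := by
    rw [← integral_indicator (measurableSet_lt measurable_const measurable_norm),
      ← integral_add_right_eq_self (fun w => _root_.wirtingerBar φ w * truncKernel ε z w) z]
    congr 1
    ext w
    by_cases h : ε < ‖w‖
    · rw [Set.indicator_of_mem (show w ∈ {w : ℂ | ε < ‖w‖} from h), truncKernel,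
        Set.indicator_of_mem (show w + z ∈ {w : ℂ | ε < ‖w - z‖} by simpa using h)]
      simp [div_eq_mul_inv]
    · rw [Set.indicator_of_notMem (show w ∉ {w : ℂ | ε < ‖w‖} from h), truncKernel,
        Set.indicator_of_notMem (show w + z ∉ {w : ℂ | ε < ‖w - z‖} by simpa using h)]
      simp
  have e2 : ∫ w in Metric.ball (0 : ℂ) ε, _root_.wirtinger φ (w + z) =
      ∫ w in Metric.ball z ε, _root_.wirtinger φ w := by
    rw [← integral_indicator Metric.isOpen_ball.measurableSet,
      ← integral_indicator Metric.isOpen_ball.measurableSet,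
      ← integral_add_right_eq_self ((Metric.ball z ε).indicator (_root_.wirtinger φ)) z]
    congr 1
    ext w
    by_cases h : ‖w‖ < ε
    · rw [Set.indicator_of_mem (show w ∈ Metric.ball (0 : ℂ) ε by simpa using h),
        Set.indicator_of_mem (show w + z ∈ Metric.ball z ε by simpa using h)]
    · rw [Set.indicator_of_notMem (show w ∉ Metric.ball (0 : ℂ) ε by simpa using h),
        Set.indicator_of_notMem (show w + z ∉ Metric.ball z ε by simpa using h)]
  rw [e1, e2] at h3
  rw [h3]
  have : ((ε ^ 2 : ℝ) : ℂ) ≠ 0 := by exact_mod_cast (by positivity : ε ^ 2 ≠ 0)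
  field_simp

lemma memLp_indicator_ball (z : ℂ) (ε : ℝ) :
    MemLp ((Metric.ball z ε).indicator fun _ => (1 : ℂ)) 2 :=
  memLp_indicator_const 2 Metric.isOpen_ball.measurableSet 1 (Or.inr measure_ball_lt_top.ne)

/-- Both sides pair `f`, or its image under a bounded operator, with fixed $L^2$ functions, so the
test function case extends by density. After division by $\pi\varepsilon^2$, the truncated Beurling
integral is exactly the mean of $Sf$ over the disc. -/
lemma integral_ball_beurlingLp (f : Lp ℂ 2 (volume : Measure ℂ)) {ε : ℝ} (hε : 0 < ε) (z : ℂ) :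
    ∫ w in Metric.ball z ε, beurlingLp f w =
      -(((ε ^ 2 : ℝ) : ℂ) * ∫ w, f w * truncKernel ε z w) := by
  have e : ∀ g : ℂ → ℂ, ∫ w in Metric.ball z ε, g w =
      ∫ w, g w * (Metric.ball z ε).indicator (fun _ => (1 : ℂ)) w := by
    intro g
    rw [← integral_indicator Metric.isOpen_ball.measurableSet]
    congr 1
    ext w
    by_cases h : w ∈ Metric.ball z ε
    · simp [Set.indicator_of_mem h]
    · simp [Set.indicator_of_notMem h]
  rw [e]
  have hc : Continuous fun f : Lp ℂ 2 (volume : Measure ℂ) =>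
      ∫ w, beurlingLp f w * (Metric.ball z ε).indicator (fun _ => (1 : ℂ)) w :=
    (continuous_integral_mul (memLp_indicator_ball z ε)).comp beurlingLp.continuous
  refine DenseRange.induction_on (p := fun f : Lp ℂ 2 (volume : Measure ℂ) =>
      ∫ w, beurlingLp f w * (Metric.ball z ε).indicator (fun _ => (1 : ℂ)) w =
      -(((ε ^ 2 : ℝ) : ℂ) * ∫ w, f w * truncKernel ε z w))
    denseRange_wirtingerBarLp f ?_ ?_
  · exact isClosed_eq hc ((continuous_integral_mul (memLp_truncKernel hε z)).const_mul _).neg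
  · intro φ
    rw [beurlingLp_wirtingerBarLp]
    have e1 : ∫ w, wirtingerLp φ w * (Metric.ball z ε).indicator (fun _ => (1 : ℂ)) w =
        ∫ w, wirtinger φ w * (Metric.ball z ε).indicator (fun _ => (1 : ℂ)) w := by
      refine integral_congr_ae ?_
      filter_upwards [coeFn_wirtingerLp φ] with z hz
      rw [hz]
    have e2 : ∫ w, wirtingerBarLp φ w * truncKernel ε z w =
        ∫ w, wirtingerBar φ w * truncKernel ε z w := by
      refine integral_congr_ae ?_
      filter_upwards [coeFn_wirtingerBarLp φ] with z hz
      rw [hz]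
    rw [e1, e2, ← e, (isTestFunction_coe φ).integral_ball_wirtinger hε]

lemma ball_ae_eq_closedBall (z : ℂ) (ε : ℝ) :
    Metric.ball z ε =ᵐ[volume] Metric.closedBall z ε := by
  have h : ∀ᵐ w : ℂ, ‖w - z‖ ≠ ε :=
    (measurePreserving_sub_right volume z).quasiMeasurePreserving.ae (ae_norm_ne ε)
  filter_upwards [h] with w hw
  refine propext ?_
  change dist w z < ε ↔ dist w z ≤ ε
  rw [dist_eq_norm]
  exact ⟨le_of_lt, fun h => lt_of_le_of_ne h hw⟩

/-- The principal value exists almost everywhere and is given by the `L²` operator. -/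
lemma beurling_ae_eq {f : ℂ → ℂ} (hf : MemLp f 2) :
    beurling f =ᵐ[volume] beurlingLp (hf.toLp f) := by
  -- As truncated integrals are disc means of `beurlingLp`, Lebesgue's differentiation theorem gives
  -- their convergence; no maximal singular integral is needed.
  have hL := IsUnifLocDoublingMeasure.ae_tendsto_average (volume : Measure ℂ)
    (locallyIntegrable_of_memLp_two (Lp.memLp (beurlingLp (hf.toLp f)))) 1
  filter_upwards [hL] with z hz
  have h1 := hz (l := 𝓝[>] (0 : ℝ)) (fun _ => z) id tendsto_id
    (by filter_upwards [self_mem_nhdsWithin] with r hr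
        have : 0 < r := hr
        simpa using this.le)
  refine Tendsto.limUnder_eq (h1.congr' ?_)
  filter_upwards [self_mem_nhdsWithin] with ε hε
  have hε0 : 0 < ε := hε
  simp only [id]
  rw [← setAverage_congr (ball_ae_eq_closedBall z ε), setAverage_eq,
    integral_ball_beurlingLp _ hε0]
  have e1 : ∫ w, (hf.toLp f) w * truncKernel ε z w =
      ∫ w in {w : ℂ | ε < ‖w - z‖}, f w / (w - z) ^ 2 := by
    rw [← integral_indicator (measurableSet_norm_sub_gt ε z)]
    refine integral_congr_ae ?_
    filter_upwards [hf.coeFn_toLp] with w hw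
    rw [hw, truncKernel]
    by_cases h : w ∈ {w : ℂ | ε < ‖w - z‖}
    · rw [Set.indicator_of_mem h, Set.indicator_of_mem h, div_eq_mul_inv]
    · rw [Set.indicator_of_notMem h, Set.indicator_of_notMem h, mul_zero]
  rw [e1, Measure.real, Complex.volume_ball]
  simp only [ENNReal.toReal_mul, ENNReal.toReal_pow, ENNReal.toReal_ofReal hε0.le,
    ENNReal.coe_toReal, NNReal.coe_real_pi, Complex.real_smul]
  have h3 : (Real.pi : ℂ) ≠ 0 := by exact_mod_cast Real.pi_ne_zero
  have h4 : (ε : ℂ) ≠ 0 := by exact_mod_cast hε0.ne'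
  push_cast
  field_simp

end Truncation

/-! ### Solving $k-\mu Sk=\Phi$ in $L^2(\mathbb C)$ -/

section Beltrami

/-- Solution of `k - μ S k = Φ` by contraction in `L²`. -/
lemma exists_beltrami_solution {μ : ℂ → ℂ} (hμ : AEStronglyMeasurable μ)
    (hμ1 : eLpNorm μ ∞ volume < 1) :
    ∃ C : ℝ≥0, ∀ Φ : ℂ → ℂ, MemLp Φ 2 → ∃ k K : ℂ → ℂ, MemLp k 2 ∧ MemLp K 2 ∧
      eLpNorm K 2 volume ≤ C * eLpNorm Φ 2 volume ∧ (∀ᵐ z, k z - μ z * K z = Φ z) ∧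
      beurling k =ᵐ[volume] K ∧
      ∀ χ, IsTestFunction χ → ∫ z, K z * wirtingerBar χ z = ∫ z, k z * wirtinger χ z := by
  set m : ℝ≥0 := (eLpNorm μ ∞ volume).toNNReal with hm
  have hmtop : eLpNorm μ ∞ volume ≠ ⊤ := (hμ1.trans ENNReal.one_lt_top).ne
  have hmc : (m : ℝ≥0∞) = eLpNorm μ ∞ volume := ENNReal.coe_toNNReal hmtop
  have hm1 : m < 1 := by
    rw [← hmc] at hμ1
    exact_mod_cast hμ1
  have hmul : ∀ g : ℂ → ℂ, MemLp g 2 → MemLp (fun z => μ z * g z) 2 ∧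
      eLpNorm (fun z => μ z * g z) 2 volume ≤ m * eLpNorm g 2 volume := by
    intro g hg
    have h1 : eLpNorm (fun z => μ z * g z) 2 volume ≤ m * eLpNorm g 2 volume := by
      rw [hmc]
      exact eLpNorm_smul_le_eLpNorm_top_mul_eLpNorm 2 hg.1 μ
    exact ⟨⟨hμ.mul hg.1, h1.trans_lt (ENNReal.mul_lt_top ENNReal.coe_lt_top hg.2)⟩, h1⟩
  refine ⟨(1 - m)⁻¹, fun Φ hΦ => ?_⟩
  -- The map $f\mapsto\mu Sf+\Phi$ contracts with ratio $\|\mu\|_\infty<1$, because $S$ does not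
  -- increase the $L^2$ norm.
  set T : Lp ℂ 2 (volume : Measure ℂ) → Lp ℂ 2 (volume : Measure ℂ) := fun f =>
    (hmul _ (Lp.memLp (beurlingLp f))).1.toLp _ + hΦ.toLp Φ with hT
  have hlip : ∀ f g, ‖T f - T g‖ ≤ m * ‖f - g‖ := by
    intro f g
    have e : T f - T g = (hmul _ (Lp.memLp (beurlingLp (f - g)))).1.toLp _ := by
      rw [hT]
      simp only [add_sub_add_right_eq_sub]
      rw [← MemLp.toLp_sub]
      apply MemLp.toLp_congr
      rw [map_sub]
      filter_upwards [Lp.coeFn_sub (beurlingLp f) (beurlingLp g)] with z hz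
      simp only [Pi.sub_apply, hz]
      ring
    rw [e, Lp.norm_toLp]
    have h2 := (hmul _ (Lp.memLp (beurlingLp (f - g)))).2
    have h3 := ENNReal.toReal_mono
      (ENNReal.mul_ne_top ENNReal.coe_ne_top (Lp.memLp (beurlingLp (f - g))).2.ne) h2
    rw [ENNReal.toReal_mul, ENNReal.coe_toReal, ← Lp.norm_def] at h3
    exact h3.trans (mul_le_mul_of_nonneg_left (norm_beurlingLp_le _) m.coe_nonneg)
  have hcon : ContractingWith m T := ⟨hm1, LipschitzWith.of_dist_le_mul fun f g => by
    rw [dist_eq_norm, dist_eq_norm]; exact hlip f g⟩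
  set k := ContractingWith.fixedPoint T hcon with hk
  have hfix : T k = k := hcon.fixedPoint_isFixedPt
  -- The comparison of $Tk=k$ with $T0=\Phi$ gives $\|k-\Phi\|\le m\|k\|$, and $k$ is absorbed.
  have hkn : ‖k‖ ≤ (1 - m : ℝ)⁻¹ * ‖hΦ.toLp Φ‖ := by
    have h1 := hlip k 0
    have h2 : T 0 = hΦ.toLp Φ := by
      rw [hT]
      simp only [map_zero, add_eq_right]
      rw [Lp.eq_zero_iff_ae_eq_zero]
      refine (MemLp.coeFn_toLp _).trans (ae_of_all _ fun z => ?_)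
      simp
    rw [hfix, h2, sub_zero] at h1
    have h3 := norm_le_norm_add_norm_sub' k (hΦ.toLp Φ)
    have h4 : (0 : ℝ) < 1 - m := by
      have : (m : ℝ) < 1 := by exact_mod_cast hm1
      linarith
    rw [inv_mul_eq_div, le_div_iff₀ h4]
    linarith
  refine ⟨k, beurlingLp k, Lp.memLp k, Lp.memLp _, ?_, ?_, ?_, fun χ hχ =>
    integral_beurlingLp_mul_wirtingerBar k hχ⟩
  · have h1 := (norm_beurlingLp_le k).trans hkn
    rw [Lp.norm_toLp] at h1
    have h5 : ((1 - m : ℝ≥0) : ℝ) = 1 - m := by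
      rw [NNReal.coe_sub hm1.le, NNReal.coe_one]
    rw [← h5, ← NNReal.coe_inv] at h1
    rw [← Lp.enorm_def, ← ofReal_norm, ← ENNReal.ofReal_toReal hΦ.2.ne, ← ENNReal.ofReal_coe_nnreal,
      ← ENNReal.ofReal_mul (NNReal.coe_nonneg _)]
    exact ENNReal.ofReal_le_ofReal h1
  · have e := hfix
    have h1 : k =ᵐ[volume] fun z => μ z * beurlingLp k z + Φ z := by
      conv_lhs => rw [← hfix]
      filter_upwards [Lp.coeFn_add ((hmul _ (Lp.memLp (beurlingLp k))).1.toLp _) (hΦ.toLp Φ),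
        (hmul _ (Lp.memLp (beurlingLp k))).1.coeFn_toLp, hΦ.coeFn_toLp] with z h1 h2 h3
      rw [hT]
      simp only
      rw [h1, Pi.add_apply, h2, h3]
    filter_upwards [h1] with z hz
    rw [hz]
    ring
  · have := beurling_ae_eq (Lp.memLp k)
    rwa [Lp.toLp_coeFn] at this

end Beltrami

/-! ### The Cauchy-Pompeiu formula and the jump relation -/

section Pompeiu

lemma locallyIntegrable_norm_inv : LocallyIntegrable fun w : ℂ => ‖w‖⁻¹ := by
  refine locallyIntegrable_of_norm_le_rpow (C := 1) (α := 1) (by simp) (by simp) ?_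
    (measurable_norm.inv).aestronglyMeasurable
  refine Eventually.of_forall fun w => ?_
  simp [Real.rpow_neg_one]

/-- The Cauchy-Pompeiu formula at the origin. -/
lemma IsTestFunction.integral_wirtingerBar_div {φ : ℂ → ℂ} (hφ : IsTestFunction φ) :
    ∫ w, _root_.wirtingerBar φ w * w⁻¹ = -(Real.pi * φ 0) := by
  set u : ℕ → ℝ := fun n => 1 / ((n : ℝ) + 1) with hu
  have hu0 : ∀ n, 0 < u n := fun n => by positivity
  have hulim : Tendsto u atTop (𝓝 0) := tendsto_one_div_add_atTop_nhds_zero_nat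
  have hb := hφ.wirtingerBar
  have h1 : Tendsto (fun n => ∫ w, cutCauchyKernel (u n) w * _root_.wirtingerBar φ w) atTop
      (𝓝 (∫ w, _root_.wirtingerBar φ w * w⁻¹)) := by
    refine tendsto_integral_of_dominated_convergence
      (fun w => ‖w‖⁻¹ * ‖_root_.wirtingerBar φ w‖) (fun n => ?_) ?_ (fun n => ?_) ?_
    · exact ((lipschitzWith_cutCauchyKernel (hu0 n)).continuous.mul hb.continuous).aestronglyMeasurable
    · have := locallyIntegrable_norm_inv.integrable_smul_left_of_hasCompactSupport
        hb.continuous.norm hb.compact.norm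
      simpa [mul_comm] using this
    · refine Eventually.of_forall fun w => ?_
      rw [norm_mul]
      exact mul_le_mul_of_nonneg_right (norm_cutCauchyKernel_le (hu0 n) w) (norm_nonneg _)
    · have h0 : ∀ᵐ w : ℂ, w ≠ 0 := by simp [ae_iff]
      filter_upwards [h0] with w hw
      refine tendsto_const_nhds.congr' ?_
      filter_upwards [hulim.eventually_lt_const (norm_pos_iff.2 hw)] with n hn
      rw [cutCauchyKernel_of_ge hn.le, mul_comm]
  have h2 : Tendsto (fun n => ∫ w, cutCauchyKernel (u n) w * _root_.wirtingerBar φ w) atTop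
      (𝓝 (-(Real.pi * φ 0))) := by
    -- The pairing with $\overline\partial\varphi$ equals $-\pi$ times the mean of $\varphi$ over
    -- the disc, and these means tend to $\varphi(0)$.
    have hL : Tendsto (fun n => ⨍ w in Metric.ball (0 : ℂ) (u n), φ w) atTop (𝓝 (φ 0)) := by
      obtain ⟨D, hD⟩ := hφ.exists_lipschitz
      rw [tendsto_iff_norm_sub_tendsto_zero]
      refine squeeze_zero (fun n => norm_nonneg _) (g := fun n => D * u n) (fun n => ?_)
        (by simpa using hulim.const_mul (D : ℝ))
      have hvol : volume (Metric.ball (0 : ℂ) (u n)) ≠ 0 :=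
        (Metric.measure_ball_pos volume _ (hu0 n)).ne'
      have hvol' : volume (Metric.ball (0 : ℂ) (u n)) ≠ ⊤ := measure_ball_lt_top.ne
      have hmem := (convex_closedBall (φ 0) (D * u n)).set_average_mem Metric.isClosed_closedBall
        hvol hvol' (f := φ) (by
          filter_upwards [ae_restrict_mem Metric.isOpen_ball.measurableSet] with w hw
          rw [Metric.mem_closedBall]
          exact (hD.dist_le_mul w 0).trans (mul_le_mul_of_nonneg_left (le_of_lt hw) D.coe_nonneg))
        hφ.integrable.integrableOn
      rwa [Metric.mem_closedBall, dist_eq_norm] at hmem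
    refine ((hL.const_mul (Real.pi : ℂ)).neg).congr fun n => ?_
    rw [(integral_cutCauchyKernel_mul (hu0 n) hφ).2, setAverage_eq, Measure.real,
      Complex.volume_ball]
    simp only [ENNReal.toReal_mul, ENNReal.toReal_pow, ENNReal.toReal_ofReal (hu0 n).le,
      ENNReal.coe_toReal, NNReal.coe_real_pi, Complex.real_smul]
    have h3 : (Real.pi : ℂ) ≠ 0 := by exact_mod_cast Real.pi_ne_zero
    have h4 : (u n : ℂ) ≠ 0 := by exact_mod_cast (hu0 n).ne'
    push_cast
    field_simp
  exact tendsto_nhds_unique h1 h2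

lemma IsTestFunction.integral_wirtingerBar_div_sub {φ : ℂ → ℂ} (hφ : IsTestFunction φ) (a : ℂ) :
    ∫ w, _root_.wirtingerBar φ w * (w - a)⁻¹ = -(Real.pi * φ a) := by
  have h := (hφ.comp_add_right a).integral_wirtingerBar_div
  rw [wirtingerBar_comp_add_right] at h
  rw [← integral_add_right_eq_self _ a]
  simpa using h

/-- The jump relation for the Cauchy integral, tested against smooth functions. -/
lemma integral_lineCauchyIntegral_mul_wirtingerBar {g : ℝ → ℂ} (hg : Integrable g) {φ : ℂ → ℂ}
    (hφ : IsTestFunction φ) :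
    ∫ z, lineCauchyIntegral g z * wirtingerBar φ z = (2 * Complex.I)⁻¹ * ∫ x : ℝ, g x * φ x := by
  have hb := hφ.wirtingerBar
  obtain ⟨M, hM⟩ : ∃ M : ℝ, ∀ z, ‖wirtingerBar φ z‖ ≤ M :=
    hb.continuous.bounded_above_of_compact_support hb.compact
  have hM0 : 0 ≤ M := (norm_nonneg _).trans (hM 0)
  set c : ℝ≥0∞ := ∫⁻ w in Metric.ball (0 : ℂ) 1, ‖‖w‖⁻¹‖ₑ with hc
  have hcfin : c < ⊤ :=
    ((locallyIntegrable_norm_inv.integrableOn_isCompact (isCompact_closedBall (0 : ℂ) 1)).mono_set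
      Metric.ball_subset_closedBall).2
  -- The kernel is split at distance $1$ from $x$: near $x$ the factor $1/|w|$ is locally
  -- integrable, farther away it is at most $1$. The bound is uniform in $x$, so Fubini applies to
  -- integrable $g$.
  have hkey : ∀ x : ℝ, ∫⁻ z : ℂ, ‖wirtingerBar φ z * ((x : ℂ) - z)⁻¹‖ₑ ≤
      ENNReal.ofReal M * c + ∫⁻ z, ‖wirtingerBar φ z‖ₑ := by
    intro x
    have e1 : ENNReal.ofReal M * c = ∫⁻ z : ℂ, ENNReal.ofReal M *
        (Metric.ball (0 : ℂ) 1).indicator (fun w => ‖‖w‖⁻¹‖ₑ) ((x : ℂ) - z) := by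
      rw [lintegral_const_mul' _ _ ENNReal.ofReal_ne_top, hc,
        ← lintegral_indicator Metric.isOpen_ball.measurableSet,
        lintegral_sub_left_eq_self (fun z => (Metric.ball (0 : ℂ) 1).indicator
          (fun w => ‖‖w‖⁻¹‖ₑ) z) (x : ℂ)]
    rw [e1, ← lintegral_add_right _ hb.continuous.measurable.enorm]
    refine lintegral_mono fun z => ?_
    rw [enorm_mul]
    by_cases h : (x : ℂ) - z ∈ Metric.ball (0 : ℂ) 1
    · rw [Set.indicator_of_mem h]
      refine le_add_right ?_
      gcongr
      · rw [← ofReal_norm]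
        exact ENNReal.ofReal_le_ofReal (hM z)
      · rw [← enorm_norm, norm_inv]
    · refine le_add_left ?_
      have h' : 1 ≤ ‖(x : ℂ) - z‖ := by simpa using h
      calc _ ≤ ‖wirtingerBar φ z‖ₑ * 1 := by
            gcongr
            rw [← ofReal_norm, ENNReal.ofReal_le_one, norm_inv]
            exact inv_le_one_of_one_le₀ h'
        _ = _ := mul_one _
  have hint : Integrable (Function.uncurry fun (z : ℂ) (x : ℝ) =>
      g x * (wirtingerBar φ z * ((x : ℂ) - z)⁻¹)) (volume.prod volume) := by
    have hm : AEStronglyMeasurable (Function.uncurry fun (z : ℂ) (x : ℝ) =>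
        g x * (wirtingerBar φ z * ((x : ℂ) - z)⁻¹)) (volume.prod volume) := by
      refine (hg.1.comp_snd).mul ?_
      refine Measurable.aestronglyMeasurable ?_
      have := hb.continuous.measurable
      fun_prop
    refine ⟨hm, ?_⟩
    rw [HasFiniteIntegral, lintegral_prod_symm _ hm.enorm]
    simp only [Function.uncurry, enorm_mul]
    calc ∫⁻ x : ℝ, ∫⁻ z : ℂ, ‖g x‖ₑ * (‖wirtingerBar φ z‖ₑ * ‖((x : ℂ) - z)⁻¹‖ₑ)
        ≤ ∫⁻ x : ℝ, ‖g x‖ₑ * (ENNReal.ofReal M * c + ∫⁻ z, ‖wirtingerBar φ z‖ₑ) := by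
          refine lintegral_mono fun x => ?_
          rw [lintegral_const_mul' _ _ enorm_ne_top]
          have := hkey x
          simp only [enorm_mul] at this
          gcongr
      _ = (∫⁻ x : ℝ, ‖g x‖ₑ) * (ENNReal.ofReal M * c + ∫⁻ z, ‖wirtingerBar φ z‖ₑ) := by
          rw [lintegral_mul_const']
          exact (ENNReal.add_lt_top.2 ⟨ENNReal.mul_lt_top ENNReal.ofReal_lt_top hcfin,
            hb.integrable.2⟩).ne
      _ < ⊤ := ENNReal.mul_lt_top hg.2 (ENNReal.add_lt_top.2
          ⟨ENNReal.mul_lt_top ENNReal.ofReal_lt_top hcfin, hb.integrable.2⟩)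
  calc ∫ z, lineCauchyIntegral g z * wirtingerBar φ z
      = (2 * (Real.pi : ℂ) * Complex.I)⁻¹ *
        ∫ z, ∫ x : ℝ, g x * (wirtingerBar φ z * ((x : ℂ) - z)⁻¹) := by
        rw [← integral_const_mul]
        congr 1
        ext z
        rw [lineCauchyIntegral, mul_assoc, ← integral_mul_const]
        congr 2
        ext x
        rw [div_eq_mul_inv]
        ring
    _ = (2 * (Real.pi : ℂ) * Complex.I)⁻¹ *
        ∫ x : ℝ, ∫ z, g x * (wirtingerBar φ z * ((x : ℂ) - z)⁻¹) := by
        rw [integral_integral_swap hint]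
    _ = (2 * (Real.pi : ℂ) * Complex.I)⁻¹ * ∫ x : ℝ, Real.pi * (g x * φ x) := by
        congr 2
        ext x
        rw [integral_const_mul]
        have h := hφ.integral_wirtingerBar_div_sub x
        have e : ∀ z, wirtingerBar φ z * ((x : ℂ) - z)⁻¹ = -(wirtingerBar φ z * (z - (x : ℂ))⁻¹) := by
          intro z
          rw [← mul_neg, ← inv_neg, neg_sub]
        simp only [e]
        rw [integral_neg, h]
        ring
    _ = _ := by
        rw [integral_const_mul]
        have h3 : (Real.pi : ℂ) ≠ 0 := by exact_mod_cast Real.pi_ne_zero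
        have h4 := Complex.I_ne_zero
        field_simp

end Pompeiu

/-! ### Trace inequalities for test functions -/

section TraceInequalities

/-- The fundamental theorem of calculus and Cauchy-Schwarz on an interval of length at most $2r$. -/
lemma enorm_sub_sq_le_of_hasDerivAt {γ γ' : ℝ → ℂ} (h : ∀ t, HasDerivAt γ (γ' t) t)
    (hc : Continuous γ') {r s t : ℝ} (hs : s ∈ Set.Icc (-r) r) (ht : t ∈ Set.Icc (-r) r) :
    ‖γ t - γ s‖ₑ ^ 2 ≤ ENNReal.ofReal (2 * r) * ∫⁻ u in Set.Icc (-r) r, ‖γ' u‖ₑ ^ 2 := by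
  have h1 : γ t - γ s = ∫ u in s..t, γ' u :=
    (intervalIntegral.integral_eq_sub_of_hasDerivAt (fun x _ => h x)
      (hc.intervalIntegrable _ _)).symm
  have hsub : Set.uIoc s t ⊆ Set.Icc (-r) r :=
    Set.uIoc_subset_uIcc.trans (Set.uIcc_subset_Icc hs ht)
  have h2 : ‖γ t - γ s‖ₑ ≤ ‖∫ u in Set.uIoc s t, γ' u * 1‖ₑ := by
    rw [h1, intervalIntegral.intervalIntegral_eq_integral_uIoc]
    simp only [mul_one]
    split_ifs <;> simp
  have h3 := enorm_integral_mul_le (ν := volume.restrict (Set.uIoc s t)) γ' (fun _ => 1)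
    hc.aestronglyMeasurable aestronglyMeasurable_const
  have h4 : eLpNorm (fun _ : ℝ => (1 : ℂ)) 2 (volume.restrict (Set.uIoc s t)) ^ 2 ≤
      ENNReal.ofReal (2 * r) := by
    rw [← lintegral_enorm_sq_eq]
    simp only [enorm_one, one_pow, lintegral_const, one_mul, MeasurableSet.univ,
      Measure.restrict_apply, Set.univ_inter]
    refine (measure_mono hsub).trans_eq ?_
    rw [Real.volume_Icc]
    ring_nf
  calc ‖γ t - γ s‖ₑ ^ 2 ≤ (eLpNorm γ' 2 (volume.restrict (Set.uIoc s t)) *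
        eLpNorm (fun _ : ℝ => (1 : ℂ)) 2 (volume.restrict (Set.uIoc s t))) ^ 2 := by
        gcongr
        exact h2.trans h3
    _ = eLpNorm (fun _ : ℝ => (1 : ℂ)) 2 (volume.restrict (Set.uIoc s t)) ^ 2 *
        ∫⁻ u in Set.uIoc s t, ‖γ' u‖ₑ ^ 2 := by
        rw [lintegral_enorm_sq_eq, mul_pow, mul_comm]
    _ ≤ _ := by
        gcongr

lemma enorm_add_sq_le {a b : ℂ} : ‖a + b‖ₑ ^ 2 ≤ 2 * ‖a‖ₑ ^ 2 + 2 * ‖b‖ₑ ^ 2 := by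
  have h1 : ‖a + b‖ ^ 2 ≤ 2 * ‖a‖ ^ 2 + 2 * ‖b‖ ^ 2 := by
    have := norm_add_le a b
    nlinarith [norm_nonneg (a + b), sq_nonneg (‖a‖ - ‖b‖), norm_nonneg a, norm_nonneg b]
  have := ENNReal.ofReal_le_ofReal h1
  rw [ENNReal.ofReal_add (by positivity) (by positivity), ENNReal.ofReal_mul (by norm_num),
    ENNReal.ofReal_mul (by norm_num), ENNReal.ofReal_pow (norm_nonneg _),
    ENNReal.ofReal_pow (norm_nonneg _), ENNReal.ofReal_pow (norm_nonneg _)] at this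
  simpa [ofReal_norm] using this

variable {ψ : ℂ → ℂ}

lemma IsTestFunction.hasDerivAt_vertical (h : IsTestFunction ψ) (z : ℂ) (t : ℝ) :
    HasDerivAt (fun t : ℝ => ψ (z + t * Complex.I))
      (fderiv ℝ ψ (z + t * Complex.I) Complex.I) t := by
  have h1 : HasDerivAt (fun t : ℝ => z + t * Complex.I) Complex.I t := by
    simpa using (Complex.ofRealCLM.hasDerivAt.mul_const Complex.I).const_add z
  exact (h.differentiable _).hasFDerivAt.comp_hasDerivAt t h1

lemma IsTestFunction.hasDerivAt_horizontal (h : IsTestFunction ψ) (z : ℂ) (s : ℝ) :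
    HasDerivAt (fun s : ℝ => ψ (s + z)) (fderiv ℝ ψ (s + z) 1) s := by
  have h1 : HasDerivAt (fun s : ℝ => (s : ℂ) + z) 1 s := by
    simpa using Complex.ofRealCLM.hasDerivAt.add_const z
  exact (h.differentiable _).hasFDerivAt.comp_hasDerivAt s h1

lemma setLIntegral_Icc_le_lintegral_complex {F : ℂ → ℝ≥0∞} (hF : Measurable F) (r : ℝ) :
    ∫⁻ x : ℝ, ∫⁻ u in Set.Icc (-r) r, F (x + u * Complex.I) ≤ ∫⁻ z, F z := by
  rw [lintegral_complex hF, lintegral_lintegral_swap]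
  · exact setLIntegral_le_lintegral _ _
  · exact (hF.comp (by fun_prop)).aemeasurable

lemma IsTestFunction.measurable_enorm_fderiv (h : IsTestFunction ψ) (v : ℂ) :
    Measurable fun z => ‖fderiv ℝ ψ z v‖ₑ ^ 2 :=
  (h.fderiv_apply v).continuous.measurable.enorm.pow_const 2

/-- The trace inequality on the real line. -/
lemma IsTestFunction.lintegral_real_le (h : IsTestFunction ψ) :
    ∫⁻ x : ℝ, ‖ψ x‖ₑ ^ 2 ≤
      4 * ((∫⁻ z, ‖ψ z‖ₑ ^ 2) + ∫⁻ z, ‖fderiv ℝ ψ z Complex.I‖ₑ ^ 2) := by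
  have hm := h.measurable_enorm_fderiv Complex.I
  have hm0 : Measurable fun z => ‖ψ z‖ₑ ^ 2 := h.continuous.measurable.enorm.pow_const 2
  set E : ℝ → ℝ≥0∞ := fun x => ∫⁻ u in Set.Icc (-1 : ℝ) 1,
    ‖fderiv ℝ ψ (x + u * Complex.I) Complex.I‖ₑ ^ 2 with hE
  have hEm : Measurable E := by
    have : Measurable fun p : ℝ × ℝ => ‖fderiv ℝ ψ (p.1 + p.2 * Complex.I) Complex.I‖ₑ ^ 2 :=
      hm.comp (by fun_prop)
    exact this.lintegral_prod_right
  -- The value at $x$ is compared with the value at $x+it$; averaging over $t\in[-1,1]$ turns the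
  -- latter into an area integral.
  have h1 : ∀ x : ℝ, ∀ t ∈ Set.Icc (-1 : ℝ) 1,
      ‖ψ x‖ₑ ^ 2 ≤ 2 * ‖ψ (x + t * Complex.I)‖ₑ ^ 2 + 4 * E x := by
    intro x t ht
    have h2 := enorm_sub_sq_le_of_hasDerivAt (h.hasDerivAt_vertical (x : ℂ))
      ((h.fderiv_apply Complex.I).continuous.comp (by fun_prop)) ht
      (show (0 : ℝ) ∈ Set.Icc (-1 : ℝ) 1 by simp)
    simp only [Complex.ofReal_zero, zero_mul, add_zero, mul_one, ENNReal.ofReal_ofNat] at h2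
    calc ‖ψ x‖ₑ ^ 2 = ‖ψ (x + t * Complex.I) + (ψ x - ψ (x + t * Complex.I))‖ₑ ^ 2 := by
          rw [add_sub_cancel]
      _ ≤ 2 * ‖ψ (x + t * Complex.I)‖ₑ ^ 2 + 2 * ‖ψ x - ψ (x + t * Complex.I)‖ₑ ^ 2 :=
          enorm_add_sq_le
      _ ≤ 2 * ‖ψ (x + t * Complex.I)‖ₑ ^ 2 + 2 * (2 * E x) := by gcongr
      _ = _ := by ring
  have h3 : ∀ x : ℝ, ‖ψ x‖ₑ ^ 2 ≤
      (∫⁻ t in Set.Icc (-1 : ℝ) 1, ‖ψ (x + t * Complex.I)‖ₑ ^ 2) + 4 * E x := by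
    intro x
    have hmx : Measurable fun t : ℝ => ‖ψ (x + t * Complex.I)‖ₑ ^ 2 := hm0.comp (by fun_prop)
    have h4 : ∫⁻ t in Set.Icc (-1 : ℝ) 1, ‖ψ x‖ₑ ^ 2 ≤
        ∫⁻ t in Set.Icc (-1 : ℝ) 1, (2 * ‖ψ (x + t * Complex.I)‖ₑ ^ 2 + 4 * E x) :=
      setLIntegral_mono' measurableSet_Icc (h1 x)
    rw [lintegral_add_right _ measurable_const, lintegral_const_mul _ hmx, setLIntegral_const,
      setLIntegral_const, Real.volume_Icc] at h4
    have e : ENNReal.ofReal (1 - -1) = 2 := by norm_num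
    rw [e, mul_comm, mul_comm (4 * E x), ← mul_add] at h4
    exact (ENNReal.mul_le_mul_iff_right (by norm_num) (by norm_num)).1 h4
  calc ∫⁻ x : ℝ, ‖ψ x‖ₑ ^ 2 ≤ ∫⁻ x : ℝ,
        ((∫⁻ t in Set.Icc (-1 : ℝ) 1, ‖ψ (x + t * Complex.I)‖ₑ ^ 2) + 4 * E x) :=
        lintegral_mono h3
    _ = (∫⁻ x : ℝ, ∫⁻ t in Set.Icc (-1 : ℝ) 1, ‖ψ (x + t * Complex.I)‖ₑ ^ 2) +
        4 * ∫⁻ x, E x := by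
        rw [lintegral_add_right _ (hEm.const_mul _), lintegral_const_mul _ hEm]
    _ ≤ (∫⁻ z, ‖ψ z‖ₑ ^ 2) + 4 * ∫⁻ z, ‖fderiv ℝ ψ z Complex.I‖ₑ ^ 2 := by
        gcongr
        · exact setLIntegral_Icc_le_lintegral_complex hm0 1
        · exact setLIntegral_Icc_le_lintegral_complex hm 1
    _ ≤ _ := by
        rw [mul_add]
        gcongr
        exact le_mul_of_one_le_left zero_le (by norm_num)

lemma setLIntegral_ball_le {F : ℂ → ℝ≥0∞} (hF : Measurable F) (x r : ℝ) :
    ∫⁻ w in Metric.ball (x : ℂ) r, F w ≤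
      ∫⁻ t in Set.Icc (-r) r, ∫⁻ s in Set.Icc (-r) r, F (s + (x + t * Complex.I)) := by
  have hb : MeasurableSet (Metric.ball (x : ℂ) r) := Metric.isOpen_ball.measurableSet
  have hG : Measurable ((Metric.ball (x : ℂ) r).indicator F) := hF.indicator hb
  rw [← lintegral_indicator hb, ← lintegral_add_right_eq_self _ (x : ℂ),
    lintegral_complex (F := fun w => (Metric.ball (x : ℂ) r).indicator F (w + x))
      (hG.comp (measurable_add_const _)), ← lintegral_indicator measurableSet_Icc]
  refine lintegral_mono fun t => ?_
  have habs : ∀ s : ℝ, (s + t * Complex.I + x : ℂ) ∈ Metric.ball (x : ℂ) r →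
      s ∈ Set.Icc (-r) r ∧ t ∈ Set.Icc (-r) r := by
    intro s hs
    have hs' : ‖(s + t * Complex.I : ℂ)‖ < r := by simpa using hs
    have e1 := (Complex.abs_re_le_norm _).trans hs'.le
    have e2 := (Complex.abs_im_le_norm _).trans hs'.le
    simp only [Complex.add_re, Complex.ofReal_re, Complex.mul_re, Complex.I_re, mul_zero,
      Complex.ofReal_im, Complex.I_im, mul_one, sub_self, add_zero, Complex.add_im, Complex.mul_im,
      zero_add] at e1 e2
    exact ⟨abs_le.1 e1, abs_le.1 e2⟩
  by_cases ht : t ∈ Set.Icc (-r) r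
  · rw [Set.indicator_of_mem ht, ← lintegral_indicator measurableSet_Icc]
    refine lintegral_mono fun s => ?_
    by_cases hs : (s + t * Complex.I + x : ℂ) ∈ Metric.ball (x : ℂ) r
    · rw [Set.indicator_of_mem hs, Set.indicator_of_mem (habs s hs).1]
      refine le_of_eq ?_
      congr 1
      ring
    · rw [Set.indicator_of_notMem hs]; exact zero_le
  · rw [Set.indicator_of_notMem ht, le_zero_iff]
    refine lintegral_eq_zero_of_ae_eq_zero (Eventually.of_forall fun s => ?_)
    exact Set.indicator_of_notMem (fun hs => ht (habs s hs).2) _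

/-- The oscillation of a test function in discs centred on the real line. -/
lemma IsTestFunction.lintegral_ball_sub_le (h : IsTestFunction ψ) {r : ℝ} (hr : 0 < r) :
    ∫⁻ x : ℝ, ∫⁻ w in Metric.ball (x : ℂ) r, ‖ψ w - ψ x‖ₑ ^ 2 ≤
      ENNReal.ofReal (16 * r ^ 3) * ((∫⁻ z, ‖fderiv ℝ ψ z 1‖ₑ ^ 2) +
        ∫⁻ z, ‖fderiv ℝ ψ z Complex.I‖ₑ ^ 2) := by
  have hm1 := h.measurable_enorm_fderiv 1
  have hmI := h.measurable_enorm_fderiv Complex.I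
  have hψ := h.continuous.measurable
  set J := Set.Icc (-r) r with hJ
  have h0J : (0 : ℝ) ∈ J := by simp [hJ, hr.le]
  have hvol : volume J = ENNReal.ofReal (2 * r) := by rw [hJ, Real.volume_Icc]; ring_nf
  set V : ℝ → ℝ≥0∞ := fun x => ∫⁻ u in J, ‖fderiv ℝ ψ (x + u * Complex.I) Complex.I‖ₑ ^ 2 with hV
  set W : ℝ → ℝ → ℝ≥0∞ := fun x t => ∫⁻ u in J, ‖fderiv ℝ ψ (u + (x + t * Complex.I)) 1‖ₑ ^ 2
    with hW
  have hVm : Measurable V := by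
    have : Measurable fun p : ℝ × ℝ => ‖fderiv ℝ ψ (p.1 + p.2 * Complex.I) Complex.I‖ₑ ^ 2 :=
      hmI.comp (by fun_prop)
    exact this.lintegral_prod_right
  have hWm : Measurable (Function.uncurry W) := by
    have : Measurable fun p : (ℝ × ℝ) × ℝ =>
        ‖fderiv ℝ ψ (p.2 + (p.1.1 + p.1.2 * Complex.I)) 1‖ₑ ^ 2 := hm1.comp (by fun_prop)
    exact this.lintegral_prod_right
  -- The path goes vertically from $x$ to $x+it$ and then horizontally.
  have hpt : ∀ x : ℝ, ∀ t ∈ J, ∀ s ∈ J, ‖ψ (s + (x + t * Complex.I)) - ψ x‖ₑ ^ 2 ≤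
      ENNReal.ofReal (4 * r) * (W x t + V x) := by
    intro x t ht s hs
    have e1 := enorm_sub_sq_le_of_hasDerivAt (h.hasDerivAt_vertical (x : ℂ))
      ((h.fderiv_apply Complex.I).continuous.comp (by fun_prop)) h0J ht
    have e2 := enorm_sub_sq_le_of_hasDerivAt (h.hasDerivAt_horizontal (x + t * Complex.I : ℂ))
      ((h.fderiv_apply 1).continuous.comp (by fun_prop)) h0J hs
    simp only [Complex.ofReal_zero, zero_mul, add_zero, zero_add] at e1 e2
    calc _ = ‖(ψ (s + (x + t * Complex.I)) - ψ (x + t * Complex.I)) +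
          (ψ (x + t * Complex.I) - ψ x)‖ₑ ^ 2 := by rw [sub_add_sub_cancel]
      _ ≤ 2 * (ENNReal.ofReal (2 * r) * W x t) + 2 * (ENNReal.ofReal (2 * r) * V x) := by
          refine enorm_add_sq_le.trans ?_
          gcongr
      _ = _ := by
          have : ENNReal.ofReal (4 * r) = 2 * ENNReal.ofReal (2 * r) := by
            rw [← ENNReal.ofReal_ofNat, ← ENNReal.ofReal_mul (by norm_num)]
            congr 1
            ring
          rw [this]
          ring
  have hx : ∀ x : ℝ, ∫⁻ w in Metric.ball (x : ℂ) r, ‖ψ w - ψ x‖ₑ ^ 2 ≤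
      ENNReal.ofReal (8 * r ^ 2) * ((∫⁻ t in J, W x t) + ENNReal.ofReal (2 * r) * V x) := by
    intro x
    calc _ ≤ ∫⁻ t in J, ∫⁻ s in J, ‖ψ (s + (x + t * Complex.I)) - ψ x‖ₑ ^ 2 :=
          setLIntegral_ball_le (F := fun w => ‖ψ w - ψ x‖ₑ ^ 2)
            ((hψ.sub_const _).enorm.pow_const 2) x r
      _ ≤ ∫⁻ t in J, ∫⁻ s in J, ENNReal.ofReal (4 * r) * (W x t + V x) := by
          refine setLIntegral_mono' measurableSet_Icc fun t ht => ?_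
          exact setLIntegral_mono' measurableSet_Icc fun s hs => hpt x t ht s hs
      _ = ∫⁻ t in J, ENNReal.ofReal (8 * r ^ 2) * (W x t + V x) := by
          refine lintegral_congr fun t => ?_
          rw [setLIntegral_const, hvol, mul_right_comm, ← ENNReal.ofReal_mul (by positivity)]
          congr 2
          ring
      _ = _ := by
          rw [lintegral_const_mul' _ _ ENNReal.ofReal_ne_top, lintegral_add_right _ measurable_const,
            setLIntegral_const, hvol, mul_comm (V x)]
  have hWx : Measurable fun x => ∫⁻ t in J, W x t := hWm.lintegral_prod_right
  have hV' : ∫⁻ x, V x ≤ ∫⁻ z, ‖fderiv ℝ ψ z Complex.I‖ₑ ^ 2 :=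
    setLIntegral_Icc_le_lintegral_complex hmI r
  -- Integrating over $x$ before the horizontal shift $u$ removes the shift by translation
  -- invariance; the remaining $u$-integral gives the factor $2r$, to match the vertical term.
  have hW' : ∫⁻ x, ∫⁻ t in J, W x t ≤ ENNReal.ofReal (2 * r) * ∫⁻ z, ‖fderiv ℝ ψ z 1‖ₑ ^ 2 := by
    calc ∫⁻ x, ∫⁻ t in J, W x t = ∫⁻ t in J, ∫⁻ x, W x t :=
          lintegral_lintegral_swap hWm.aemeasurable
      _ = ∫⁻ t in J, ∫⁻ u in J, ∫⁻ x : ℝ, ‖fderiv ℝ ψ (x + t * Complex.I) 1‖ₑ ^ 2 := by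
          refine lintegral_congr fun t => ?_
          rw [hW]
          simp only
          rw [lintegral_lintegral_swap]
          · refine lintegral_congr fun u => ?_
            rw [← lintegral_add_left_eq_self
              (fun x : ℝ => ‖fderiv ℝ ψ (x + t * Complex.I) 1‖ₑ ^ 2) u]
            refine lintegral_congr fun x => ?_
            push_cast
            rw [add_assoc]
          · exact (hm1.comp (by fun_prop)).aemeasurable
      _ = ENNReal.ofReal (2 * r) * ∫⁻ t in J, ∫⁻ x : ℝ, ‖fderiv ℝ ψ (x + t * Complex.I) 1‖ₑ ^ 2 := by
          rw [← lintegral_const_mul' _ _ ENNReal.ofReal_ne_top]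
          refine lintegral_congr fun t => ?_
          rw [setLIntegral_const, hvol, mul_comm]
      _ ≤ _ := by
          rw [lintegral_complex hm1]
          exact mul_le_mul' le_rfl (setLIntegral_le_lintegral _ _)
  calc _ ≤ ∫⁻ x : ℝ, ENNReal.ofReal (8 * r ^ 2) *
        ((∫⁻ t in J, W x t) + ENNReal.ofReal (2 * r) * V x) := lintegral_mono hx
    _ = ENNReal.ofReal (8 * r ^ 2) *
        ((∫⁻ x, ∫⁻ t in J, W x t) + ENNReal.ofReal (2 * r) * ∫⁻ x, V x) := by
        rw [lintegral_const_mul' _ _ ENNReal.ofReal_ne_top, lintegral_add_left hWx,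
          lintegral_const_mul _ hVm]
    _ ≤ ENNReal.ofReal (8 * r ^ 2) *
        (ENNReal.ofReal (2 * r) * (∫⁻ z, ‖fderiv ℝ ψ z 1‖ₑ ^ 2) +
          ENNReal.ofReal (2 * r) * ∫⁻ z, ‖fderiv ℝ ψ z Complex.I‖ₑ ^ 2) := by gcongr
    _ = _ := by
        rw [← mul_add, ← mul_assoc, ← ENNReal.ofReal_mul (by positivity)]
        congr 2
        ring

end TraceInequalities

/-! ### Lebesgue values of $W^{1,2}$ functions on the real line -/

section LebesgueTrace

/-- By Tonelli: a given $w$ lies in $B(x,r)$ only if $|x-\operatorname{Re}w|<r$, an interval of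
length $2r$. -/
lemma lintegral_setLIntegral_ball_le {g : ℂ → ℝ≥0∞} (hg : Measurable g) (r : ℝ) :
    ∫⁻ x : ℝ, ∫⁻ w in Metric.ball (x : ℂ) r, g w ≤ ENNReal.ofReal (2 * r) * ∫⁻ w, g w := by
  have hS : MeasurableSet {p : ℝ × ℂ | dist p.2 (p.1 : ℂ) < r} :=
    measurableSet_lt (by fun_prop) measurable_const
  have hm : Measurable ({p : ℝ × ℂ | dist p.2 (p.1 : ℂ) < r}.indicator fun p => g p.2) :=
    (hg.comp measurable_snd).indicator hS
  calc ∫⁻ x : ℝ, ∫⁻ w in Metric.ball (x : ℂ) r, g w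
      = ∫⁻ x : ℝ, ∫⁻ w, {p : ℝ × ℂ | dist p.2 (p.1 : ℂ) < r}.indicator (fun p => g p.2) (x, w) := by
        refine lintegral_congr fun x => ?_
        rw [← lintegral_indicator Metric.isOpen_ball.measurableSet]
        rfl
    _ = ∫⁻ w, ∫⁻ x : ℝ, {p : ℝ × ℂ | dist p.2 (p.1 : ℂ) < r}.indicator (fun p => g p.2) (x, w) :=
        lintegral_lintegral_swap hm.aemeasurable
    _ ≤ ∫⁻ w, ENNReal.ofReal (2 * r) * g w := by
        refine lintegral_mono fun w => ?_
        calc _ ≤ ∫⁻ x : ℝ, (Metric.ball w.re r).indicator (fun _ => g w) x := by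
              refine lintegral_mono fun x => ?_
              by_cases h : dist w (x : ℂ) < r
              · rw [Set.indicator_of_mem (show (x, w) ∈ {p : ℝ × ℂ | dist p.2 (p.1 : ℂ) < r} from h),
                  Set.indicator_of_mem]
                rw [Metric.mem_ball, Real.dist_eq, abs_sub_comm]
                refine lt_of_le_of_lt ?_ h
                rw [dist_eq_norm]
                simpa using Complex.abs_re_le_norm (w - x)
              · rw [Set.indicator_of_notMem
                  (show (x, w) ∉ {p : ℝ × ℂ | dist p.2 (p.1 : ℂ) < r} from h)]
                exact zero_le
          _ = _ := by
              rw [lintegral_indicator Metric.isOpen_ball.measurableSet, setLIntegral_const,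
                Real.volume_ball, mul_comm]
    _ = _ := lintegral_const_mul _ hg

variable {φ : ℂ → ℂ} {v : ℝ → ℂ}

/-- The oscillation estimate passes to the limit: replacing $\varphi$ by $\psi_n$ and $v$ by
$\psi_n|_{\mathbb R}$ costs errors that vanish for fixed $r$, and splitting the square doubles $16$
to $32$. -/
lemma lintegral_ball_sub_le_of_tendsto (hφ : Measurable φ) (hv : Measurable v) {ψ : ℕ → ℂ → ℂ}
    (hψ : ∀ n, IsTestFunction (ψ n)) {E : ℝ≥0∞}
    (hE : ∀ n, (∫⁻ z, ‖fderiv ℝ (ψ n) z 1‖ₑ ^ 2) + ∫⁻ z, ‖fderiv ℝ (ψ n) z Complex.I‖ₑ ^ 2 ≤ E)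
    (h1 : Tendsto (fun n => ∫⁻ z, ‖ψ n z - φ z‖ₑ ^ 2) atTop (𝓝 0))
    (h2 : Tendsto (fun n => ∫⁻ x : ℝ, ‖ψ n x - v x‖ₑ ^ 2) atTop (𝓝 0)) {r : ℝ} (hr : 0 < r) :
    ∫⁻ x : ℝ, ∫⁻ w in Metric.ball (x : ℂ) r, ‖φ w - v x‖ₑ ^ 2 ≤
      ENNReal.ofReal (32 * r ^ 3) * E := by
  set c : ℝ≥0∞ := volume (Metric.ball (0 : ℂ) r) with hc
  have hcx : ∀ x : ℝ, volume (Metric.ball (x : ℂ) r) = c := fun x => by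
    rw [hc, Complex.volume_ball, Complex.volume_ball]
  have hcfin : c ≠ ⊤ := measure_ball_lt_top.ne
  have key : ∀ n, ∫⁻ x : ℝ, ∫⁻ w in Metric.ball (x : ℂ) r, ‖φ w - v x‖ₑ ^ 2 ≤
      ENNReal.ofReal (32 * r ^ 3) * E + (4 * (ENNReal.ofReal (2 * r) *
        ∫⁻ z, ‖ψ n z - φ z‖ₑ ^ 2) + 4 * (c * ∫⁻ x : ℝ, ‖ψ n x - v x‖ₑ ^ 2)) := by
    intro n
    have hm := (hψ n).continuous.measurable
    have hm1 : Measurable fun w => ‖ψ n w - φ w‖ₑ ^ 2 := (hm.sub hφ).enorm.pow_const 2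
    have hm2 : Measurable fun x : ℝ => ‖ψ n x - v x‖ₑ ^ 2 :=
      ((hm.comp Complex.measurable_ofReal).sub hv).enorm.pow_const 2
    have hm3 : ∀ x : ℝ, Measurable fun w => ‖ψ n w - ψ n x‖ₑ ^ 2 := fun x =>
      (hm.sub_const _).enorm.pow_const 2
    have hball : ∀ {g : ℝ → ℂ → ℝ≥0∞}, Measurable (Function.uncurry g) →
        Measurable fun x : ℝ => ∫⁻ w in Metric.ball (x : ℂ) r, g x w := by
      intro g hg
      have hS : MeasurableSet {p : ℝ × ℂ | dist p.2 (p.1 : ℂ) < r} :=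
        measurableSet_lt (by fun_prop) measurable_const
      have := (hg.indicator hS).lintegral_prod_right' (ν := (volume : Measure ℂ))
      convert this using 1
      funext x
      rw [← lintegral_indicator Metric.isOpen_ball.measurableSet]
      rfl
    have hA : Measurable fun x : ℝ => ∫⁻ w in Metric.ball (x : ℂ) r, ‖ψ n w - ψ n x‖ₑ ^ 2 := by
      refine hball (g := fun x w => ‖ψ n w - ψ n x‖ₑ ^ 2) ?_
      exact ((hm.comp measurable_snd).sub
        (hm.comp (Complex.measurable_ofReal.comp measurable_fst))).enorm.pow_const 2
    have hB : Measurable fun x : ℝ => ∫⁻ w in Metric.ball (x : ℂ) r, ‖ψ n w - φ w‖ₑ ^ 2 :=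
      hball (g := fun _ w => ‖ψ n w - φ w‖ₑ ^ 2) (hm1.comp measurable_snd)
    have hpt : ∀ (x : ℝ) (w : ℂ), ‖φ w - v x‖ₑ ^ 2 ≤
        2 * ‖ψ n w - ψ n x‖ₑ ^ 2 + (4 * ‖ψ n w - φ w‖ₑ ^ 2 + 4 * ‖ψ n x - v x‖ₑ ^ 2) := by
      intro x w
      calc ‖φ w - v x‖ₑ ^ 2
          = ‖(ψ n w - ψ n x) + ((φ w - ψ n w) + (ψ n x - v x))‖ₑ ^ 2 := by congr 2; ring
        _ ≤ 2 * ‖ψ n w - ψ n x‖ₑ ^ 2 + 2 * ‖(φ w - ψ n w) + (ψ n x - v x)‖ₑ ^ 2 := enorm_add_sq_le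
        _ ≤ 2 * ‖ψ n w - ψ n x‖ₑ ^ 2 +
            2 * (2 * ‖φ w - ψ n w‖ₑ ^ 2 + 2 * ‖ψ n x - v x‖ₑ ^ 2) := by
            gcongr
            exact enorm_add_sq_le
        _ = _ := by
            rw [← enorm_neg (φ w - ψ n w), neg_sub]
            ring
    calc ∫⁻ x : ℝ, ∫⁻ w in Metric.ball (x : ℂ) r, ‖φ w - v x‖ₑ ^ 2
        ≤ ∫⁻ x : ℝ, ∫⁻ w in Metric.ball (x : ℂ) r, (2 * ‖ψ n w - ψ n x‖ₑ ^ 2 +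
            (4 * ‖ψ n w - φ w‖ₑ ^ 2 + 4 * ‖ψ n x - v x‖ₑ ^ 2)) :=
          lintegral_mono fun x => lintegral_mono fun w => hpt x w
      _ = ∫⁻ x : ℝ, (2 * (∫⁻ w in Metric.ball (x : ℂ) r, ‖ψ n w - ψ n x‖ₑ ^ 2) +
            (4 * (∫⁻ w in Metric.ball (x : ℂ) r, ‖ψ n w - φ w‖ₑ ^ 2) +
              4 * (c * ‖ψ n x - v x‖ₑ ^ 2))) := by
          refine lintegral_congr fun x => ?_
          rw [lintegral_add_left ((hm3 x).const_mul _), lintegral_add_right _ measurable_const,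
            lintegral_const_mul _ (hm3 x), lintegral_const_mul _ hm1, setLIntegral_const, hcx,
            mul_assoc, mul_comm c]
      _ = 2 * (∫⁻ x : ℝ, ∫⁻ w in Metric.ball (x : ℂ) r, ‖ψ n w - ψ n x‖ₑ ^ 2) +
            (4 * (∫⁻ x : ℝ, ∫⁻ w in Metric.ball (x : ℂ) r, ‖ψ n w - φ w‖ₑ ^ 2) +
              4 * (c * ∫⁻ x : ℝ, ‖ψ n x - v x‖ₑ ^ 2)) := by
          rw [lintegral_add_left (hA.const_mul _), lintegral_const_mul _ hA,
            lintegral_add_left (hB.const_mul _), lintegral_const_mul _ hB,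
            lintegral_const_mul _ (hm2.const_mul _), lintegral_const_mul _ hm2]
      _ ≤ 2 * (ENNReal.ofReal (16 * r ^ 3) * E) +
            (4 * (ENNReal.ofReal (2 * r) * ∫⁻ z, ‖ψ n z - φ z‖ₑ ^ 2) +
              4 * (c * ∫⁻ x : ℝ, ‖ψ n x - v x‖ₑ ^ 2)) := by
          gcongr
          · exact ((hψ n).lintegral_ball_sub_le hr).trans (mul_le_mul' le_rfl (hE n))
          · exact lintegral_setLIntegral_ball_le hm1 r
      _ = _ := by
          congr 1
          rw [← mul_assoc, ← ENNReal.ofReal_ofNat, ← ENNReal.ofReal_mul (by norm_num)]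
          congr 2
          ring
  refine ge_of_tendsto' (x := atTop) ?_ key
  have t1 := ENNReal.Tendsto.const_mul h1 (Or.inr (ENNReal.ofReal_ne_top (r := 2 * r)))
  have t2 := ENNReal.Tendsto.const_mul t1 (Or.inr (show (4 : ℝ≥0∞) ≠ ⊤ by norm_num))
  have t3 := ENNReal.Tendsto.const_mul h2 (Or.inr hcfin)
  have t4 := ENNReal.Tendsto.const_mul t3 (Or.inr (show (4 : ℝ≥0∞) ≠ ⊤ by norm_num))
  have := (tendsto_const_nhds (x := ENNReal.ofReal (32 * r ^ 3) * E)).add (t2.add t4)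
  simpa using this

lemma sq_average_norm_le (hφ : AEStronglyMeasurable φ) (x : ℂ) (a : ℂ) {r : ℝ} (hr : 0 < r) :
    ENNReal.ofReal ((⨍ w in Metric.ball x r, ‖φ w - a‖) ^ 2) ≤
      (ENNReal.ofReal (r ^ 2))⁻¹ * ∫⁻ w in Metric.ball x r, ‖φ w - a‖ₑ ^ 2 := by
  set V : ℝ≥0∞ := volume (Metric.ball x r) with hV
  have hV0 : V ≠ 0 := (Metric.measure_ball_pos volume _ hr).ne'
  have hVt : V ≠ ⊤ := measure_ball_lt_top.ne
  have hVr : ENNReal.ofReal (r ^ 2) ≤ V := by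
    rw [hV, Complex.volume_ball, ENNReal.ofReal_pow hr.le]
    refine le_mul_of_one_le_right zero_le ?_
    exact_mod_cast (show (1 : ℝ) ≤ Real.pi by linarith [Real.pi_gt_three])
  have h0 : 0 ≤ ⨍ w in Metric.ball x r, ‖φ w - a‖ := by
    rw [setAverage_eq]
    exact smul_nonneg (by positivity) (integral_nonneg fun _ => norm_nonneg _)
  rw [ENNReal.ofReal_pow h0]
  have h1 : ENNReal.ofReal (⨍ w in Metric.ball x r, ‖φ w - a‖) ≤
      V⁻¹ * ∫⁻ w in Metric.ball x r, ‖φ w - a‖ₑ := by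
    rw [setAverage_eq, smul_eq_mul, ENNReal.ofReal_mul (by positivity)]
    refine mul_le_mul' (le_of_eq ?_) ?_
    · rw [ENNReal.ofReal_inv_of_pos (by
        rw [Measure.real]; exact ENNReal.toReal_pos hV0 hVt), Measure.real,
        ENNReal.ofReal_toReal hVt]
    · have := enorm_integral_le_lintegral_enorm (μ := volume.restrict (Metric.ball x r))
        (fun w => ‖φ w - a‖)
      rw [Real.enorm_of_nonneg (integral_nonneg fun _ => norm_nonneg _)] at this
      simpa using this
  have hma : AEStronglyMeasurable (fun w => φ w - a) (volume.restrict (Metric.ball x r)) :=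
    (hφ.sub aestronglyMeasurable_const).restrict
  have h2 : (∫⁻ w in Metric.ball x r, ‖φ w - a‖ₑ) ^ 2 ≤
      (∫⁻ w in Metric.ball x r, ‖φ w - a‖ₑ ^ 2) * V := by
    rw [lintegral_enorm_sq_eq, ← eLpNorm_one_eq_lintegral_enorm]
    have := eLpNorm_le_eLpNorm_mul_rpow_measure_univ (p := 1) (q := 2) (by norm_num) hma
    rw [Measure.restrict_apply_univ] at this
    calc _ ≤ (eLpNorm (fun w => φ w - a) 2 (volume.restrict (Metric.ball x r)) *
          V ^ (1 / (1 : ℝ≥0∞).toReal - 1 / (2 : ℝ≥0∞).toReal)) ^ 2 := by gcongr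
      _ = _ := by
          rw [mul_pow]
          congr 1
          have e : (1 / (1 : ℝ≥0∞).toReal - 1 / (2 : ℝ≥0∞).toReal) = 1 / 2 := by norm_num
          rw [e, ← ENNReal.rpow_natCast, ← ENNReal.rpow_mul]
          norm_num
  calc ENNReal.ofReal (⨍ w in Metric.ball x r, ‖φ w - a‖) ^ 2
      ≤ (V⁻¹ * ∫⁻ w in Metric.ball x r, ‖φ w - a‖ₑ) ^ 2 := by gcongr
    _ ≤ V⁻¹ ^ 2 * ((∫⁻ w in Metric.ball x r, ‖φ w - a‖ₑ ^ 2) * V) := by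
        rw [mul_pow]
        gcongr
    _ = V⁻¹ * ∫⁻ w in Metric.ball x r, ‖φ w - a‖ₑ ^ 2 := by
        rw [sq, mul_comm _ V, ← mul_assoc, mul_assoc V⁻¹, ENNReal.inv_mul_cancel hV0 hVt, mul_one]
    _ ≤ _ := by gcongr

/-- Divided by $r^2$, the mean square oscillation has integral at most $rE$ over $\mathbb R$. This
is summable over $r=2^{-k}$, so for a.e. $x$ it tends to $0$ along dyadic radii; another radius is
compared with the next larger dyadic one at the cost of a factor $4$. -/
lemma isTraceOnReal_of_lintegral_le (hφ : Measurable φ) (hv : Measurable v) {E : ℝ≥0∞}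
    (hE : E ≠ ⊤)
    (h : ∀ r : ℝ, 0 < r → ∫⁻ x : ℝ, ∫⁻ w in Metric.ball (x : ℂ) r, ‖φ w - v x‖ₑ ^ 2 ≤
      ENNReal.ofReal (r ^ 3) * E) : IsTraceOnReal φ v := by
  set R : ℕ → ℝ := fun k => (1 / 2) ^ k with hR
  have hR0 : ∀ k, 0 < R k := fun k => by positivity
  set D : ℕ → ℝ → ℝ≥0∞ := fun k x =>
    (ENNReal.ofReal (R k ^ 2))⁻¹ * ∫⁻ w in Metric.ball (x : ℂ) (R k), ‖φ w - v x‖ₑ ^ 2 with hD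
  have hDm : ∀ k, Measurable (D k) := by
    intro k
    refine Measurable.const_mul ?_ _
    have hS : MeasurableSet {p : ℝ × ℂ | dist p.2 (p.1 : ℂ) < R k} :=
      measurableSet_lt (by fun_prop) measurable_const
    have hg : Measurable fun p : ℝ × ℂ => ‖φ p.2 - v p.1‖ₑ ^ 2 :=
      ((hφ.comp measurable_snd).sub (hv.comp measurable_fst)).enorm.pow_const 2
    have := (hg.indicator hS).lintegral_prod_right' (ν := (volume : Measure ℂ))
    convert this using 1
    funext x
    rw [← lintegral_indicator Metric.isOpen_ball.measurableSet]
    rfl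
  have hDi : ∀ k, ∫⁻ x, D k x ≤ E * 2⁻¹ ^ k := by
    intro k
    have hne : ENNReal.ofReal (R k ^ 2) ≠ 0 := by
      have := hR0 k
      rw [ne_eq, ENNReal.ofReal_eq_zero, not_le]
      positivity
    rw [lintegral_const_mul' _ _ (ENNReal.inv_ne_top.2 hne)]
    calc _ ≤ (ENNReal.ofReal (R k ^ 2))⁻¹ * (ENNReal.ofReal (R k ^ 3) * E) := by
          gcongr
          exact h _ (hR0 k)
      _ = ENNReal.ofReal (R k) * E := by
          rw [pow_succ (R k) 2, ENNReal.ofReal_mul (by positivity), mul_assoc, ← mul_assoc,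
            ENNReal.inv_mul_cancel hne ENNReal.ofReal_ne_top, one_mul]
      _ = _ := by
          rw [hR]
          simp only
          rw [ENNReal.ofReal_pow (by norm_num), mul_comm, one_div,
            ENNReal.ofReal_inv_of_pos two_pos, ENNReal.ofReal_ofNat]
  have hsum : ∫⁻ x, ∑' k, D k x ≠ ⊤ := by
    rw [lintegral_tsum fun k => (hDm k).aemeasurable]
    have : ∑' k, ∫⁻ x, D k x ≤ E * 2 := by
      refine (ENNReal.tsum_le_tsum hDi).trans_eq ?_
      rw [ENNReal.tsum_mul_left, ENNReal.tsum_geometric_two]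
    exact (this.trans_lt (ENNReal.mul_lt_top hE.lt_top (by norm_num))).ne
  have hae := ae_lt_top' (Measurable.tsum hDm).aemeasurable hsum
  filter_upwards [hae] with x hx
  have hlim : Tendsto (fun k => D k x) atTop (𝓝 0) := ENNReal.tendsto_atTop_zero_of_tsum_ne_top hx.ne
  rw [Metric.tendsto_nhds]
  intro δ hδ
  have hδ' : 0 < ENNReal.ofReal (δ ^ 2 / 4) := by
    rw [ENNReal.ofReal_pos]; positivity
  obtain ⟨N, hN⟩ := eventually_atTop.1 (hlim.eventually_lt_const hδ')
  filter_upwards [Ioo_mem_nhdsGT (hR0 N)] with r hr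
  have hr0 : 0 < r := hr.1
  have hr1 : r ≤ 1 := by
    refine hr.2.le.trans ?_
    exact pow_le_one₀ (by norm_num) (by norm_num)
  obtain ⟨k, hk1, hk2⟩ := exists_nat_pow_near_of_lt_one hr0 hr1 (show (0 : ℝ) < 1 / 2 by norm_num)
    (by norm_num)
  have hkN : N ≤ k := by
    by_contra hc
    have hc' : k + 1 ≤ N := by omega
    have : R N ≤ R (k + 1) := pow_le_pow_of_le_one (by norm_num) (by norm_num) hc'
    have h3 := hr.2
    linarith
  have h4 := hN k hkN
  have h5 := sq_average_norm_le hφ.aestronglyMeasurable (x : ℂ) (v x) hr0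
  have h6 : (ENNReal.ofReal (r ^ 2))⁻¹ * ∫⁻ w in Metric.ball (x : ℂ) r, ‖φ w - v x‖ₑ ^ 2 ≤
      4 * D k x := by
    rw [hD]
    simp only
    rw [← mul_assoc]
    have hRk := hR0 k
    have e1 : (ENNReal.ofReal (r ^ 2))⁻¹ ≤ 4 * (ENNReal.ofReal (R k ^ 2))⁻¹ := by
      rw [← ENNReal.ofReal_inv_of_pos (by positivity), ← ENNReal.ofReal_inv_of_pos (by positivity),
        ← ENNReal.ofReal_ofNat, ← ENNReal.ofReal_mul (by norm_num)]
      refine ENNReal.ofReal_le_ofReal ?_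
      have h7 : R k ≤ 2 * r := by
        have : R (k + 1) = R k * (1 / 2) := pow_succ _ _
        change R (k + 1) < r at hk1
        linarith
      rw [← div_eq_mul_inv, inv_eq_one_div, div_le_div_iff₀ (by positivity) (by positivity)]
      nlinarith
    refine mul_le_mul' e1 (lintegral_mono_set (Metric.ball_subset_ball hk2))
  have h0 : 0 ≤ ⨍ w in Metric.ball (x : ℂ) r, ‖φ w - v x‖ := by
    rw [setAverage_eq]
    exact smul_nonneg (by positivity) (integral_nonneg fun _ => norm_nonneg _)
  rw [Real.dist_eq, sub_zero, abs_of_nonneg h0]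
  have h8 : ENNReal.ofReal ((⨍ w in Metric.ball (x : ℂ) r, ‖φ w - v x‖) ^ 2) <
      ENNReal.ofReal (δ ^ 2) := by
    calc _ ≤ 4 * D k x := h5.trans h6
      _ < 4 * ENNReal.ofReal (δ ^ 2 / 4) :=
          (ENNReal.mul_lt_mul_iff_right (by norm_num) (by norm_num)).2 h4
      _ = _ := by
          rw [← ENNReal.ofReal_ofNat, ← ENNReal.ofReal_mul (by norm_num)]
          congr 1
          ring
  rw [ENNReal.ofReal_lt_ofReal_iff (by positivity)] at h8
  exact lt_of_pow_lt_pow_left₀ 2 hδ.le h8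

lemma IsTraceOnReal.congr {φ' : ℂ → ℂ} (h : IsTraceOnReal φ v) (hφ : φ =ᵐ[volume] φ') :
    IsTraceOnReal φ' v := by
  filter_upwards [h] with x hx
  refine hx.congr fun r => ?_
  rw [setAverage_eq, setAverage_eq]
  congr 1
  refine integral_congr_ae (ae_restrict_of_ae ?_)
  filter_upwards [hφ] with w hw
  rw [hw]

lemma IsTestFunction.memLp_ofReal {ψ : ℂ → ℂ} (h : IsTestFunction ψ) :
    MemLp (fun x : ℝ => ψ x) 2 := by
  refine memLp_two_of_lintegral_lt_top
    (h.continuous.comp Complex.continuous_ofReal).aestronglyMeasurable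
    (h.lintegral_real_le.trans_lt ?_)
  rw [lintegral_enorm_sq_eq, lintegral_enorm_sq_eq]
  exact ENNReal.mul_lt_top (by norm_num) (ENNReal.add_lt_top.2
    ⟨ENNReal.pow_lt_top (h.memLp 2).2, ENNReal.pow_lt_top ((h.fderiv_apply _).memLp 2).2⟩)

lemma fderiv_one_eq (ψ : ℂ → ℂ) (z : ℂ) : fderiv ℝ ψ z 1 = wirtinger ψ z + wirtingerBar ψ z := by
  unfold wirtinger wirtingerBar
  ring

lemma fderiv_I_eq (ψ : ℂ → ℂ) (z : ℂ) :
    fderiv ℝ ψ z Complex.I = Complex.I * (wirtinger ψ z - wirtingerBar ψ z) := by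
  unfold wirtinger wirtingerBar
  linear_combination (fderiv ℝ ψ z Complex.I) * Complex.I_sq

/-- A compactly supported `W^{1,2}` function has a trace in `L²(ℝ)`, which is the limit of the
restrictions of its mollifications. -/
lemma exists_isTraceOnReal {P Q : ℂ → ℂ} (hφ : MemLp φ 2) (hP : MemLp P 2) (hQ : MemLp Q 2) {R : ℝ}
    (hR : ∀ z, R < ‖z‖ → φ z = 0)
    (hPw : ∀ χ, IsTestFunction χ → ∫ z, φ z * wirtinger χ z = -∫ z, P z * χ z)
    (hQw : ∀ χ, IsTestFunction χ → ∫ z, φ z * wirtingerBar χ z = -∫ z, Q z * χ z) :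
    ∃ v : ℝ → ℂ, MemLp v 2 ∧ IsTraceOnReal φ v ∧
      Tendsto (fun n => eLpNorm (fun x : ℝ => mollify n φ x - v x) 2 volume) atTop (𝓝 0) := by
  have hL := locallyIntegrable_of_memLp_two hφ
  have hψ : ∀ n, IsTestFunction (mollify n φ) := fun n => isTestFunction_mollify n hL hR
  have hw : ∀ n, wirtinger (mollify n φ) = mollify n P := fun n =>
    funext (wirtinger_mollify n hL hPw)
  have hwb : ∀ n, wirtingerBar (mollify n φ) = mollify n Q := fun n =>
    funext (wirtingerBar_mollify n hL hQw)
  set s : ℕ → ℝ≥0∞ := fun n => eLpNorm (fun z => mollify n φ z - φ z) 2 volume +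
    (eLpNorm (fun z => mollify n P z - P z) 2 volume +
      eLpNorm (fun z => mollify n Q z - Q z) 2 volume) with hs
  have hs0 : Tendsto s atTop (𝓝 0) := by
    simpa using (tendsto_eLpNorm_mollify_sub hφ).add
      ((tendsto_eLpNorm_mollify_sub hP).add (tendsto_eLpNorm_mollify_sub hQ))
  have hm : ∀ {u : ℂ → ℂ}, MemLp u 2 → ∀ n, AEStronglyMeasurable (fun z => mollify n u z - u z)
      volume := fun {u} hu n =>
    (aestronglyMeasurable_mollify n (locallyIntegrable_of_memLp_two hu)).sub hu.1
  have htri : ∀ {u : ℂ → ℂ}, MemLp u 2 → ∀ n m,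
      eLpNorm (fun z => mollify n u z - mollify m u z) 2 volume ≤
      eLpNorm (fun z => mollify n u z - u z) 2 volume +
        eLpNorm (fun z => mollify m u z - u z) 2 volume := by
    intro u hu n m
    have := eLpNorm_sub_le (hm hu n) (hm hu m) (p := 2) (by norm_num)
    refine le_trans (le_of_eq ?_) this
    congr 1
    funext z
    simp
  -- The trace inequality is applied to the difference of two mollifications, whose derivatives are
  -- mollifications of $P$ and $Q$. Hence the restrictions to $\mathbb R$ form a Cauchy sequence in
  -- $L^2(\mathbb R)$.
  have hcau : ∀ n m, eLpNorm (fun x : ℝ => mollify n φ x - mollify m φ x) 2 volume ≤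
      2 * (s n + s m) := by
    intro n m
    have h1 := ((hψ n).sub (hψ m)).lintegral_real_le
    rw [lintegral_enorm_sq_eq, lintegral_enorm_sq_eq, lintegral_enorm_sq_eq] at h1
    have h2 : eLpNorm (fun z => fderiv ℝ (fun z => mollify n φ z - mollify m φ z) z Complex.I) 2
        volume ≤ eLpNorm (fun z => mollify n P z - mollify m P z) 2 volume +
          eLpNorm (fun z => mollify n Q z - mollify m Q z) 2 volume := by
      have e : ∀ z, fderiv ℝ (fun z => mollify n φ z - mollify m φ z) z Complex.I =
          Complex.I * ((mollify n P z - mollify m P z) - (mollify n Q z - mollify m Q z)) := by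
        intro z
        rw [fderiv_fun_sub ((hψ n).differentiable z) ((hψ m).differentiable z), sub_apply,
          fderiv_I_eq, fderiv_I_eq, hw, hw, hwb, hwb]
        ring
      simp_rw [e]
      refine le_trans (le_of_eq ?_) (eLpNorm_sub_le (p := 2) ?_ ?_ (by norm_num))
      · refine eLpNorm_congr_norm_ae (ae_of_all _ fun z => ?_)
        simp
      · exact (aestronglyMeasurable_mollify n (locallyIntegrable_of_memLp_two hP)).sub
          (aestronglyMeasurable_mollify m (locallyIntegrable_of_memLp_two hP))
      · exact (aestronglyMeasurable_mollify n (locallyIntegrable_of_memLp_two hQ)).sub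
          (aestronglyMeasurable_mollify m (locallyIntegrable_of_memLp_two hQ))
    have h3 : eLpNorm (fun x : ℝ => mollify n φ x - mollify m φ x) 2 volume ^ 2 ≤
        (2 * (s n + s m)) ^ 2 := by
      refine h1.trans ?_
      have h4 := htri hφ n m
      have h5 := h2.trans (add_le_add (htri hP n m) (htri hQ n m))
      have h6 : ∀ a b : ℝ≥0∞, 4 * (a ^ 2 + b ^ 2) ≤ (2 * (a + b)) ^ 2 := by
        intro a b
        have : (2 * (a + b)) ^ 2 = 4 * (a ^ 2 + b ^ 2) + 8 * (a * b) := by ring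
        rw [this]
        exact le_self_add
      refine (h6 _ _).trans ?_
      refine pow_le_pow_left' (mul_le_mul' le_rfl ((add_le_add h4 h5).trans_eq ?_)) 2
      rw [hs]
      ring
    exact (ENNReal.pow_le_pow_left_iff two_ne_zero).1 h3
  have hC : CauchySeq fun n => (hψ n).memLp_ofReal.toLp := by
    rw [EMetric.cauchySeq_iff]
    intro ε hε
    have h1 : Tendsto (fun n => 4 * s n) atTop (𝓝 0) := by
      simpa using ENNReal.Tendsto.const_mul hs0 (Or.inr (show (4 : ℝ≥0∞) ≠ ⊤ by norm_num))
    obtain ⟨N, hN⟩ := eventually_atTop.1 (h1.eventually_lt_const hε)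
    refine ⟨N, fun m hmN n hnN => ?_⟩
    rw [Lp.edist_toLp_toLp]
    refine (hcau m n).trans_lt ?_
    rcases le_total (s m) (s n) with h | h
    · refine lt_of_le_of_lt ?_ (hN n hnN)
      calc 2 * (s m + s n) ≤ 2 * (s n + s n) := by gcongr
        _ = 4 * s n := by ring
    · refine lt_of_le_of_lt ?_ (hN m hmN)
      calc 2 * (s m + s n) ≤ 2 * (s m + s m) := by gcongr
        _ = 4 * s m := by ring
  obtain ⟨V, hV⟩ := cauchySeq_tendsto_of_complete hC
  have hlim : Tendsto (fun n => eLpNorm (fun x : ℝ => mollify n φ x - V x) 2 volume) atTop (𝓝 0) := by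
    have := (Lp.tendsto_Lp_iff_tendsto_eLpNorm' (fun n => (hψ n).memLp_ofReal.toLp) V).1 hV
    refine this.congr fun n => eLpNorm_congr_ae ?_
    filter_upwards [(hψ n).memLp_ofReal.coeFn_toLp] with x hx
    simp [hx]
  refine ⟨V, Lp.memLp V, ?_, hlim⟩
  have hmk := hφ.1.ae_eq_mk
  refine IsTraceOnReal.congr ?_ hmk.symm
  set E : ℝ≥0 := (8 * (eLpNorm P 2 volume ^ 2 + eLpNorm Q 2 volume ^ 2)).toNNReal with hE
  have hEtop : 8 * (eLpNorm P 2 volume ^ 2 + eLpNorm Q 2 volume ^ 2) ≠ ⊤ :=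
    ENNReal.mul_ne_top (by norm_num) (ENNReal.add_ne_top.2
      ⟨(ENNReal.pow_lt_top hP.2).ne, (ENNReal.pow_lt_top hQ.2).ne⟩)
  have hEE : (E : ℝ≥0∞) = 8 * (eLpNorm P 2 volume ^ 2 + eLpNorm Q 2 volume ^ 2) :=
    ENNReal.coe_toNNReal hEtop
  refine isTraceOnReal_of_lintegral_le (E := 32 * E) hφ.1.measurable_mk (Lp.stronglyMeasurable V).measurable
    (ENNReal.mul_ne_top (by norm_num) ENNReal.coe_ne_top) fun r hr => ?_
  have hb : ∀ (n : ℕ) {u : ℂ → ℂ}, MemLp u 2 → ∫⁻ z, ‖mollify n u z‖ₑ ^ 2 ≤ eLpNorm u 2 volume ^ 2 := by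
    intro n u hu
    rw [lintegral_enorm_sq_eq]
    exact pow_le_pow_left' (eLpNorm_mollify_le n hu) 2
  have hmm : ∀ (n : ℕ) {u : ℂ → ℂ}, MemLp u 2 → AEMeasurable (fun z => 2 * ‖mollify n u z‖ₑ ^ 2)
      volume := fun n {u} hu =>
    ((aestronglyMeasurable_mollify n (locallyIntegrable_of_memLp_two hu)).enorm.pow_const 2).const_mul 2
  have hone : ∀ n {D : ℂ → ℂ}, (∀ z, ‖D z‖ₑ ^ 2 ≤
      2 * ‖mollify n P z‖ₑ ^ 2 + 2 * ‖mollify n Q z‖ₑ ^ 2) →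
      ∫⁻ z, ‖D z‖ₑ ^ 2 ≤ 2 * eLpNorm P 2 volume ^ 2 + 2 * eLpNorm Q 2 volume ^ 2 := by
    intro n D hD
    refine (lintegral_mono hD).trans ?_
    rw [lintegral_add_left' (hmm n hP), lintegral_const_mul' _ _ (by norm_num),
      lintegral_const_mul' _ _ (by norm_num)]
    exact add_le_add (mul_le_mul' le_rfl (hb n hP)) (mul_le_mul' le_rfl (hb n hQ))
  have := lintegral_ball_sub_le_of_tendsto (E := E) hφ.1.measurable_mk
    (Lp.stronglyMeasurable V).measurable hψ (fun n => ?_) ?_ ?_ hr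
  · refine this.trans_eq ?_
    rw [mul_comm 32 (r ^ 3), ENNReal.ofReal_mul (by positivity), mul_assoc, ENNReal.ofReal_ofNat]
  · rw [hEE]
    refine (add_le_add (hone n (D := fun z => fderiv ℝ (mollify n φ) z 1) fun z => ?_)
      (hone n (D := fun z => fderiv ℝ (mollify n φ) z Complex.I) fun z => ?_)).trans ?_
    · simp only [fderiv_one_eq, hw, hwb]
      exact enorm_add_sq_le
    · simp only [fderiv_I_eq, hw, hwb]
      rw [enorm_mul, show ‖Complex.I‖ₑ = 1 by simp [← ofReal_norm], one_mul, sub_eq_add_neg]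
      exact enorm_add_sq_le.trans_eq (by rw [enorm_neg])
    · calc _ = 4 * (eLpNorm P 2 volume ^ 2 + eLpNorm Q 2 volume ^ 2) := by ring
        _ ≤ _ := by
          gcongr
          norm_num
  · have : Tendsto (fun n => eLpNorm (fun z => mollify n φ z - φ z) 2 volume ^ 2) atTop (𝓝 0) := by
      simpa using ENNReal.Tendsto.pow (n := 2) (tendsto_eLpNorm_mollify_sub hφ)
    refine this.congr fun n => ?_
    rw [← lintegral_enorm_sq_eq]
    refine lintegral_congr_ae ?_
    filter_upwards [hmk] with z hz
    rw [← hz]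
  · have : Tendsto (fun n => eLpNorm (fun x : ℝ => mollify n φ x - V x) 2 volume ^ 2) atTop (𝓝 0) := by
      simpa using ENNReal.Tendsto.pow (n := 2) hlim
    refine this.congr fun n => ?_
    rw [← lintegral_enorm_sq_eq]

end LebesgueTrace

/-! ### Multiplication of $W^{1,2}_{\mathrm{loc}}$ functions by test functions -/

section Localization

variable {H p q χ ψ : ℂ → ℂ}

lemma IsTestFunction.mul (h : IsTestFunction χ) (h' : IsTestFunction ψ) :
    IsTestFunction fun z => χ z * ψ z :=
  ⟨h.smooth.mul h'.smooth, h.compact.mul_right⟩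

lemma wirtinger_mul (h : IsTestFunction χ) (h' : IsTestFunction ψ) (z : ℂ) :
    wirtinger (fun z => χ z * ψ z) z = χ z * wirtinger ψ z + ψ z * wirtinger χ z := by
  unfold wirtinger
  rw [fderiv_fun_mul (h.differentiable z) (h'.differentiable z)]
  simp only [add_apply, smul_apply, smul_eq_mul]
  ring

lemma wirtingerBar_mul (h : IsTestFunction χ) (h' : IsTestFunction ψ) (z : ℂ) :
    wirtingerBar (fun z => χ z * ψ z) z = χ z * wirtingerBar ψ z + ψ z * wirtingerBar χ z := by
  unfold wirtingerBar
  rw [fderiv_fun_mul (h.differentiable z) (h'.differentiable z)]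
  simp only [add_apply, smul_apply, smul_eq_mul]
  ring

lemma MemL2Loc.locallyIntegrable {u : ℂ → ℂ} (hu : MemL2Loc u) : LocallyIntegrable u := by
  rw [locallyIntegrable_iff]
  intro K hK
  have : IsFiniteMeasure (volume.restrict K) := ⟨by
    rw [Measure.restrict_apply_univ]; exact hK.measure_lt_top⟩
  exact (hu K hK).integrable (by norm_num)

lemma MemL2Loc.memLp_testFunction_mul {u : ℂ → ℂ} (hu : MemL2Loc u) (hχ : IsTestFunction χ) :
    MemLp (fun z => χ z * u z) 2 := by
  obtain ⟨C, hC⟩ := hχ.continuous.bounded_above_of_compact_support hχ.compact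
  have h1 := memLp_mul_of_bound (hu (tsupport χ) hχ.compact)
    (hχ.continuous.aestronglyMeasurable (μ := volume.restrict (tsupport χ))) hC
  have h2 := (memLp_indicator_iff_restrict (isClosed_tsupport χ).measurableSet).2 h1
  have e : (fun z => χ z * u z) = (tsupport χ).indicator fun z => u z * χ z := by
    funext z
    by_cases hz : z ∈ tsupport χ
    · rw [Set.indicator_of_mem hz, mul_comm]
    · rw [Set.indicator_of_notMem hz, image_eq_zero_of_notMem_tsupport hz, zero_mul]
  rw [e]
  exact h2

/-- Leibniz' rule in weak form, obtained by testing `H` against $\chi\psi$. -/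
lemma IsW12Loc.weakDz_mul (h : IsW12Loc H p q) (hχ : IsTestFunction χ) (hψ : IsTestFunction ψ) :
    ∫ z, χ z * H z * wirtinger ψ z = -∫ z, (χ z * p z + wirtinger χ z * H z) * ψ z := by
  have h1 := h.weakDz _ (hχ.mul hψ).smooth (hχ.mul hψ).compact
  have iH := h.memH.locallyIntegrable
  have ip := h.memP.locallyIntegrable
  have i1 := integrable_mul_of_locallyIntegrable iH (hχ.mul hψ.wirtinger)
  have i2 := integrable_mul_of_locallyIntegrable iH (hψ.mul hχ.wirtinger)
  have i3 := integrable_mul_of_locallyIntegrable ip (hχ.mul hψ)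
  simp only [wirtinger_mul hχ hψ, mul_add] at h1
  rw [integral_add i1 i2] at h1
  have e1 : ∫ z, χ z * H z * wirtinger ψ z = ∫ z, H z * (χ z * wirtinger ψ z) := by
    congr 1; funext z; ring
  have e2 : ∫ z, (χ z * p z + wirtinger χ z * H z) * ψ z =
      (∫ z, p z * (χ z * ψ z)) + ∫ z, H z * (ψ z * wirtinger χ z) := by
    rw [← integral_add i3 i2]
    congr 1; funext z; ring
  rw [e1, e2]
  linear_combination h1

lemma IsW12Loc.weakDzBar_mul (h : IsW12Loc H p q) (hχ : IsTestFunction χ) (hψ : IsTestFunction ψ) :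
    ∫ z, χ z * H z * wirtingerBar ψ z = -∫ z, (χ z * q z + wirtingerBar χ z * H z) * ψ z := by
  have h1 := h.weakDzBar _ (hχ.mul hψ).smooth (hχ.mul hψ).compact
  have iH := h.memH.locallyIntegrable
  have ip := h.memQ.locallyIntegrable
  have i1 := integrable_mul_of_locallyIntegrable iH (hχ.mul hψ.wirtingerBar)
  have i2 := integrable_mul_of_locallyIntegrable iH (hψ.mul hχ.wirtingerBar)
  have i3 := integrable_mul_of_locallyIntegrable ip (hχ.mul hψ)
  simp only [wirtingerBar_mul hχ hψ, mul_add] at h1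
  rw [integral_add i1 i2] at h1
  have e1 : ∫ z, χ z * H z * wirtingerBar ψ z = ∫ z, H z * (χ z * wirtingerBar ψ z) := by
    congr 1; funext z; ring
  have e2 : ∫ z, (χ z * q z + wirtingerBar χ z * H z) * ψ z =
      (∫ z, q z * (χ z * ψ z)) + ∫ z, H z * (ψ z * wirtingerBar χ z) := by
    rw [← integral_add i3 i2]
    congr 1; funext z; ring
  rw [e1, e2]
  linear_combination h1

end Localization

/-! ### Cutoffs at dyadic scales -/

section Cutoff

/-- Smooth cutoffs at dyadic scales. -/
lemma exists_dyadic_cutoff : ∃ (χ : ℕ → ℂ → ℂ) (C : ℝ), 0 ≤ C ∧ ∀ j, IsTestFunction (χ j) ∧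
    (∀ z, ‖χ j z‖ ≤ 1) ∧ (∀ z, ‖z‖ ≤ 2 ^ j → χ j z = 1) ∧ (∀ z, 2 ^ (j + 1) < ‖z‖ → χ j z = 0) ∧
    (∀ z, ¬(2 ^ j < ‖z‖ ∧ ‖z‖ < 2 * 2 ^ j) → wirtinger (χ j) z = 0 ∧ wirtingerBar (χ j) z = 0) ∧
    ∀ z, ‖wirtinger (χ j) z‖ ≤ C / 2 ^ j ∧ ‖wirtingerBar (χ j) z‖ ≤ C / 2 ^ j := by
  -- The radii $5/4$ and $3/2$ lie strictly between $1$ and $2$, so the bump is locally constant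
  -- around every point with $|z|\le1$ or $|z|\ge2$ and its derivative vanishes on the boundary
  -- circles too.
  set b : ContDiffBump (0 : ℂ) := ⟨5 / 4, 3 / 2, by norm_num, by norm_num⟩ with hb
  set χ₀ : ℂ → ℂ := fun z => (b z : ℂ) with hχ₀
  have ht : IsTestFunction χ₀ := ⟨Complex.ofRealCLM.contDiff.comp b.contDiff,
    b.hasCompactSupport.comp_left (g := ((↑) : ℝ → ℂ)) (by simp)⟩
  obtain ⟨C₁, hC₁⟩ := ht.wirtinger.continuous.bounded_above_of_compact_support ht.wirtinger.compact
  obtain ⟨C₂, hC₂⟩ :=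
    ht.wirtingerBar.continuous.bounded_above_of_compact_support ht.wirtingerBar.compact
  have hone : ∀ z : ℂ, ‖z‖ ≤ 5 / 4 → χ₀ z = 1 := by
    intro z hz
    have : b z = 1 := b.one_of_mem_closedBall (by simpa using hz)
    simp [hχ₀, this]
  have hzero : ∀ z : ℂ, 3 / 2 ≤ ‖z‖ → χ₀ z = 0 := by
    intro z hz
    have : b z = 0 := b.zero_of_le_dist (by simpa using hz)
    simp [hχ₀, this]
  have hd : ∀ z : ℂ, ¬(1 < ‖z‖ ∧ ‖z‖ < 2) → fderiv ℝ χ₀ z = 0 := by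
    intro z hz
    by_cases h1 : ‖z‖ ≤ 1
    · have : χ₀ =ᶠ[𝓝 z] fun _ => 1 := by
        filter_upwards [Metric.ball_mem_nhds z (show (0 : ℝ) < 1 / 4 by norm_num)] with w hw
        refine hone w ?_
        have h3 := norm_le_norm_add_norm_sub' w z
        rw [Metric.mem_ball, dist_eq_norm] at hw
        linarith
      rw [this.fderiv_eq, fderiv_const_apply]
    · have h2 : 2 ≤ ‖z‖ := by
        by_contra h
        exact hz ⟨not_le.1 h1, not_le.1 h⟩
      have : χ₀ =ᶠ[𝓝 z] fun _ => 0 := by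
        filter_upwards [Metric.ball_mem_nhds z (show (0 : ℝ) < 1 / 4 by norm_num)] with w hw
        refine hzero w ?_
        have h3 := norm_le_norm_add_norm_sub w z
        rw [Metric.mem_ball, dist_eq_norm] at hw
        linarith
      rw [this.fderiv_eq, fderiv_const_apply]
  have hfd : ∀ (j : ℕ) (z : ℂ), fderiv ℝ (fun z : ℂ => χ₀ (((2 : ℝ) ^ j)⁻¹ • z)) z =
      ((2 : ℝ) ^ j)⁻¹ • fderiv ℝ χ₀ (((2 : ℝ) ^ j)⁻¹ • z) := fun j z => fderiv_comp_smul _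
  have hn : ∀ (j : ℕ) (z : ℂ), ‖((2 : ℝ) ^ j)⁻¹ • z‖ = ‖z‖ / 2 ^ j := by
    intro j z
    rw [norm_smul, norm_inv, norm_pow, Real.norm_ofNat, inv_mul_eq_div]
  refine ⟨fun j z => χ₀ (((2 : ℝ) ^ j)⁻¹ • z), max C₁ C₂,
    (norm_nonneg _).trans ((hC₁ 0).trans (le_max_left _ _)), fun j => ?_⟩
  have h2j : (0 : ℝ) < 2 ^ j := by positivity
  have hw : ∀ z, wirtinger (fun z : ℂ => χ₀ (((2 : ℝ) ^ j)⁻¹ • z)) z =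
      (((2 : ℝ) ^ j)⁻¹ : ℝ) * wirtinger χ₀ (((2 : ℝ) ^ j)⁻¹ • z) := by
    intro z
    unfold wirtinger
    rw [hfd]
    simp only [smul_apply, Complex.real_smul]
    ring
  have hwb : ∀ z, wirtingerBar (fun z : ℂ => χ₀ (((2 : ℝ) ^ j)⁻¹ • z)) z =
      (((2 : ℝ) ^ j)⁻¹ : ℝ) * wirtingerBar χ₀ (((2 : ℝ) ^ j)⁻¹ • z) := by
    intro z
    unfold wirtingerBar
    rw [hfd]
    simp only [smul_apply, Complex.real_smul]
    ring
  refine ⟨⟨ht.smooth.comp (contDiff_const_smul _), ?_⟩, fun z => ?_, fun z hz => ?_, fun z hz => ?_,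
    fun z hz => ?_, fun z => ?_⟩
  · exact ht.compact.comp_homeomorph (Homeomorph.smulOfNeZero _ (inv_ne_zero h2j.ne'))
  · simp only [hχ₀]
    rw [Complex.norm_real, Real.norm_of_nonneg b.nonneg]
    exact b.le_one
  · refine hone _ ?_
    rw [hn, div_le_iff₀ h2j]
    linarith
  · refine hzero _ ?_
    rw [hn, le_div_iff₀ h2j]
    rw [pow_succ] at hz
    linarith
  · have : fderiv ℝ χ₀ (((2 : ℝ) ^ j)⁻¹ • z) = 0 := by
      refine hd _ ?_
      rw [hn, lt_div_iff₀ h2j, div_lt_iff₀ h2j, one_mul]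
      exact hz
    rw [hw, hwb]
    unfold wirtinger wirtingerBar
    rw [this]
    simp
  · rw [hw, hwb, norm_mul, norm_mul, Complex.norm_real, norm_inv, norm_pow, Real.norm_ofNat,
      inv_mul_eq_div, inv_mul_eq_div]
    exact ⟨div_le_div_of_nonneg_right ((hC₁ _).trans (le_max_left _ _)) h2j.le,
      div_le_div_of_nonneg_right ((hC₂ _).trans (le_max_right _ _)) h2j.le⟩

end Cutoff

/-! ### Growth of the $L^2$ mass of the Cauchy integral -/

section Growth

variable {g : ℝ → ℂ} {M : ℝ}

/-- On the support of $g$ one has $|x|\le M\le|z|/2$, hence $|x-z|\ge|z|/2$; the resulting factor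
$2$ is absorbed by $1/(2\pi)\le1/2$. -/
lemma enorm_lineCauchyIntegral_le (hsupp : ∀ x, M < |x| → g x = 0) {z : ℂ}
    (hM : 0 < M) (hz : 2 * M ≤ ‖z‖) :
    ‖lineCauchyIntegral g z‖ₑ ≤ ENNReal.ofReal ‖z‖⁻¹ * ∫⁻ x, ‖g x‖ₑ := by
  have hz0 : 0 < ‖z‖ := by linarith
  have h1 : ∀ x : ℝ, ‖g x / ((x : ℂ) - z)‖ₑ ≤ ENNReal.ofReal (2 * ‖z‖⁻¹) * ‖g x‖ₑ := by
    intro x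
    by_cases hx : M < |x|
    · simp [hsupp x hx]
    · have h2 : ‖z‖ / 2 ≤ ‖(x : ℂ) - z‖ := by
        have := norm_sub_norm_le z (x : ℂ)
        rw [norm_sub_rev, Complex.norm_real, Real.norm_eq_abs] at this
        linarith
      rw [← ofReal_norm, ← ofReal_norm, ← ENNReal.ofReal_mul (by positivity)]
      refine ENNReal.ofReal_le_ofReal ?_
      rw [norm_div, div_eq_inv_mul]
      gcongr
      calc ‖(x : ℂ) - z‖⁻¹ ≤ (‖z‖ / 2)⁻¹ := by gcongr
        _ = 2 * ‖z‖⁻¹ := by rw [inv_div, div_eq_mul_inv]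
  rw [lineCauchyIntegral, enorm_mul]
  have h3 : ‖(2 * (Real.pi : ℂ) * Complex.I)⁻¹‖ₑ ≤ ENNReal.ofReal (1 / 2) := by
    rw [← ofReal_norm]
    refine ENNReal.ofReal_le_ofReal ?_
    rw [norm_inv, norm_mul, norm_mul, Complex.norm_I, Complex.norm_real, Real.norm_of_nonneg
      Real.pi_pos.le, Complex.norm_ofNat, mul_one, ← one_div]
    gcongr
    linarith [Real.pi_gt_three]
  calc _ ≤ ENNReal.ofReal (1 / 2) * ∫⁻ x, ENNReal.ofReal (2 * ‖z‖⁻¹) * ‖g x‖ₑ :=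
        mul_le_mul' h3 ((enorm_integral_le_lintegral_enorm _).trans (lintegral_mono h1))
    _ = _ := by
        rw [lintegral_const_mul' _ _ ENNReal.ofReal_ne_top, ← mul_assoc,
          ← ENNReal.ofReal_mul (by norm_num)]
        congr 2
        ring

/-- The disc lies in the strip $|y|<r$, on each line of which, except $\mathbb R$ itself, the $L^2$
bound by $\|g\|_2$ holds. -/
lemma lintegral_ball_lineCauchyIntegral_lt_top (hg : MemLp g 2) (r : ℝ) :
    ∫⁻ z in Metric.ball 0 r, ‖lineCauchyIntegral g z‖ₑ ^ 2 < ⊤ := by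
  have hm := measurable_lineCauchyIntegral hg.1
  have hS : MeasurableSet {z : ℂ | |z.im| < r} :=
    measurableSet_lt (by fun_prop) measurable_const
  calc ∫⁻ z in Metric.ball 0 r, ‖lineCauchyIntegral g z‖ₑ ^ 2
      ≤ ∫⁻ z in {z : ℂ | |z.im| < r}, ‖lineCauchyIntegral g z‖ₑ ^ 2 := by
        refine lintegral_mono_set fun z hz => ?_
        exact (Complex.abs_im_le_norm z).trans_lt (by simpa using hz)
    _ = ∫⁻ y : ℝ, ∫⁻ x : ℝ, {z : ℂ | |z.im| < r}.indicator
          (fun z => ‖lineCauchyIntegral g z‖ₑ ^ 2) (x + y * Complex.I) := by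
        rw [← lintegral_indicator hS, lintegral_complex ((hm.enorm.pow_const 2).indicator hS)]
    _ ≤ ∫⁻ y : ℝ, (Metric.ball 0 r).indicator (fun _ => eLpNorm g 2 volume ^ 2) y := by
        refine lintegral_mono_ae ?_
        filter_upwards [measure_eq_zero_iff_ae_notMem.1 (Real.volume_singleton (a := 0))] with y hy
        by_cases h : |y| < r
        · rw [Set.indicator_of_mem (by simpa using h)]
          refine le_trans (lintegral_mono fun x => Set.indicator_le_self _ _ _) ?_
          exact lintegral_sq_lineCauchyIntegral_le hg hy
        · refine le_trans (le_of_eq ?_) zero_le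
          simp [Set.indicator, h]
    _ = eLpNorm g 2 volume ^ 2 * volume (Metric.ball (0 : ℝ) r) := by
        rw [lintegral_indicator Metric.isOpen_ball.measurableSet, setLIntegral_const]
    _ < ⊤ := ENNReal.mul_lt_top (ENNReal.pow_lt_top hg.2) measure_ball_lt_top

/-- The `L²` mass of the Cauchy integral of a compactly supported function grows at most
logarithmically. -/
lemma exists_lintegral_ball_lineCauchyIntegral_le (hg : MemLp g 2) (hg1 : Integrable g)
    (hsupp : ∀ x, M < |x| → g x = 0) :
    ∃ C : ℝ≥0, ∀ m : ℕ, ∫⁻ z in Metric.ball 0 (2 ^ m), ‖lineCauchyIntegral g z‖ₑ ^ 2 ≤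
      C * (m + 1) := by
  wlog hM : 0 < M generalizing M
  · exact this (M := 1) (fun x hx => hsupp x (lt_trans (lt_of_le_of_lt (not_lt.1 hM) one_pos) hx))
      one_pos
  obtain ⟨m₀, hm₀⟩ := pow_unbounded_of_one_lt (2 * M) (one_lt_two (α := ℝ))
  set D := ∫⁻ z in Metric.ball 0 (2 ^ m₀), ‖lineCauchyIntegral g z‖ₑ ^ 2 with hD
  have hDt : D < ⊤ := lintegral_ball_lineCauchyIntegral_lt_top hg _
  set F := 4 * ENNReal.ofReal Real.pi * (∫⁻ x, ‖g x‖ₑ) ^ 2 with hF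
  have hFt : F < ⊤ := ENNReal.mul_lt_top (ENNReal.mul_lt_top (by norm_num) ENNReal.ofReal_lt_top)
    (ENNReal.pow_lt_top hg1.2)
  have key : ∀ m : ℕ, ∫⁻ z in Metric.ball 0 (2 ^ m), ‖lineCauchyIntegral g z‖ₑ ^ 2 ≤ D + m * F := by
    intro m
    rcases le_total m m₀ with h | h
    · exact (lintegral_mono_set (Metric.ball_subset_ball (pow_le_pow_right₀ one_le_two h))).trans
        le_self_add
    · induction m, h using Nat.le_induction with
      | base => exact le_self_add
      | succ m hm ih =>
        have hsub : Metric.ball (0 : ℂ) (2 ^ (m + 1)) ⊆ Metric.ball 0 (2 ^ m) ∪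
            (Metric.ball 0 (2 ^ (m + 1)) \ Metric.ball 0 (2 ^ m)) := by
          rw [Set.union_sdiff_self]
          exact Set.subset_union_right
        -- On the annulus $|C_g|^2\le4^{-m}\|g\|_1^2$ and the area is at most $\pi4^{m+1}$, so each
        -- dyadic step adds at most the constant `F`.
        have hann : ∫⁻ z in Metric.ball (0 : ℂ) (2 ^ (m + 1)) \ Metric.ball 0 (2 ^ m),
            ‖lineCauchyIntegral g z‖ₑ ^ 2 ≤ F := by
          have hpt : ∀ z ∈ Metric.ball (0 : ℂ) (2 ^ (m + 1)) \ Metric.ball 0 (2 ^ m),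
              ‖lineCauchyIntegral g z‖ₑ ^ 2 ≤
                (ENNReal.ofReal (2 ^ m)⁻¹ * ∫⁻ x, ‖g x‖ₑ) ^ 2 := by
            intro z hz
            have hz2 : 2 ^ m ≤ ‖z‖ := by simpa using hz.2
            have h3 : 2 * M ≤ ‖z‖ := by
              have : (2 : ℝ) ^ m₀ ≤ 2 ^ m := pow_le_pow_right₀ one_le_two hm
              linarith
            refine pow_le_pow_left' ((enorm_lineCauchyIntegral_le hsupp hM h3).trans ?_) 2
            gcongr
          refine (setLIntegral_mono measurable_const hpt).trans ?_
          rw [setLIntegral_const]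
          refine (mul_le_mul' le_rfl (measure_mono Set.sdiff_subset)).trans ?_
          rw [Complex.volume_ball, hF, mul_pow, ← ENNReal.ofReal_pow (by positivity),
            ← ENNReal.ofReal_pow (by positivity)]
          have e1 : (NNReal.pi : ℝ≥0∞) = ENNReal.ofReal Real.pi := by
            rw [← NNReal.coe_real_pi, ENNReal.ofReal_coe_nnreal]
          rw [e1]
          have e2 : (4 : ℝ≥0∞) = ENNReal.ofReal (((2 : ℝ) ^ m)⁻¹ ^ 2) *
              ENNReal.ofReal ((2 ^ (m + 1)) ^ 2) := by
            rw [← ENNReal.ofReal_mul (by positivity), ← ENNReal.ofReal_ofNat]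
            congr 1
            rw [pow_succ]
            field_simp
            ring
          rw [e2]
          refine le_of_eq ?_
          ring
        calc _ ≤ (∫⁻ z in Metric.ball 0 (2 ^ m), ‖lineCauchyIntegral g z‖ₑ ^ 2) + F :=
              (lintegral_mono_set hsub).trans ((lintegral_union_le _ _ _).trans
                (add_le_add le_rfl hann))
          _ ≤ D + m * F + F := by gcongr
          _ = _ := by push_cast; ring
  refine ⟨(D + F).toNNReal, fun m => (key m).trans ?_⟩
  rw [ENNReal.coe_toNNReal (ENNReal.add_lt_top.2 ⟨hDt, hFt⟩).ne]
  calc D + m * F ≤ (D + m * F) + (m * D + F) := le_self_add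
    _ = _ := by ring

end Growth

/-! ### Pairing identities for compactly supported $W^{1,2}$ functions -/

section Pairing

lemma tendsto_integral_mul {α : Type*} [MeasurableSpace α] {ν : Measure α} {a w : α → ℂ}
    {w' : ℕ → α → ℂ} (ha : MemLp a 2 ν) (hw : MemLp w 2 ν) (hw' : ∀ n, MemLp (w' n) 2 ν)
    (h : Tendsto (fun n => eLpNorm (fun x => w' n x - w x) 2 ν) atTop (𝓝 0)) :
    Tendsto (fun n => ∫ x, a x * w' n x ∂ν) atTop (𝓝 (∫ x, a x * w x ∂ν)) := by
  rw [tendsto_iff_edist_tendsto_0]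
  have h1 : Tendsto (fun n => eLpNorm a 2 ν * eLpNorm (fun x => w' n x - w x) 2 ν) atTop (𝓝 0) := by
    simpa using ENNReal.Tendsto.const_mul h (Or.inr ha.2.ne)
  refine tendsto_of_tendsto_of_tendsto_of_le_of_le tendsto_const_nhds h1 (fun n => zero_le)
    fun n => ?_
  simp only
  rw [edist_eq_enorm_sub, ← integral_sub (integrable_mul_of_memLp_two ha (hw' n))
    (integrable_mul_of_memLp_two ha hw)]
  simp only [← mul_sub]
  exact enorm_integral_mul_le _ _ ha.1 ((hw' n).1.sub hw.1)

lemma memLp_mollify (n : ℕ) {u : ℂ → ℂ} (hu : MemLp u 2) : MemLp (mollify n u) 2 :=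
  ⟨aestronglyMeasurable_mollify n (locallyIntegrable_of_memLp_two hu),
    (eLpNorm_mollify_le n hu).trans_lt hu.2⟩

variable {φ P Q : ℂ → ℂ} {R ρ : ℝ}

/-- The jump relation holds for the mollifications and passes to the limit. The indicator puts the
Cauchy integral in $L^2$ and changes nothing, because the mollifications of `Q` vanish for $|z|>R+1$
and $R+1<\rho$. -/
lemma integral_indicator_lineCauchyIntegral_mul {g v : ℝ → ℂ} (hg : MemLp g 2) (hg1 : Integrable g)
    (hφ : MemLp φ 2) (hQ : MemLp Q 2) (hR : ∀ z, R < ‖z‖ → φ z = 0)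
    (hQR : ∀ z, R < ‖z‖ → Q z = 0)
    (hQw : ∀ χ, IsTestFunction χ → ∫ z, φ z * wirtingerBar χ z = -∫ z, Q z * χ z)
    (hv : MemLp v 2)
    (hlim : Tendsto (fun n => eLpNorm (fun x : ℝ => mollify n φ x - v x) 2 volume) atTop (𝓝 0))
    (hρ : R + 1 < ρ) :
    ∫ z, (Metric.ball 0 ρ).indicator (lineCauchyIntegral g) z * Q z =
      (2 * Complex.I)⁻¹ * ∫ x : ℝ, g x * v x := by
  have hL := locallyIntegrable_of_memLp_two hφ
  have hψ : ∀ n, IsTestFunction (mollify n φ) := fun n => isTestFunction_mollify n hL hR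
  have hC : MemLp ((Metric.ball 0 ρ).indicator (lineCauchyIntegral g)) 2 := by
    rw [memLp_indicator_iff_restrict Metric.isOpen_ball.measurableSet]
    exact memLp_two_of_lintegral_lt_top (measurable_lineCauchyIntegral hg.1).aestronglyMeasurable
      (lintegral_ball_lineCauchyIntegral_lt_top hg ρ)
  have t1 := tendsto_integral_mul hC hQ (fun n => memLp_mollify n hQ) (tendsto_eLpNorm_mollify_sub hQ)
  have t2 := (tendsto_integral_mul hg hv (fun n => (hψ n).memLp_ofReal)
    hlim).const_mul (2 * Complex.I)⁻¹
  refine tendsto_nhds_unique t1 (t2.congr fun n => ?_)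
  rw [← integral_lineCauchyIntegral_mul_wirtingerBar hg1 (hψ n)]
  congr 1
  funext z
  rw [wirtingerBar_mollify n hL hQw]
  by_cases hz : z ∈ Metric.ball (0 : ℂ) ρ
  · rw [Set.indicator_of_mem hz]
  · have : R + 1 < ‖z‖ := hρ.trans_le (by simpa using hz)
    rw [mollify_eq_zero n hQR this, mul_zero, mul_zero]

/-- Mollification extends $\int Sk\,\overline\partial\chi=\int k\,\partial\chi$ from test functions
to the localised solution. -/
lemma integral_mul_eq_of_weak {k K : ℂ → ℂ} (hk : MemLp k 2) (hK : MemLp K 2)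
    (hkK : ∀ χ, IsTestFunction χ → ∫ z, K z * wirtingerBar χ z = ∫ z, k z * wirtinger χ z)
    (hφ : MemLp φ 2) (hP : MemLp P 2) (hQ : MemLp Q 2) (hR : ∀ z, R < ‖z‖ → φ z = 0)
    (hPw : ∀ χ, IsTestFunction χ → ∫ z, φ z * wirtinger χ z = -∫ z, P z * χ z)
    (hQw : ∀ χ, IsTestFunction χ → ∫ z, φ z * wirtingerBar χ z = -∫ z, Q z * χ z) :
    ∫ z, K z * Q z = ∫ z, k z * P z := by
  have hL := locallyIntegrable_of_memLp_two hφ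
  have t1 := tendsto_integral_mul hK hQ (fun n => memLp_mollify n hQ) (tendsto_eLpNorm_mollify_sub hQ)
  have t2 := tendsto_integral_mul hk hP (fun n => memLp_mollify n hP) (tendsto_eLpNorm_mollify_sub hP)
  refine tendsto_nhds_unique t1 (t2.congr fun n => ?_)
  have := hkK _ (isTestFunction_mollify n hL hR)
  rw [funext (wirtinger_mollify n hL hPw), funext (wirtingerBar_mollify n hL hQw)] at this
  exact this.symm

end Pairing

/-! ### Weighted estimates and dyadic annuli -/

section Estimates

lemma weightedSq_mul_eq {μ : ℂ → ℂ} (hμ : AEStronglyMeasurable μ)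
    {F : ℂ → ℂ} (hF : Measurable F) :
    weightedSq (fun z => μ z * F z) = ∫⁻ z, ‖F z‖ₑ ^ 2 ∂dilatationMeasure μ := by
  have hd : AEMeasurable (fun z : ℂ => ‖μ z‖ₑ ^ 2 / ‖z.im‖ₑ) volume :=
    (hμ.enorm.pow_const 2).div Complex.measurable_im.enorm.aemeasurable
  rw [dilatationMeasure, lintegral_withDensity_eq_lintegral_mul₀ hd (hF.enorm.pow_const 2).aemeasurable,
    weightedSq]
  refine lintegral_congr fun z => ?_
  rw [Pi.mul_apply, enorm_mul, mul_pow, ENNReal.mul_div_right_comm]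

lemma dilatationMeasure_im_eq_zero (μ : ℂ → ℂ) : dilatationMeasure μ {z | z.im = 0} = 0 :=
  withDensity_absolutelyContinuous _ _ volume_im_eq_zero

/-- The Carleson embedding for $|\mu|^2/|y|\,dm$. It places the right-hand side $\mu C_g$ of the
dual equation in $L^2(dm/|y|)$. -/
lemma weightedSq_mul_lineCauchyIntegral_le {μ : ℂ → ℂ} (hμ : AEStronglyMeasurable μ) {A : ℝ≥0}
    (hA : IsCarlesonWith (dilatationMeasure μ) A) {g : ℝ → ℂ} (hg : MemLp g 2) (s : Set ℂ) :
    weightedSq (fun z => μ z * s.indicator (lineCauchyIntegral g) z) ≤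
      12288 * A * eLpNorm g 2 volume ^ 2 := by
  refine le_trans (lintegral_mono fun z => ?_) ((weightedSq_mul_eq hμ
    (measurable_lineCauchyIntegral hg.1)).trans_le
    (lintegral_sq_lineCauchyIntegral_le_carleson hA (dilatationMeasure_im_eq_zero μ) hg))
  simp only [enorm_mul]
  gcongr
  exact enorm_indicator_le_enorm_self _ _

/-- Cauchy-Schwarz after inserting $|y|^{1/2}|y|^{-1/2}$; the first factor is controlled by the
Littlewood-Paley estimate, which supplies the $2$. -/
lemma sq_enorm_integral_lineCauchyDeriv_mul_le {f : ℝ → ℂ} (hf : MemLp f 2) {k χ : ℂ → ℂ}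
    (hk : AEStronglyMeasurable k) (hχm : AEStronglyMeasurable χ) (hχ : ∀ z, ‖χ z‖ ≤ 1) :
    ‖∫ z, lineCauchyDeriv f z * (χ z * k z)‖ₑ ^ 2 ≤
      2 * eLpNorm f 2 volume ^ 2 * weightedSq k := by
  set a : ℂ → ℂ := fun z => lineCauchyDeriv f z * (√|z.im| : ℝ) with ha
  set b : ℂ → ℂ := fun z => χ z * k z * ((√|z.im|)⁻¹ : ℝ) with hb
  have ms : Measurable fun z : ℂ => ((√|z.im| : ℝ) : ℂ) := by fun_prop
  have ms' : Measurable fun z : ℂ => (((√|z.im|)⁻¹ : ℝ) : ℂ) := by fun_prop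
  have e : ∫ z, lineCauchyDeriv f z * (χ z * k z) = ∫ z, a z * b z := by
    refine integral_congr_ae ?_
    filter_upwards [ae_im_ne_zero] with z hz
    have : ((√|z.im| : ℝ) : ℂ) ≠ 0 := by
      rw [ne_eq, Complex.ofReal_eq_zero, Real.sqrt_eq_zero (abs_nonneg _), abs_eq_zero]
      exact hz
    simp only [ha, hb]
    push_cast
    field_simp
  have hs : ∀ z : ℂ, ‖((√|z.im| : ℝ) : ℂ)‖ₑ ^ 2 = ‖z.im‖ₑ := by
    intro z
    rw [← ofReal_norm, ← ENNReal.ofReal_pow (norm_nonneg _), Complex.norm_real,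
      Real.norm_of_nonneg (Real.sqrt_nonneg _), Real.sq_sqrt (abs_nonneg _), ← Real.norm_eq_abs,
      ofReal_norm]
  have ha2 : eLpNorm a 2 volume ^ 2 ≤ 2 * eLpNorm f 2 volume ^ 2 := by
    rw [← lintegral_enorm_sq_eq]
    refine le_trans (le_of_eq (lintegral_congr fun z => ?_)) (lintegral_sq_lineCauchyDeriv_le hf)
    rw [ha, enorm_mul, mul_pow, hs]
  have hb2 : eLpNorm b 2 volume ^ 2 ≤ weightedSq k := by
    rw [← lintegral_enorm_sq_eq, weightedSq]
    refine lintegral_mono_ae ?_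
    filter_upwards [ae_im_ne_zero] with z hz
    have h0 : ((√|z.im| : ℝ) : ℂ) ≠ 0 := by
      rw [ne_eq, Complex.ofReal_eq_zero, Real.sqrt_eq_zero (abs_nonneg _), abs_eq_zero]
      exact hz
    have h1 : ‖χ z‖ₑ ≤ 1 := by
      rw [← ofReal_norm]
      exact ENNReal.ofReal_le_one.2 (hχ z)
    rw [hb]
    simp only
    rw [Complex.ofReal_inv, enorm_mul, enorm_mul, enorm_inv h0, mul_pow, mul_pow,
      ← ENNReal.inv_pow, hs, ENNReal.div_eq_inv_mul, mul_comm]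
    refine mul_le_mul' le_rfl ?_
    calc ‖χ z‖ₑ ^ 2 * ‖k z‖ₑ ^ 2 ≤ 1 ^ 2 * ‖k z‖ₑ ^ 2 := by gcongr
      _ = _ := by rw [one_pow, one_mul]
  rw [e]
  calc _ ≤ (eLpNorm a 2 volume * eLpNorm b 2 volume) ^ 2 :=
        pow_le_pow_left' (enorm_integral_mul_le a b
          ((measurable_lineCauchyDeriv f).mul ms).aestronglyMeasurable
          ((hχm.mul hk).mul ms'.aestronglyMeasurable)) 2
    _ ≤ _ := by
        rw [mul_pow]
        exact mul_le_mul' ha2 hb2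

/-- Meant for the commutator error, where `W` is `H` times derivatives of the cutoff. As `W` lives
on `S`, only the mass of `G` on `S` enters. -/
lemma sq_enorm_integral_mul_le_of_annulus {G W H : ℂ → ℂ} (hG : AEStronglyMeasurable G)
    (hW : AEStronglyMeasurable W) {S : Set ℂ} {c : ℝ≥0∞} (hc : c ≠ ⊤)
    (hWS : ∀ z ∉ S, W z = 0) (hWb : ∀ᵐ z, ‖W z‖ₑ ≤ c * ‖H z‖ₑ) :
    ‖∫ z, G z * W z‖ₑ ^ 2 ≤ (∫⁻ z in S, ‖G z‖ₑ ^ 2) * (c ^ 2 * ∫⁻ z in S, ‖H z‖ₑ ^ 2) := by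
  have e : ∫ z, G z * W z = ∫ z in S, G z * W z := by
    rw [setIntegral_eq_integral_of_forall_compl_eq_zero]
    intro z hz
    rw [hWS z hz, mul_zero]
  rw [e]
  refine (pow_le_pow_left' (enorm_integral_mul_le G W hG.restrict hW.restrict) 2).trans ?_
  rw [mul_pow, ← lintegral_enorm_sq_eq, ← lintegral_enorm_sq_eq,
    ← lintegral_const_mul' _ _ (ENNReal.pow_ne_top hc)]
  refine mul_le_mul' le_rfl (lintegral_mono_ae (ae_restrict_of_ae ?_))
  filter_upwards [hWb] with z hz
  rw [← mul_pow]
  exact pow_le_pow_left' hz 2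

/-- The dyadic annulus `{2 ^ j < |z| < 2 ^ (j + 1)}`. -/
def dyadicAnnulus (j : ℕ) : Set ℂ := {z | 2 ^ j < ‖z‖ ∧ ‖z‖ < 2 * 2 ^ j}

lemma measurableSet_dyadicAnnulus (j : ℕ) : MeasurableSet (dyadicAnnulus j) :=
  (measurableSet_lt measurable_const measurable_norm).inter
    (measurableSet_lt measurable_norm measurable_const)

lemma pairwise_disjoint_dyadicAnnulus : Pairwise (Function.onFun Disjoint dyadicAnnulus) := by
  have key : ∀ i j : ℕ, i < j → Disjoint (dyadicAnnulus i) (dyadicAnnulus j) := by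
    intro i j hij
    rw [Set.disjoint_left]
    intro z hi hj
    have h1 : (2 : ℝ) ^ (i + 1) ≤ 2 ^ j := pow_le_pow_right₀ one_le_two hij
    rw [pow_succ] at h1
    have h2 := hi.2
    have h3 := hj.1
    linarith
  intro i j hij
  rcases lt_or_gt_of_ne hij with h | h
  · exact key i j h
  · exact (key j i h).symm

/-- Pigeonhole over the $N$ disjoint annuli with $N\le j<2N$. The total may grow like $N$ and one
annulus still carries at most `D`. -/
lemma exists_lintegral_dyadicAnnulus_le (F : ℂ → ℝ≥0∞) {N : ℕ} (hN : 0 < N) {D : ℝ≥0∞}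
    (h : ∫⁻ z, F z ≤ D * N) :
    ∃ j, N ≤ j ∧ j < 2 * N ∧ ∫⁻ z in dyadicAnnulus j, F z ≤ D := by
  by_contra! hc
  have h1 : ∑ j ∈ Finset.Ico N (2 * N), D <
      ∑ j ∈ Finset.Ico N (2 * N), ∫⁻ z in dyadicAnnulus j, F z := by
    refine ENNReal.sum_lt_sum_of_nonempty (Finset.nonempty_Ico.2 (by omega)) fun j hj => ?_
    rw [Finset.mem_Ico] at hj
    exact hc j hj.1 hj.2
  have h2 : ∑ j ∈ Finset.Ico N (2 * N), ∫⁻ z in dyadicAnnulus j, F z ≤ ∫⁻ z, F z := by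
    rw [← lintegral_biUnion_finset (fun i _ j _ hij => pairwise_disjoint_dyadicAnnulus hij)
      fun j _ => measurableSet_dyadicAnnulus j]
    exact setLIntegral_le_lintegral _ _
  rw [Finset.sum_const, Nat.card_Ico, nsmul_eq_mul, show 2 * N - N = N by omega, mul_comm] at h1
  exact absurd (h1.trans_le (h2.trans h)) (lt_irrefl _)

lemma tendsto_dyadicAnnulus_of_vanishesAtInfty {H : ℂ → ℂ} (hH : MemL2Loc H)
    (h : VanishesAtInfty H) :
    Tendsto (fun j : ℕ => ENNReal.ofReal ((2 ^ j) ^ 2)⁻¹ * ∫⁻ z in dyadicAnnulus j, ‖H z‖ₑ ^ 2)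
      atTop (𝓝 0) := by
  have h1 := h.comp (tendsto_pow_atTop_atTop_of_one_lt (one_lt_two (α := ℝ)))
  have h2 := ENNReal.tendsto_ofReal h1
  rw [ENNReal.ofReal_zero] at h2
  refine h2.congr fun j => ?_
  simp only [Function.comp_apply]
  rw [ENNReal.ofReal_mul (by positivity)]
  congr 1
  have hm : MemLp H 2 (volume.restrict (dyadicAnnulus j)) := by
    refine (hH (Metric.closedBall 0 (2 * 2 ^ j)) (isCompact_closedBall _ _)).mono_measure
      (Measure.restrict_mono (fun z hz => ?_) le_rfl)
    simpa using hz.2.le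
  have hi : Integrable (fun z => ‖H z‖ ^ 2) (volume.restrict (dyadicAnnulus j)) :=
    hm.integrable_norm_pow two_ne_zero
  change ENNReal.ofReal (∫ z in dyadicAnnulus j, ‖H z‖ ^ 2) = _
  rw [ofReal_integral_eq_lintegral_ofReal hi (ae_of_all _ fun z => by positivity)]
  refine lintegral_congr fun z => ?_
  rw [ENNReal.ofReal_pow (norm_nonneg _), ofReal_norm]

lemma ae_enorm_le_one {μ : ℂ → ℂ} (hμ1 : eLpNorm μ ∞ volume < 1) : ∀ᵐ z, ‖μ z‖ₑ ≤ 1 := by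
  rw [eLpNorm_exponent_top] at hμ1
  filter_upwards [ae_le_eLpNormEssSup (f := μ) (μ := volume)] with z hz
  exact hz.trans hμ1.le

end Estimates

/-! ### The duality argument -/

section Duality

variable {A B : ℝ≥0} {μ H p q : ℂ → ℂ} {f : ℝ → ℂ}

/-- The trace of a localization of `H`, tested against a compactly supported function `g`. -/
lemma enorm_integral_mul_trace_le (hμ : AEStronglyMeasurable μ) (hμ1 : eLpNorm μ ∞ volume < 1)
    (hA : IsCarlesonWith (dilatationMeasure μ) A) (hB : InvertibleWith μ B) (hf : MemLp f 2)
    (hW : IsW12Loc H p q) (hEq : ∀ᵐ z, q z - μ z * p z = μ z * lineCauchyDeriv f z)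
    {χ : ℂ → ℂ} (hχ : IsTestFunction χ) (hχ1 : ∀ z, ‖χ z‖ ≤ 1) {R : ℝ}
    (hχR : ∀ z, R < ‖z‖ → χ z = 0) {S : Set ℂ}
    (hχS : ∀ z ∉ S, wirtinger χ z = 0 ∧ wirtingerBar χ z = 0) (hSR : ∀ z ∈ S, ‖z‖ ≤ R) {C : ℝ}
    (hχC : ∀ z, ‖wirtinger χ z‖ ≤ C ∧ ‖wirtingerBar χ z‖ ≤ C)
    {v : ℝ → ℂ} (hv : MemLp v 2)
    (hlim : Tendsto (fun n => eLpNorm (fun x : ℝ => mollify n (fun z => χ z * H z) x - v x) 2 volume)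
      atTop (𝓝 0))
    {g : ℝ → ℂ} (hg : MemLp g 2) (hg1 : Integrable g) {ρ : ℝ} (hρ : R + 1 < ρ) {k K : ℂ → ℂ}
    (hk : MemLp k 2) (hK : MemLp K 2)
    (hkK : ∀ᵐ z, k z - μ z * K z = μ z * (Metric.ball 0 ρ).indicator (lineCauchyIntegral g) z)
    (hkS : beurling k =ᵐ[volume] K)
    (hkw : ∀ χ, IsTestFunction χ → ∫ z, K z * wirtingerBar χ z = ∫ z, k z * wirtinger χ z)
    {D : ℝ≥0∞} (hD : ∫⁻ z in S, ‖(Metric.ball 0 ρ).indicator (lineCauchyIntegral g) z + K z‖ₑ ^ 2 ≤ D)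
    {δ : ℝ≥0∞} (hδ : D * (ENNReal.ofReal (2 * C) ^ 2 * ∫⁻ z in S, ‖H z‖ₑ ^ 2) ≤ δ ^ 2) :
    ‖∫ x, g x * v x‖ₑ ≤ 2 * ((NNReal.sqrt (24576 * A * B) : ℝ≥0) * eLpNorm f 2 volume *
      eLpNorm g 2 volume + δ) := by
  have hC : MemLp ((Metric.ball 0 ρ).indicator (lineCauchyIntegral g)) 2 := by
    rw [memLp_indicator_iff_restrict Metric.isOpen_ball.measurableSet]
    exact memLp_two_of_lintegral_lt_top (measurable_lineCauchyIntegral hg.1).aestronglyMeasurable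
      (lintegral_ball_lineCauchyIntegral_lt_top hg ρ)
  set c := (Metric.ball 0 ρ).indicator (lineCauchyIntegral g) with hc
  set P : ℂ → ℂ := fun z => χ z * p z + wirtinger χ z * H z with hP
  set Q : ℂ → ℂ := fun z => χ z * q z + wirtingerBar χ z * H z with hQ
  have mφ := hW.memH.memLp_testFunction_mul hχ
  have mP : MemLp P 2 := (hW.memP.memLp_testFunction_mul hχ).add
    (hW.memH.memLp_testFunction_mul hχ.wirtinger)
  have mQ : MemLp Q 2 := (hW.memQ.memLp_testFunction_mul hχ).add
    (hW.memH.memLp_testFunction_mul hχ.wirtingerBar)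
  have hR : ∀ z, R < ‖z‖ → χ z * H z = 0 := fun z hz => by rw [hχR z hz, zero_mul]
  have hQR : ∀ z, R < ‖z‖ → Q z = 0 := fun z hz => by
    have : z ∉ S := fun h => absurd (hSR z h) (not_le.2 hz)
    simp only [hQ]
    rw [hχR z hz, (hχS z this).2, zero_mul, zero_mul, add_zero]
  have hPw := fun ψ (hψ : IsTestFunction ψ) => hW.weakDz_mul hχ hψ
  have hQw := fun ψ (hψ : IsTestFunction ψ) => hW.weakDzBar_mul hχ hψ
  have e1 := integral_indicator_lineCauchyIntegral_mul hg hg1 mφ mQ hR hQR hQw hv hlim hρ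
  have e2 := integral_mul_eq_of_weak hk hK hkw mφ mP mQ hR hPw hQw
  have mG : MemLp (fun z => c z + K z) 2 := hC.add hK
  -- `W` collects the terms in which a derivative falls on $\chi$.
  set W : ℂ → ℂ := fun z => H z * (wirtingerBar χ z - μ z * wirtinger χ z) with hWdef
  have mμ : MemLp μ ∞ := ⟨hμ, hμ1.trans ENNReal.one_lt_top⟩
  have mW : MemLp W 2 := by
    have h1 := hW.memH.memLp_testFunction_mul hχ.wirtingerBar
    have h2 : MemLp (fun z => μ z * (wirtinger χ z * H z)) 2 :=
      (hW.memH.memLp_testFunction_mul hχ.wirtinger).mul mμ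
    refine (h1.sub h2).ae_eq (ae_of_all _ fun z => ?_)
    simp only [hWdef, Pi.sub_apply]
    ring
  have i1 : Integrable fun z => c z * Q z := integrable_mul_of_memLp_two hC mQ
  have i2 : Integrable fun z => K z * Q z := integrable_mul_of_memLp_two hK mQ
  have i3 : Integrable fun z => k z * P z := integrable_mul_of_memLp_two hk mP
  have i4 : Integrable fun z => (c z + K z) * W z := integrable_mul_of_memLp_two mG mW
  -- The cancellation at the heart of the proof: with $\mu(c+K)=k$ and $q=\mu p+\mu C_f'$ one has
  -- $(c+K)q-kp=kC_f'$.
  have hae : ∀ᵐ z, lineCauchyDeriv f z * (χ z * k z) =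
      c z * Q z + K z * Q z - k z * P z - (c z + K z) * W z := by
    filter_upwards [hEq, hkK] with z h1 h2
    simp only [hQ, hP, hWdef]
    linear_combination (-(c z + K z) * χ z) * h1 +
      (lineCauchyDeriv f z * χ z + (χ z * p z + wirtinger χ z * H z)) * h2
  have e3 : ∫ z, lineCauchyDeriv f z * (χ z * k z) =
      (2 * Complex.I)⁻¹ * (∫ x, g x * v x) - ∫ z, (c z + K z) * W z := by
    have i12 : Integrable fun z => c z * Q z + K z * Q z := i1.add i2
    have i123 : Integrable fun z => c z * Q z + K z * Q z - k z * P z := i12.sub i3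
    rw [integral_congr_ae hae, integral_sub i123 i4, integral_sub i12 i3,
      integral_add i1 i2, e1, e2]
    ring
  have hΦ : AEStronglyMeasurable (fun z => μ z * c z) volume := hμ.mul hC.1
  have hw1 : weightedSq (fun z => μ z * c z) ≤ 12288 * A * eLpNorm g 2 volume ^ 2 :=
    weightedSq_mul_lineCauchyIntegral_le hμ hA hg _
  -- The invertibility hypothesis is applied to $\Phi=\mu c$, which the cutoff at radius $\rho$ has
  -- made compactly supported.
  have hw2 : weightedSq k ≤ B * (12288 * A * eLpNorm g 2 volume ^ 2) := by
    refine (hB _ k hΦ ?_ (hw1.trans_lt ?_) hk ?_).trans (mul_le_mul' le_rfl hw1)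
    · refine hasCompactSupport_of_norm_gt (R := ρ) fun z hz => ?_
      rw [hc, Set.indicator_of_notMem (by simpa using hz.le), mul_zero]
    · exact ENNReal.mul_lt_top (ENNReal.mul_lt_top (by norm_num) ENNReal.coe_lt_top)
        (ENNReal.pow_lt_top hg.2)
    · filter_upwards [hkK, hkS] with z h1 h2
      rw [h2, h1]
  -- The constant is $2\cdot12288=24576$: Littlewood-Paley times Carleson embedding.
  have b1 : ‖∫ z, lineCauchyDeriv f z * (χ z * k z)‖ₑ ≤
      (NNReal.sqrt (24576 * A * B) : ℝ≥0) * eLpNorm f 2 volume * eLpNorm g 2 volume := by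
    rw [← ENNReal.pow_le_pow_left_iff two_ne_zero]
    refine (sq_enorm_integral_lineCauchyDeriv_mul_le hf hk.1 hχ.continuous.aestronglyMeasurable
      hχ1).trans ((mul_le_mul' le_rfl hw2).trans_eq ?_)
    rw [mul_pow, mul_pow, ← ENNReal.coe_pow, NNReal.sq_sqrt]
    push_cast
    ring
  -- As $|\mu|\le1$ a.e., $|\overline\partial\chi-\mu\,\partial\chi|\le2C$, and both derivatives
  -- vanish off `S`.
  have b2 : ‖∫ z, (c z + K z) * W z‖ₑ ≤ δ := by
    rw [← ENNReal.pow_le_pow_left_iff two_ne_zero]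
    refine (sq_enorm_integral_mul_le_of_annulus (S := S) (H := H) (c := ENNReal.ofReal (2 * C))
      mG.1 mW.1 ENNReal.ofReal_ne_top (fun z hz => ?_) ?_).trans
      ((mul_le_mul' hD le_rfl).trans hδ)
    · simp only [hWdef]
      rw [(hχS z hz).1, (hχS z hz).2]
      ring
    · filter_upwards [ae_enorm_le_one hμ1] with z hz
      simp only [hWdef]
      rw [enorm_mul, mul_comm]
      refine mul_le_mul' ?_ le_rfl
      have h1 : ‖μ z‖ ≤ 1 := by
        rw [← ofReal_norm] at hz
        exact ENNReal.ofReal_le_one.1 hz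
      rw [← ofReal_norm]
      refine ENNReal.ofReal_le_ofReal ((norm_sub_le _ _).trans ?_)
      rw [norm_mul]
      have := hχC z
      nlinarith [norm_nonneg (wirtinger χ z)]
  have e4 : ∫ x, g x * v x = (2 * Complex.I) * ((∫ z, lineCauchyDeriv f z * (χ z * k z)) +
      ∫ z, (c z + K z) * W z) := by
    rw [e3, sub_add_cancel, ← mul_assoc, mul_inv_cancel₀ (by simp), one_mul]
  rw [e4, enorm_mul]
  have h2 : ‖2 * Complex.I‖ₑ = 2 := by
    rw [← ofReal_norm, norm_mul, Complex.norm_I, mul_one, Complex.norm_ofNat, ENNReal.ofReal_ofNat]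
  rw [h2]
  exact mul_le_mul' le_rfl ((enorm_add_le _ _).trans (add_le_add b1 b2))

/-- The traces of the dyadic localizations of `H`, tested against a compactly supported `g`. -/
lemma exists_enorm_integral_mul_trace_le (hμ : AEStronglyMeasurable μ)
    (hμ1 : eLpNorm μ ∞ volume < 1)
    (hA : IsCarlesonWith (dilatationMeasure μ) A) (hB : InvertibleWith μ B) (hf : MemLp f 2)
    (hW : IsW12Loc H p q) (hH : VanishesAtInfty H)
    (hEq : ∀ᵐ z, q z - μ z * p z = μ z * lineCauchyDeriv f z)
    {χ : ℕ → ℂ → ℂ} {C : ℝ} (hC : 0 ≤ C) (hχ : ∀ j, IsTestFunction (χ j) ∧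
      (∀ z, ‖χ j z‖ ≤ 1) ∧ (∀ z, 2 ^ (j + 1) < ‖z‖ → χ j z = 0) ∧
      (∀ z ∉ dyadicAnnulus j, wirtinger (χ j) z = 0 ∧ wirtingerBar (χ j) z = 0) ∧
      ∀ z, ‖wirtinger (χ j) z‖ ≤ C / 2 ^ j ∧ ‖wirtingerBar (χ j) z‖ ≤ C / 2 ^ j)
    {v : ℕ → ℝ → ℂ} (hv : ∀ j, MemLp (v j) 2)
    (hlim : ∀ j, Tendsto (fun n => eLpNorm
      (fun x : ℝ => mollify n (fun z => χ j z * H z) x - v j x) 2 volume) atTop (𝓝 0))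
    {g : ℝ → ℂ} (hg : MemLp g 2) {M : ℝ} (hgM : ∀ x, M < |x| → g x = 0) (J : ℕ) {δ : ℝ≥0∞}
    (hδ : δ ≠ 0) :
    ∃ j, J ≤ j ∧ ‖∫ x, g x * v j x‖ₑ ≤ 2 * ((NNReal.sqrt (24576 * A * B) : ℝ≥0) *
      eLpNorm f 2 volume * eLpNorm g 2 volume + δ) := by
  have hg1 : Integrable g := by
    have h1 : MemLp g 2 (volume.restrict (Set.Icc (-M) M)) := hg.restrict _
    have h2 : IntegrableOn g (Set.Icc (-M) M) := h1.integrable (by norm_num)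
    rw [← integrableOn_univ]
    refine h2.of_forall_sdiff_eq_zero MeasurableSet.univ fun x hx => hgM x ?_
    by_contra h
    exact hx.2 (abs_le.1 (not_lt.1 h))
  obtain ⟨C₀, hC₀⟩ := exists_beltrami_solution hμ hμ1
  obtain ⟨C₁, hC₁⟩ := exists_lintegral_ball_lineCauchyIntegral_le hg hg1 hgM
  -- The factor $(1+C_0)^2$ comes from $\|c+K\|_2\le(1+C_0)\|c\|_2$, and $4C_1$ from the logarithmic
  -- growth. `D` does not depend on the radius $\rho$, so the threshold $N_0$ can be fixed before
  -- $\rho$ and $k$ are chosen.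
  set D : ℝ≥0∞ := (1 + C₀) ^ 2 * C₁ * 4 with hD
  have hDt : D ≠ ⊤ := by
    rw [hD]
    exact ENNReal.mul_ne_top (ENNReal.mul_ne_top (ENNReal.pow_ne_top (by simp)) (by simp))
      (by norm_num)
  have hsmall : ∀ᶠ j : ℕ in atTop, D * (ENNReal.ofReal (2 * (C / 2 ^ j)) ^ 2 *
      ∫⁻ z in dyadicAnnulus j, ‖H z‖ₑ ^ 2) ≤ δ ^ 2 := by
    have t := ENNReal.Tendsto.const_mul (a := D * ENNReal.ofReal (4 * C ^ 2))
      (tendsto_dyadicAnnulus_of_vanishesAtInfty hW.memH hH)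
      (Or.inr (ENNReal.mul_ne_top hDt ENNReal.ofReal_ne_top))
    rw [mul_zero] at t
    filter_upwards [t.eventually_le_const (show 0 < δ ^ 2 by positivity)] with j hj
    refine le_trans (le_of_eq ?_) hj
    rw [mul_assoc D, ← mul_assoc (ENNReal.ofReal (4 * C ^ 2)), ← ENNReal.ofReal_pow (by positivity),
      ← ENNReal.ofReal_mul (by positivity)]
    congr 3
    field_simp
    ring
  obtain ⟨N₀, hN₀⟩ := eventually_atTop.1 hsmall
  set N := max (max J N₀) 1 with hN
  have hN1 : 0 < N := lt_of_lt_of_le one_pos (le_max_right _ _)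
  -- For $j<2N$ the cutoff $\chi_j$ vanishes beyond $2^{j+1}\le2^{2N}$, so $\rho=2\cdot2^{2N}$
  -- leaves room for the mollification radius $1$. One $\rho$, and hence one $k$, serves every
  -- candidate $j$.
  set ρ : ℝ := 2 ^ (2 * N + 1) with hρ
  set c := (Metric.ball 0 ρ).indicator (lineCauchyIntegral g) with hc
  have mc : MemLp c 2 := by
    rw [hc, memLp_indicator_iff_restrict Metric.isOpen_ball.measurableSet]
    exact memLp_two_of_lintegral_lt_top (measurable_lineCauchyIntegral hg.1).aestronglyMeasurable
      (lintegral_ball_lineCauchyIntegral_lt_top hg ρ)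
  have mμ : MemLp μ ∞ := ⟨hμ, hμ1.trans ENNReal.one_lt_top⟩
  have mΦ : MemLp (fun z => μ z * c z) 2 := mc.mul mμ
  obtain ⟨k, K, hk, hK, hKn, hkK, hkS, hkw⟩ := hC₀ _ mΦ
  have hcn : eLpNorm c 2 volume ^ 2 ≤ C₁ * (4 * N) := by
    have h1 := hC₁ (2 * N + 1)
    have h2 : eLpNorm c 2 volume ^ 2 =
        ∫⁻ z in Metric.ball 0 (2 ^ (2 * N + 1)), ‖lineCauchyIntegral g z‖ₑ ^ 2 := by
      rw [hc, eLpNorm_indicator_eq_eLpNorm_restrict Metric.isOpen_ball.measurableSet,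
        lintegral_enorm_sq_eq]
    rw [h2]
    refine h1.trans (mul_le_mul' le_rfl ?_)
    have : 2 * N + 1 + 1 ≤ 4 * N := by omega
    exact_mod_cast this
  have hG : ∫⁻ z, ‖c z + K z‖ₑ ^ 2 ≤ D * N := by
    rw [lintegral_enorm_sq_eq]
    have h1 : eLpNorm (fun z => μ z * c z) 2 volume ≤ eLpNorm c 2 volume := by
      refine eLpNorm_mono_enorm_ae ?_
      filter_upwards [ae_enorm_le_one hμ1] with z hz
      rw [enorm_mul]
      exact mul_le_of_le_one_left zero_le hz
    have h2 : eLpNorm (fun z => c z + K z) 2 volume ≤ (1 + C₀) * eLpNorm c 2 volume := by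
      refine (eLpNorm_add_le mc.1 hK.1 (by norm_num)).trans ?_
      rw [add_mul, one_mul]
      exact add_le_add le_rfl (hKn.trans (mul_le_mul' le_rfl h1))
    calc _ ≤ ((1 + C₀) * eLpNorm c 2 volume) ^ 2 := pow_le_pow_left' h2 2
      _ ≤ (1 + C₀) ^ 2 * (C₁ * (4 * N)) := by
          rw [mul_pow]
          exact mul_le_mul' le_rfl hcn
      _ = _ := by rw [hD]; ring
  -- Only after $k$ has been fixed is the annulus selected, by the pigeonhole lemma.
  obtain ⟨j, hj1, hj2, hj3⟩ := exists_lintegral_dyadicAnnulus_le _ hN1 hG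
  have hJN : J ≤ N := (le_max_left _ _).trans (le_max_left _ _)
  have hNN : N₀ ≤ N := (le_max_right _ _).trans (le_max_left _ _)
  obtain ⟨h1, h2, h3, h4, h5⟩ := hχ j
  refine ⟨j, hJN.trans hj1, ?_⟩
  refine enorm_integral_mul_trace_le hμ hμ1 hA hB hf hW hEq h1 h2 h3 h4 ?_ h5 (hv j) (hlim j) hg hg1
    (ρ := ρ) ?_ hk hK hkK hkS hkw hj3 (hN₀ j (hNN.trans hj1))
  · intro z hz
    rw [pow_succ, mul_comm]
    exact hz.2.le
  · have h6 : (2 : ℝ) ^ (j + 1) ≤ 2 ^ (2 * N) := pow_le_pow_right₀ one_le_two (by omega)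
    have h7 : (1 : ℝ) < 2 ^ (2 * N) := one_lt_pow₀ one_lt_two (by omega)
    rw [hρ, pow_succ 2 (2 * N)]
    linarith

end Duality

/-! ### Gluing the local traces and conclusion -/

section Main

/-- Averages of $|a-b|\le|H-a|+|H-b|$ tend to $0$. Uniqueness makes the traces of different
localisations agree. -/
lemma tendsto_lebesgue_value_unique {H : ℂ → ℂ} (hH : LocallyIntegrable H) {x a b : ℂ}
    (ha : Tendsto (fun r : ℝ => ⨍ w in Metric.ball x r, ‖H w - a‖) (𝓝[>] 0) (𝓝 0))
    (hb : Tendsto (fun r : ℝ => ⨍ w in Metric.ball x r, ‖H w - b‖) (𝓝[>] 0) (𝓝 0)) : a = b := by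
  have h := ha.add hb
  rw [add_zero] at h
  have h1 : ‖a - b‖ ≤ 0 := by
    refine ge_of_tendsto h ?_
    filter_upwards [self_mem_nhdsWithin] with r hr
    have hr0 : 0 < r := hr
    have hHi : IntegrableOn H (Metric.ball x r) :=
      ((locallyIntegrable_iff.1 hH) _ (isCompact_closedBall x r)).mono_set Metric.ball_subset_closedBall
    have hfin : volume (Metric.ball x r) ≠ ⊤ := measure_ball_lt_top.ne
    have hpos : volume (Metric.ball x r) ≠ 0 := (Metric.measure_ball_pos volume x hr0).ne'
    have hi : ∀ c : ℂ, IntegrableOn (fun w => ‖H w - c‖) (Metric.ball x r) := fun c =>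
      (hHi.sub (integrableOn_const hfin)).norm
    have e : ⨍ _ in Metric.ball x r, ‖a - b‖ = ‖a - b‖ := setAverage_const hpos hfin _
    rw [← e, setAverage_eq, setAverage_eq, setAverage_eq, ← smul_add, ← integral_add (hi a) (hi b)]
    refine smul_le_smul_of_nonneg_left ?_ (by positivity)
    refine integral_mono (integrableOn_const hfin) ((hi a).add (hi b)) fun w => ?_
    have := norm_sub_le (H w - b) (H w - a)
    simp only [sub_sub_sub_cancel_left] at this
    rw [add_comm]
    exact this
  exact sub_eq_zero.1 (norm_le_zero_iff.1 h1)

lemma eLpNorm_two_le_of_forall_setLIntegral {u : ℝ → ℂ} {c : ℝ≥0∞}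
    (h : ∀ m : ℕ, ∫⁻ x in Set.Icc (-m : ℝ) m, ‖u x‖ₑ ^ 2 ≤ c ^ 2) : eLpNorm u 2 volume ≤ c := by
  rw [← ENNReal.pow_le_pow_left_iff two_ne_zero, ← lintegral_enorm_sq_eq]
  have hU : (⋃ m : ℕ, Set.Icc (-m : ℝ) m) = Set.univ := by
    refine Set.eq_univ_of_forall fun x => Set.mem_iUnion.2 ?_
    obtain ⟨m, hm⟩ := exists_nat_ge |x|
    exact ⟨m, abs_le.1 hm⟩
  have hd : Directed (· ⊆ ·) fun m : ℕ => Set.Icc (-m : ℝ) m := by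
    refine (Monotone.directed_le (f := fun m : ℕ => Set.Icc (-m : ℝ) m) fun a b hab => ?_)
    have : (a : ℝ) ≤ b := by exact_mod_cast hab
    exact Set.Icc_subset_Icc (by linarith) this
  rw [← setLIntegral_univ, ← hU, setLIntegral_iUnion_of_directed _ hd]
  exact iSup_le h

end Main

theorem proposition1 (A B : ℝ≥0) :
    ∃ c : ℝ≥0, 0 < c ∧
      ∀ μ : ℂ → ℂ, AEStronglyMeasurable μ → eLpNorm μ ∞ volume < 1 →
        IsCarlesonWith (dilatationMeasure μ) A →
        InvertibleWith μ B →
        ∀ f : ℝ → ℂ, MemLp f 2 →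
        ∀ H p q : ℂ → ℂ, IsW12Loc H p q → VanishesAtInfty H →
          (∀ᵐ z : ℂ, q z - μ z * p z = μ z * lineCauchyDeriv f z) →
            ∃ u : ℝ → ℂ, IsTraceOnReal H u ∧ MemLp u 2 ∧
              eLpNorm u 2 volume ≤ c * eLpNorm f 2 volume := by
  -- The summand $1$ only keeps the constant positive when $AB=0$.
  refine ⟨2 * NNReal.sqrt (24576 * A * B) + 1, by positivity, ?_⟩
  intro μ hμ hμ1 hA hB f hf H p q hW hH hEq
  obtain ⟨χ, C, hC, hχ⟩ := exists_dyadic_cutoff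
  have htr : ∀ j, ∃ v : ℝ → ℂ, MemLp v 2 ∧ IsTraceOnReal (fun z => χ j z * H z) v ∧
      Tendsto (fun n => eLpNorm (fun x : ℝ => mollify n (fun z => χ j z * H z) x - v x) 2 volume)
        atTop (𝓝 0) := by
    intro j
    obtain ⟨h1, -, -, h4, -, -⟩ := hχ j
    exact exists_isTraceOnReal (hW.memH.memLp_testFunction_mul h1)
      ((hW.memP.memLp_testFunction_mul h1).add (hW.memH.memLp_testFunction_mul h1.wirtinger))
      ((hW.memQ.memLp_testFunction_mul h1).add (hW.memH.memLp_testFunction_mul h1.wirtingerBar))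
      (fun z hz => by rw [h4 z hz, zero_mul])
      (fun ψ hψ => hW.weakDz_mul h1 hψ) fun ψ hψ => hW.weakDzBar_mul h1 hψ
  choose v hv hvtr hlim using htr
  -- Since $\chi_j=1$ for $|z|\le2^j$, small discs about such an $x$ do not see the cutoff, and the
  -- trace of $\chi_jH$ is a Lebesgue value of $H$.
  have hloc : ∀ᵐ x : ℝ, ∀ j : ℕ, |x| < 2 ^ j →
      Tendsto (fun r : ℝ => ⨍ w in Metric.ball (x : ℂ) r, ‖H w - v j x‖) (𝓝[>] 0) (𝓝 0) := by
    rw [ae_all_iff]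
    intro j
    filter_upwards [hvtr j] with x hx hxj
    refine hx.congr' ?_
    filter_upwards [Ioo_mem_nhdsGT (show 0 < 2 ^ j - |x| by linarith)] with r hr
    rw [setAverage_eq, setAverage_eq]
    congr 1
    refine setIntegral_congr_fun Metric.isOpen_ball.measurableSet fun w hw => ?_
    have hw' : ‖w‖ ≤ 2 ^ j := by
      have h1 := norm_le_norm_add_norm_sub' w (x : ℂ)
      rw [Metric.mem_ball, dist_eq_norm] at hw
      rw [Complex.norm_real, Real.norm_eq_abs] at h1
      linarith [hr.2]
    rw [(hχ j).2.2.1 w hw', one_mul]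
  have hidx : ∀ x : ℝ, |x| < 2 ^ ⌈|x|⌉₊ := fun x =>
    (Nat.le_ceil _).trans_lt (by exact_mod_cast Nat.lt_two_pow_self)
  -- The index $\lceil|x|\rceil$ is admissible because $n<2^n$.
  set u : ℝ → ℂ := fun x => v ⌈|x|⌉₊ x with hu
  have huv : ∀ᵐ x : ℝ, ∀ j : ℕ, |x| < 2 ^ j → v j x = u x := by
    filter_upwards [hloc] with x hx j hj
    exact tendsto_lebesgue_value_unique hW.memH.locallyIntegrable (hx j hj) (hx _ (hidx x))
  have hum : AEStronglyMeasurable u volume := by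
    refine aestronglyMeasurable_of_tendsto_ae atTop (fun j => (hv j).1) ?_
    filter_upwards [huv] with x hx
    refine tendsto_const_nhds.congr' ?_
    filter_upwards [eventually_ge_atTop ⌈|x|⌉₊] with j hj
    exact (hx j ((hidx x).trans_le (pow_le_pow_right₀ one_le_two hj))).symm
  have hbound : eLpNorm u 2 volume ≤
      2 * ((NNReal.sqrt (24576 * A * B) : ℝ≥0) * eLpNorm f 2 volume) := by
    refine eLpNorm_two_le_of_forall_setLIntegral fun m => ?_
    -- The extremal test function: on $[-m,m]$ the trace $v_j$ equals $u$ for all $j\ge m$, so $\int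
    -- gv_j=\|g\|_2^2$. The duality bound then becomes
    -- $\|g\|_2^2\le\mathrm{const}\cdot\|f\|_2\|g\|_2$.
    set g : ℝ → ℂ := (Set.Icc (-m : ℝ) m).indicator fun x => starRingEnd ℂ (u x) with hg
    have hIcc : ∀ x : ℝ, x ∈ Set.Icc (-m : ℝ) m → ∀ j, m ≤ j → |x| < 2 ^ j := by
      intro x hx j hj
      refine (abs_le.2 hx).trans_lt ?_
      calc (m : ℝ) ≤ j := by exact_mod_cast hj
        _ < 2 ^ j := by exact_mod_cast Nat.lt_two_pow_self
    have hgm : AEStronglyMeasurable g volume :=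
      (Complex.continuous_conj.comp_aestronglyMeasurable hum).indicator measurableSet_Icc
    have hgnorm : ∀ x, ‖g x‖ₑ = (Set.Icc (-m : ℝ) m).indicator (fun x => ‖u x‖ₑ) x := by
      intro x
      rw [hg, enorm_indicator_eq_indicator_enorm]
      congr 1
      funext y
      rw [← ofReal_norm, RCLike.norm_conj, ofReal_norm]
    have hgL : MemLp g 2 := by
      refine ⟨hgm, lt_of_le_of_lt (eLpNorm_mono_enorm_ae ?_) (hv m).2⟩
      filter_upwards [huv] with x hx
      rw [hgnorm]
      by_cases hxm : x ∈ Set.Icc (-m : ℝ) m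
      · rw [Set.indicator_of_mem hxm, hx m (hIcc x hxm m le_rfl)]
      · rw [Set.indicator_of_notMem hxm]
        exact zero_le
    have hsq : eLpNorm g 2 volume ^ 2 = ∫⁻ x in Set.Icc (-m : ℝ) m, ‖u x‖ₑ ^ 2 := by
      rw [← lintegral_enorm_sq_eq, ← lintegral_indicator measurableSet_Icc]
      refine lintegral_congr fun x => ?_
      rw [hgnorm]
      by_cases hxm : x ∈ Set.Icc (-m : ℝ) m
      · rw [Set.indicator_of_mem hxm, Set.indicator_of_mem hxm]
      · rw [Set.indicator_of_notMem hxm, Set.indicator_of_notMem hxm, zero_pow two_ne_zero]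
    have hint : ∀ j, m ≤ j → ‖∫ x, g x * v j x‖ₑ = eLpNorm g 2 volume ^ 2 := by
      intro j hj
      have h1 : ∀ᵐ x, g x * v j x = ((‖g x‖ ^ 2 : ℝ) : ℂ) := by
        filter_upwards [huv] with x hx
        by_cases hxm : x ∈ Set.Icc (-m : ℝ) m
        · rw [hg, Set.indicator_of_mem hxm, hx j (hIcc x hxm j hj), RCLike.norm_conj, mul_comm,
            Complex.mul_conj, Complex.normSq_eq_norm_sq]
        · rw [hg, Set.indicator_of_notMem hxm]
          simp
      have h2 : Integrable fun x => ‖g x‖ ^ 2 := hgL.integrable_norm_pow two_ne_zero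
      rw [integral_congr_ae h1, integral_complex_ofReal, ← lintegral_enorm_sq_eq, ← ofReal_norm,
        Complex.norm_real, Real.norm_of_nonneg (integral_nonneg fun x => by positivity),
        ofReal_integral_eq_lintegral_ofReal h2 (ae_of_all _ fun x => by positivity)]
      refine lintegral_congr fun x => ?_
      rw [ENNReal.ofReal_pow (norm_nonneg _), ofReal_norm]
    have hkey : eLpNorm g 2 volume ^ 2 ≤ 2 * ((NNReal.sqrt (24576 * A * B) : ℝ≥0) *
        eLpNorm f 2 volume * eLpNorm g 2 volume) := by
      -- The index $j$ depends on $\varepsilon$, but the left-hand side is the same for all $j\ge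
      -- m$, so $\varepsilon$ may tend to $0$.
      refine ENNReal.le_of_forall_pos_le_add fun ε hε _ => ?_
      obtain ⟨j, hj, hle⟩ := exists_enorm_integral_mul_trace_le hμ hμ1 hA hB hf hW hH hEq hC
        (fun j => ⟨(hχ j).1, (hχ j).2.1, (hχ j).2.2.2.1, (hχ j).2.2.2.2.1, (hχ j).2.2.2.2.2⟩)
        hv hlim hgL (M := m)
        (fun x hx => Set.indicator_of_notMem
          (fun h : x ∈ Set.Icc (-m : ℝ) m => absurd (abs_le.2 h) (not_le.2 hx)) _) m
        (δ := (ε / 2 : ℝ≥0)) (by positivity)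
      rw [hint j hj] at hle
      refine hle.trans_eq ?_
      rw [mul_add]
      congr 1
      rw [← ENNReal.coe_ofNat, ← ENNReal.coe_mul, mul_div_cancel₀ _ two_ne_zero]
    rw [← hsq]
    refine pow_le_pow_left' ?_ 2
    -- Dividing by $\|g\|_2$ requires it to be nonzero and finite.
    by_cases h0 : eLpNorm g 2 volume = 0
    · rw [h0]
      exact zero_le
    · rw [← ENNReal.mul_le_mul_iff_left h0 hgL.2.ne, ← sq]
      refine hkey.trans_eq ?_
      ring
  refine ⟨u, ?_, ⟨hum, hbound.trans_lt ?_⟩, hbound.trans ?_⟩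
  · filter_upwards [hloc] with x hx
    exact hx _ (hidx x)
  · exact ENNReal.mul_lt_top (by norm_num) (ENNReal.mul_lt_top ENNReal.coe_lt_top hf.2)
  · rw [← mul_assoc]
    refine mul_le_mul' ?_ le_rfl
    push_cast
    exact le_self_add
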